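/- Work in dimension $d=2$, on the torus $\mathbb T^2$ of side $2\pi$, with Fourier basis $e_k(x)=(2\pi)^{-1}e^{\iota k\cdot x}$ and $\mathbb Z^2_0=\mathbb Z^2\setminus\{0\}$. Fix $\mathfrak w\in\mathbb R^2\setminus\{0\}$; $|\cdot|$ is the Euclidean norm. Let $\Gamma=\bigoplus_{n\ge0}\Gamma_n$ be the Fock space: $\psi=(\psi_n)_n\in\Gamma$ if each $\psi_n$ is a symmetric element of $L^2((\mathbb T^2)^n)$ with zero average in each variable, so that it is given by its Fourier coefficients $\hat\psi_n(k_{1:n})$, $k_{1:n}\in(\mathbb Z^2_0)^n$, and $\|\psi\|^2=\sum_n n!\,\|\psi_n\|_{L^2}^2<\infty$; correspondingly $\langle\psi,\phi\rangle=\sum_n n!\,\langle\psi_n,\phi_n\rangle_{L^2}$. For $\varepsilon\in(0,1)$ put $\lambda_\varepsilon=(\log\varepsilon^{-2})^{-1/2}$, $$\mathrm L^\varepsilon(x)=\lambda_\varepsilon^2\log\Big(1+\frac1{\varepsilon^2x}\Big),\qquad G(x)=\frac1{|\mathfrak w|^{2}}\Big[\Big(\frac{3|\mathfrak w|^2}{2\pi}x+1\Big)^{2/3}-1\Big].$$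 With $|k_{1:n}|^2=\sum_i|k_i|^2$, let $\mathcal N$, $\mathcal L_0$, $\mathcal L_0^{\mathfrak w}$, $\mathcal G^\varepsilon=G(\mathrm L^\varepsilon(-\mathcal L_0))$ be the operators that act on $\Gamma_n$ as multiplication of $\hat\psi_n(k_{1:n})$ by $n$, $-\frac12|k_{1:n}|^2$, $-\frac12\sum_i(\mathfrak w\cdot k_i)^2$, $G(\mathrm L^\varepsilon(\frac12|k_{1:n}|^2))$, respectively. Let $\mathbb J^\varepsilon_{\ell,m}=\mathbf 1\{0<\varepsilon|\ell|\le1,\ 0<\varepsilon|m|\le1,\ 0<\varepsilon|\ell+m|\le1\}$, and define, for $f\in\Gamma_n$, the element $\mathcal A^\varepsilon_+f\in\Gamma_{n+1}$ by $$\widehat{\mathcal A^\varepsilon_+f}(k_{1:n+1})=-\frac{2\iota}{2\pi}\frac{\lambda_\varepsilon}{n+1}\sum_{1\le i<j\le n+1}[\mathfrak w\cdot(k_i+k_j)]\,\mathbb J^\varepsilon_{k_i,k_j}\,\hat f(k_i+k_j,k_{\{1:n+1\}\setminus\{i,j\}}),$$ and $\mathcal A^\varepsilon_-=-(\mathcal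 A^\varepsilon_+)^*$, that is, $\mathcal A^\varepsilon_-f=0$ for $n\le1$ and, for $f\in\Gamma_n$ with $n\ge2$, $$\widehat{\mathcal A^\varepsilon_-f}(k_{1:n-1})=-\frac{\iota}{2\pi}\,n\lambda_\varepsilon\sum_{j=1}^{n-1}(\mathfrak w\cdot k_j)\sum_{\ell+m=k_j}\mathbb J^\varepsilon_{\ell,m}\,\hat f(\ell,m,k_{\{1:n-1\}\setminus\{j\}}).$$ Set $$\mathcal R^\varepsilon=-\mathcal A^\varepsilon_-(-\mathcal L_0-\mathcal L_0^{\mathfrak w}\mathcal G^\varepsilon)^{-1}\mathcal A^\varepsilon_++\mathcal L_0^{\mathfrak w}\mathcal G^\varepsilon ,$$ an operator that maps each $\Gamma_n$ to itself. **Lemma (Replacement Lemma).** There is a constant $C>0$, depending only on $\mathfrak w$, such that for all $\varepsilon\in(0,1)$: 1. for all $\psi_1,\psi_2\in\Gamma$ with $\mathcal N(-\mathcal L_0)^{1/2}\psi_i\in\Gamma$, $i=1,2$, each component $(\mathcal R^\varepsilon\psi_1)_n$ belongs to $\Gamma_n$, the series $\langle\mathcal R^\varepsilon\psi_1,\psi_2\rangle=\sum_n\langle(\mathcal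 R^\varepsilon\psi_1)_n,(\psi_2)_n\rangle$ converges absolutely, and $$|\langle\mathcal R^\varepsilon\psi_1,\psi_2\rangle|\le C\lambda_\varepsilon^2\,\|\mathcal N(-\mathcal L_0)^{1/2}\psi_1\|\,\|\mathcal N(-\mathcal L_0)^{1/2}\psi_2\|;$$ 2. consequently $\mathcal L_0^{\mathfrak w}\mathcal G^\varepsilon$ is an approximate fixed point, chaos by chaos, of the operator equation $\mathcal L_0^{\mathfrak w}\mathcal G^\varepsilon=\mathcal A^\varepsilon_-(-\mathcal L_0-\mathcal L_0^{\mathfrak w}\mathcal G^\varepsilon)^{-1}\mathcal A^\varepsilon_+$, in the sense that for every $n\ge1$ and $\psi\in\Gamma_n$ one has $(-\mathcal L_0)^{-1/2}\mathcal R^\varepsilon(-\mathcal L_0)^{-1/2}\psi\in\Gamma_n$ and $$\|(-\mathcal L_0)^{-1/2}\mathcal R^\varepsilon(-\mathcal L_0)^{-1/2}\psi\|\le C\lambda_\varepsilon^2n^2\|\psi\|.$$ -/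

import Mathlib

noncomputable section

namespace Burgers2D

/-- Momenta: points of `ℤ²`. -/
abbrev Z2 := Fin 2 → ℤ

/-- A sequence `(ψ_n)_n` of kernels, given by their Fourier coefficients `ψ̂_n(k_1, …, k_n)` with
respect to the orthonormal basis `e_{k_1} ⊗ ⋯ ⊗ e_{k_n}` of `L²((𝕋²)ⁿ)`, where
`e_k(x) = (2π)⁻¹ exp(i k·x)` and `𝕋²` is the torus of side `2π`. -/
abbrev Family := (n : ℕ) → (Fin n → Z2) → ℂ

/-- `|k|²` for `k ∈ ℤ²` (Euclidean). -/
def sqNorm (k : Z2) : ℝ := ∑ a, (k a : ℝ) ^ 2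

/-- `𝔴 · k`. -/
def dot (w : EuclideanSpace ℝ (Fin 2)) (k : Z2) : ℝ := ∑ a, w a * (k a : ℝ)

/-- `f` is the Fourier transform of an element of the `n`-th Fock space: a symmetric, square
integrable function on `(𝕋²)ⁿ` that has zero average in each of its variables. (Kernels are
complex-valued; the real-valued ones are those with `f (-k) = conj (f k)`.) -/
structure IsKernel (n : ℕ) (f : (Fin n → Z2) → ℂ) : Prop where
  symm : ∀ (σ : Equiv.Perm (Fin n)) (k : Fin n → Z2), f (k ∘ σ) = f k
  zero_mean : ∀ k : Fin n → Z2, (∃ i, k i = 0) → f k = 0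
  sq_summable : Summable fun k => ‖f k‖ ^ 2

/-- `ψ` belongs to the Fock space `⨁_{n ≥ 0} Γ_n`: every component is a kernel and
`∑_n n! ‖ψ_n‖²_{L²} < ∞`. -/
structure MemFock (ψ : Family) : Prop where
  kernel : ∀ n, IsKernel n (ψ n)
  summable : Summable fun n => (n.factorial : ℝ) * ∑' k, ‖ψ n k‖ ^ 2

/-- `ψ` is concentrated on the `n`-th chaos. -/
def InChaos (n : ℕ) (ψ : Family) : Prop := ∀ m, m ≠ n → ψ m = 0

/-- The scalar product `⟨f, g⟩ = ∑_n n! ⟨f_n, g_n⟩_{L²}` of the Fock space. -/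
def fockInner (f g : Family) : ℂ :=
  ∑' n, (n.factorial : ℂ) * ∑' k, f n k * (starRingEnd ℂ) (g n k)

/-- The norm `‖f‖ = (∑_n n! ‖f_n‖²_{L²})^{1/2}` of the Fock space. -/
def fockNorm (f : Family) : ℝ :=
  Real.sqrt (∑' n, (n.factorial : ℝ) * ∑' k, ‖f n k‖ ^ 2)

/-- The operator, diagonal in Fourier variables, with symbol `m`. -/
def multiplier (m : (n : ℕ) → (Fin n → Z2) → ℝ) (ψ : Family) : Family :=
  fun n k => (m n k : ℂ) * ψ n k

/-- The number operator `𝒩`. -/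
def number : Family → Family := multiplier fun n _ => (n : ℝ)

/-- Symbol `½|k_{1:n}|² = ½ ∑_i |k_i|²` of `-ℒ₀`. -/
def symNegL0 (n : ℕ) (k : Fin n → Z2) : ℝ := (1 / 2) * ∑ i, sqNorm (k i)

/-- Symbol `-½ (𝔴·k)²_{1:n} = -½ ∑_i (𝔴·k_i)²` of `ℒ₀^𝔴`, i.e. of `½(𝔴·∇)²` acting on each of the
variables. -/
def symL0w (w : EuclideanSpace ℝ (Fin 2)) (n : ℕ) (k : Fin n → Z2) : ℝ :=
  -((1 / 2) * ∑ i, dot w (k i) ^ 2)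

/-- `(-ℒ₀)^{1/2}`. -/
def sqrtNegL0 : Family → Family := multiplier fun n k => Real.sqrt (symNegL0 n k)

/-- `(-ℒ₀)^{-1/2}`, on the chaoses of order at least one. -/
def invSqrtNegL0 : Family → Family := multiplier fun n k => (Real.sqrt (symNegL0 n k))⁻¹

/-- `ℒ₀^𝔴`. -/
def L0w (w : EuclideanSpace ℝ (Fin 2)) : Family → Family := multiplier (symL0w w)

/-- The coupling constant `λ_ε = (log ε⁻²)^{-1/2}`. -/
def lam (ε : ℝ) : ℝ := 1 / Real.sqrt (Real.log (ε ^ (-2 : ℤ)))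

/-- `L^ε(x) = λ_ε² log(1 + 1/(ε² x))`. -/
def Leps (ε x : ℝ) : ℝ := lam ε ^ 2 * Real.log (1 + 1 / (ε ^ 2 * x))

/-- `G(x) = |𝔴|⁻² [(3|𝔴|² x/(2π) + 1)^{2/3} - 1]`. -/
def G (w : EuclideanSpace ℝ (Fin 2)) (x : ℝ) : ℝ :=
  1 / ‖w‖ ^ 2 * ((3 * ‖w‖ ^ 2 / (2 * Real.pi) * x + 1) ^ ((2 : ℝ) / 3) - 1)

/-- Symbol `G(L^ε(½|k_{1:n}|²))` of `𝒢^ε`. -/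
def symG (ε : ℝ) (w : EuclideanSpace ℝ (Fin 2)) (n : ℕ) (k : Fin n → Z2) : ℝ :=
  G w (Leps ε (symNegL0 n k))

/-- `𝒢^ε = G(L^ε(-ℒ₀))`. -/
def Geps (ε : ℝ) (w : EuclideanSpace ℝ (Fin 2)) : Family → Family := multiplier (symG ε w)

/-- `(-ℒ₀ - ℒ₀^𝔴 𝒢^ε)⁻¹`, on the chaoses of order at least one (where the symbol that is inverted
is positive at nonzero momenta). -/
def resolvent (ε : ℝ) (w : EuclideanSpace ℝ (Fin 2)) : Family → Family :=
  multiplier fun n k => (symNegL0 n k - symL0w w n k * symG ε w n k)⁻¹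

open Classical in
/-- The cut-off `𝕁^ε_{ℓ,m} = 1{0 < ε|ℓ| ≤ 1, 0 < ε|m| ≤ 1, 0 < ε|ℓ+m| ≤ 1}`, Euclidean norms. -/
def cutoff (ε : ℝ) (l m : Z2) : ℝ :=
  if (0 < ε * √(sqNorm l) ∧ ε * √(sqNorm l) ≤ 1) ∧ (0 < ε * √(sqNorm m) ∧ ε * √(sqNorm m) ≤ 1) ∧
      (0 < ε * √(sqNorm (l + m)) ∧ ε * √(sqNorm (l + m)) ≤ 1)
  then 1 else 0

/-- The momenta obtained from `k_1, …, k_{n+1}` by replacing `k_i` by `k_i + k_j` and deleting `k_j`: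
up to the order (immaterial for symmetric kernels), `(k_i + k_j, k_{{1:n+1} ∖ {i,j}})`. -/
def merge {n : ℕ} (k : Fin (n + 1) → Z2) (i j : Fin (n + 1)) : Fin n → Z2 :=
  j.removeNth (Function.update k i (k i + k j))

/-- The momenta obtained from `k_1, …, k_n` by splitting `k_j` into `l` and `k_j - l`:
up to the order, `(l, k_j - l, k_{{1:n} ∖ {j}})`. -/
def split {n : ℕ} (k : Fin n → Z2) (j : Fin n) (l : Z2) : Fin (n + 1) → Z2 :=
  Fin.cons l (Function.update k j (k j - l))

/-- The creation operator `𝒜^ε_+`. -/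
def Aplus (ε : ℝ) (w : EuclideanSpace ℝ (Fin 2)) (ψ : Family) : Family
  | 0, _ => 0
  | n + 1, k =>
    -(2 * Complex.I / (2 * Real.pi)) * ((lam ε : ℂ) / (n + 1)) *
      ∑ i : Fin (n + 1), ∑ j ∈ Finset.Ioi i,
        (dot w (k i + k j) : ℂ) * (cutoff ε (k i) (k j) : ℂ) * ψ n (merge k i j)

/-- The annihilation operator `𝒜^ε_-`, vanishing on the first chaos. The numerical factor is the one
for which `𝒜^ε_- = -(𝒜^ε_+)^*`, see `Aplus_adjoint`. The sum over `l` has finitely many nonzero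
terms. -/
def Aminus (ε : ℝ) (w : EuclideanSpace ℝ (Fin 2)) (ψ : Family) : Family :=
  fun n k =>
    -(Complex.I / (2 * Real.pi)) * ((n : ℂ) + 1) * (lam ε : ℂ) *
      ∑ j : Fin n, (dot w (k j) : ℂ) *
        ∑' l : Z2, (cutoff ε l (k j - l) : ℂ) * ψ (n + 1) (split k j l)

/-- The operator `-𝒜^ε_- (-ℒ₀ - ℒ₀^𝔴 𝒢^ε)⁻¹ 𝒜^ε_+ + ℒ₀^𝔴 𝒢^ε`. -/
def replacementOp (ε : ℝ) (w : EuclideanSpace ℝ (Fin 2)) (ψ : Family) : Family :=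
  -Aminus ε w (resolvent ε w (Aplus ε w ψ)) + L0w w (Geps ε w ψ)

/-! Helper facts: the creation and annihilation operators are, up to sign, adjoint. -/

theorem sqNorm_finite (R : ℝ) : {l : Z2 | sqNorm l ≤ R}.Finite := by
  have hs : {l : Z2 | sqNorm l ≤ R} ⊆ Set.Icc (fun _ => -⌈R⌉) (fun _ => ⌈R⌉) := by
    intro l hl
    have key : ∀ a, |l a| ≤ ⌈R⌉ := by
      intro a
      have h1 : (l a : ℝ) ^ 2 ≤ sqNorm l :=
        Finset.single_le_sum (f := fun a => (l a : ℝ) ^ 2) (fun _ _ => sq_nonneg _)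
          (Finset.mem_univ a)
      have h2 : |l a| ≤ l a ^ 2 := by
        rw [← sq_abs]
        nlinarith [abs_nonneg (l a), Int.le_self_sq |l a|]
      have h3 : ((l a ^ 2 : ℤ) : ℝ) ≤ (⌈R⌉ : ℝ) := by
        push_cast
        exact (h1.trans hl).trans (Int.le_ceil R)
      exact h2.trans (by exact_mod_cast h3)
    exact ⟨fun a => (abs_le.1 (key a)).1, fun a => (abs_le.1 (key a)).2⟩
  exact (Set.finite_Icc _ _).subset hs

theorem cutoff_finite {ε : ℝ} (hε : 0 < ε) :
    ∃ B : Finset Z2, ∀ l m, cutoff ε l m ≠ 0 → l ∈ B ∧ l + m ∈ B := by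
  classical
  refine ⟨(sqNorm_finite ((1 / ε) ^ 2)).toFinset, fun l m h => ?_⟩
  have aux : ∀ p : Z2, ε * √(sqNorm p) ≤ 1 → sqNorm p ≤ (1 / ε) ^ 2 := by
    intro p hp
    have : √(sqNorm p) ≤ 1 / ε := by rw [le_div_iff₀ hε]; linarith
    exact (Real.sqrt_le_left (by positivity)).1 this
  unfold cutoff at h
  split_ifs at h with h'
  · exact ⟨(Set.Finite.mem_toFinset _).2 (aux l h'.1.2),
      (Set.Finite.mem_toFinset _).2 (aux (l + m) h'.2.2.2)⟩
  · exact absurd rfl h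

theorem cutoff_comm (ε : ℝ) (l m : Z2) : cutoff ε l m = cutoff ε m l := by
  unfold cutoff
  rw [add_comm m l]
  congr 1
  simp only [eq_iff_iff]
  tauto

theorem cutoff_le_one (ε : ℝ) (l m : Z2) : |cutoff ε l m| ≤ 1 := by
  unfold cutoff; split_ifs <;> simp

theorem merge_comm {n : ℕ} {f : (Fin n → Z2) → ℂ} (hf : IsKernel n f) (k : Fin (n + 1) → Z2)
    (i j : Fin (n + 1)) : f (merge k j i) = f (merge k i j) := by
  let e : {x : Fin (n + 1) // x ≠ i} ≃ {x : Fin (n + 1) // x ≠ j} :=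
    (Equiv.swap i j).subtypeEquiv fun a => by
      rw [Ne, Ne, not_iff_not, Equiv.swap_apply_eq_iff, Equiv.swap_apply_right]
  let σ : Equiv.Perm (Fin n) :=
    ((finSuccAboveEquiv i).trans e).trans (finSuccAboveEquiv j).symm
  have hσ : ∀ a, j.succAbove (σ a) = Equiv.swap i j (i.succAbove a) := by
    intro a
    have := (finSuccAboveEquiv j).apply_symm_apply (e (finSuccAboveEquiv i a))
    exact congrArg Subtype.val this
  rw [← hf.symm σ (merge k i j)]
  congr 1
  funext a
  simp only [merge, Function.comp, Fin.removeNth, hσ]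
  have ha : i.succAbove a ≠ i := Fin.succAbove_ne i a
  by_cases h : i.succAbove a = j
  · rw [h, Equiv.swap_apply_right, Function.update_self, Function.update_self, add_comm]
  · rw [Equiv.swap_apply_of_ne_of_ne ha h, Function.update_of_ne h, Function.update_of_ne ha]

/-- Splitting, with the two new momenta put in the places `j` and `j.succAbove a`. -/
def splitEquiv {n : ℕ} (j : Fin (n + 1)) (a : Fin n) :
    (Z2 × (Fin n → Z2)) ≃ (Fin (n + 1) → Z2) where
  toFun p := Fin.insertNth (α := fun _ => Z2) j p.1 (Function.update p.2 a (p.2 a - p.1))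
  invFun k := (k j, merge k (j.succAbove a) j)
  left_inv p := by
    refine Prod.ext (by simp) ?_
    funext b
    simp only [merge, Fin.removeNth]
    by_cases h : b = a
    · subst h; simp
    · rw [Function.update_of_ne (by simpa using h)]; simp [h]
  right_inv k := by
    funext b
    refine Fin.succAboveCases j ?_ (fun b => ?_) b
    · simp
    · by_cases h : b = a
      · subst h; simp [merge, Fin.removeNth]
      · simp [merge, Fin.removeNth, h]

theorem split_symm {n : ℕ} {g : (Fin (n + 1) → Z2) → ℂ} (hg : IsKernel (n + 1) g)
    (j : Fin (n + 1)) (a : Fin n) (l : Z2) (q : Fin n → Z2) :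
    g (splitEquiv j a (l, q)) = g (split q a l) := by
  have := hg.symm (Fin.cycleRange j).symm⁻¹ (splitEquiv j a (l, q))
  rw [← hg.symm (Fin.cycleRange j) (split q a l)]
  congr 1
  simp only [splitEquiv, split, Equiv.coe_fn_mk, Fin.cons_comp_cycleRange]

theorem sum_lt_eq {n : ℕ} (X : Fin (n + 1) → Fin (n + 1) → ℂ)
    (hX : ∀ i j, i ≠ j → X i j = X j i) :
    2 * ∑ i, ∑ j ∈ Finset.Ioi i, X i j = ∑ j, ∑ a, X (j.succAbove a) j := by
  have h1 : ∀ j, ∑ a, X (j.succAbove a) j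
      = (∑ i ∈ Finset.Iio j, X i j) + ∑ i ∈ Finset.Ioi j, X i j := by
    intro j
    have h2 : ∑ a, X (j.succAbove a) j = ∑ i ∈ ({j}ᶜ : Finset (Fin (n + 1))), X i j := by
      rw [← Fin.image_succAbove_univ, Finset.sum_image
        (fun _ _ _ _ h => Fin.succAbove_right_injective h)]
    rw [h2, ← Finset.sum_union]
    · congr 1
      ext i
      simp [lt_or_lt_iff_ne]
    · exact Finset.disjoint_left.2 fun i hi hi' => by
        simp at hi hi'
        exact absurd hi (not_lt.2 hi'.le)
  simp only [h1, Finset.sum_add_distrib]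
  have h3 : ∑ j, ∑ i ∈ Finset.Iio j, X i j = ∑ i, ∑ j ∈ Finset.Ioi i, X i j :=
    Finset.sum_comm' (by simp)
  have h4 : ∑ j, ∑ i ∈ Finset.Ioi j, X i j = ∑ i, ∑ j ∈ Finset.Ioi i, X i j :=
    Finset.sum_congr rfl fun i _ => Finset.sum_congr rfl fun j hj =>
      hX j i (Finset.mem_Ioi.1 hj).ne'
  rw [h3, h4]
  ring

set_option maxHeartbeats 1000000 in
/-- `𝒜^ε_- = -(𝒜^ε_+)^*`: for `f` in the `n`-th and `g` in the `(n+1)`-th Fock space,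
`⟨𝒜^ε_+ f, g⟩ = -⟨f, 𝒜^ε_- g⟩`. -/
theorem Aplus_adjoint {ε : ℝ} (hε : 0 < ε) (w : EuclideanSpace ℝ (Fin 2)) (n : ℕ) (f g : Family)
    (hf : IsKernel n (f n)) (hg : IsKernel (n + 1) (g (n + 1))) :
    ((n + 1).factorial : ℂ) * ∑' k, Aplus ε w f (n + 1) k * (starRingEnd ℂ) (g (n + 1) k)
      = -((n.factorial : ℂ) * ∑' k, f n k * (starRingEnd ℂ) (Aminus ε w g n k)) := by
  classical
  obtain ⟨B, hB⟩ := cutoff_finite hε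
  set D : ℝ := ∑ p ∈ B, |dot w p| with hD
  -- the common value of all the pieces
  let t : Fin n → Z2 × (Fin n → Z2) → ℂ := fun a p =>
    (dot w (p.2 a) : ℂ) * (cutoff ε p.1 (p.2 a - p.1) : ℂ) * f n p.2 *
      (starRingEnd ℂ) (g (n + 1) (split p.2 a p.1))
  have ht : ∀ a, Summable (t a) := by
    intro a
    have s1 : Summable fun p : Z2 × (Fin n → Z2) => (if p.1 ∈ B then (1 : ℝ) else 0) * ‖f n p.2‖ ^ 2 :=
      Summable.mul_of_nonneg (f := fun l : Z2 => if l ∈ B then (1 : ℝ) else 0)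
        (summable_of_ne_finset_zero (s := B) fun b hb => by simp [hb]) hf.sq_summable
        (fun l => by dsimp; split_ifs <;> simp) (fun _ => sq_nonneg _)
    have s2 : Summable fun p : Z2 × (Fin n → Z2) => ‖g (n + 1) (split p.2 a p.1)‖ ^ 2 := by
      have := (splitEquiv (0 : Fin (n + 1)) a).summable_iff.2 hg.sq_summable
      refine this.congr fun p => ?_
      simp only [Function.comp]
      rw [← split_symm hg 0 a p.1 p.2]
    refine Summable.of_norm_bounded ((s1.add s2).mul_left D) fun p => ?_
    by_cases h : cutoff ε p.1 (p.2 a - p.1) = 0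
    · simp only [t, h]
      have hD0 : 0 ≤ D := Finset.sum_nonneg fun _ _ => abs_nonneg _
      have : 0 ≤ (if p.1 ∈ B then (1 : ℝ) else 0) := by split_ifs <;> simp
      simp only [Complex.ofReal_zero, mul_zero, zero_mul, norm_zero]
      positivity
    · obtain ⟨h1, h2⟩ := hB _ _ h
      rw [add_sub_cancel] at h2
      have h3 : |dot w (p.2 a)| ≤ D :=
        Finset.single_le_sum (f := fun p => |dot w p|) (fun _ _ => abs_nonneg _) h2
      have h4 := cutoff_le_one ε p.1 (p.2 a - p.1)
      simp only [t, norm_mul, Complex.norm_real, Real.norm_eq_abs, RCLike.norm_conj, if_pos h1,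
        one_mul]
      set x := ‖f n p.2‖
      set y := ‖g (n + 1) (split p.2 a p.1)‖
      have hx : 0 ≤ x := norm_nonneg _
      have hy : 0 ≤ y := norm_nonneg _
      have h5 : |dot w (p.2 a)| * |cutoff ε p.1 (p.2 a - p.1)| ≤ D * 1 :=
        mul_le_mul h3 h4 (abs_nonneg _) ((abs_nonneg _).trans h3)
      calc _ ≤ D * 1 * x * y := by gcongr
        _ = D * (x * y) := by ring
        _ ≤ D * (x ^ 2 + y ^ 2) := by
          have : 0 ≤ D := (abs_nonneg _).trans h3
          gcongr
          nlinarith [sq_nonneg (x - y)]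
  -- the pieces of `⟨𝒜_+ f, g⟩`
  let X : (Fin (n + 1) → Z2) → Fin (n + 1) → Fin (n + 1) → ℂ := fun k i j =>
    (dot w (k i + k j) : ℂ) * (cutoff ε (k i) (k j) : ℂ) * f n (merge k i j) *
      (starRingEnd ℂ) (g (n + 1) k)
  have hXs : ∀ k i j, i ≠ j → X k i j = X k j i := by
    intro k i j _
    simp only [X]
    rw [add_comm, cutoff_comm, merge_comm hf k j i]
  have hXt : ∀ (j : Fin (n + 1)) (a : Fin n),
      (fun k => X k (j.succAbove a) j) ∘ splitEquiv j a = t a := by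
    intro j a
    funext p
    obtain ⟨l, q⟩ := p
    have e1 : (splitEquiv j a (l, q)) j = l := by simp [splitEquiv]
    have e2 : (splitEquiv j a (l, q)) (j.succAbove a) = q a - l := by simp [splitEquiv]
    have e3 : merge (splitEquiv j a (l, q)) (j.succAbove a) j = q :=
      congrArg Prod.snd ((splitEquiv j a).left_inv (l, q))
    simp only [Function.comp, X, t]
    rw [e1, e2, e3, split_symm hg, sub_add_cancel, cutoff_comm]
  have hsum : ∀ (j : Fin (n + 1)) (a : Fin n), HasSum (fun k => X k (j.succAbove a) j) (∑' p, t a p) := by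
    intro j a
    rw [← (splitEquiv j a).hasSum_iff, hXt]
    exact (ht a).hasSum
  have hL : HasSum (fun k => Aplus ε w f (n + 1) k * (starRingEnd ℂ) (g (n + 1) k))
      (-(2 * Complex.I / (2 * Real.pi)) * ((lam ε : ℂ) / (n + 1)) *
        (1 / 2 * ∑ _j : Fin (n + 1), ∑ a, ∑' p, t a p)) := by
    have h1 : HasSum (fun k => ∑ j, ∑ a, X k (j.succAbove a) j)
        (∑ _j : Fin (n + 1), ∑ a, ∑' p, t a p) :=
      hasSum_sum fun j _ => hasSum_sum fun a _ => hsum j a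
    refine ((h1.mul_left (1 / 2)).mul_left
      (-(2 * Complex.I / (2 * Real.pi)) * ((lam ε : ℂ) / (n + 1)))).congr_fun ?_
    intro k
    rw [← sum_lt_eq (X k) (hXs k)]
    simp only [Aplus, X, ← Finset.sum_mul]
    ring
  have hR : ∀ a, HasSum (fun q : Fin n → Z2 => f n q * ((dot w (q a) : ℂ) *
      (starRingEnd ℂ) (∑' l : Z2, (cutoff ε l (q a - l) : ℂ) * g (n + 1) (split q a l))))
      (∑' p, t a p) := by
    intro a
    have h1 := ((ht a).prod_symm).hasSum
    have h2 : ∑' p : (Fin n → Z2) × Z2, t a p.swap = ∑' p, t a p :=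
      (Equiv.prodComm _ _).tsum_eq (t a)
    rw [h2] at h1
    refine (h1.prod_fiberwise fun q => ?_)
    have h3 : Summable fun l : Z2 => (cutoff ε l (q a - l) : ℂ) * g (n + 1) (split q a l) :=
      summable_of_ne_finset_zero (s := B) fun l hl => by
        have : cutoff ε l (q a - l) = 0 := by
          by_contra h
          exact hl (hB _ _ h).1
        simp [this]
    have h4 := (h3.hasSum.map (starRingEnd ℂ) Complex.continuous_conj).mul_left
      (f n q * (dot w (q a) : ℂ))
    rw [mul_assoc] at h4
    refine h4.congr_fun ?_
    intro l
    simp [t]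
    ring
  have hR' : HasSum (fun q => f n q * (starRingEnd ℂ) (Aminus ε w g n q))
      (Complex.I / (2 * Real.pi) * ((n : ℂ) + 1) * (lam ε : ℂ) * ∑ a, ∑' p, t a p) := by
    refine ((hasSum_sum fun a (_ : a ∈ Finset.univ) => hR a).mul_left
      (Complex.I / (2 * Real.pi) * ((n : ℂ) + 1) * (lam ε : ℂ))).congr_fun ?_
    intro q
    simp only [Aminus, map_mul, map_neg, map_sum, map_div₀, Complex.conj_I, map_add, map_one,
      Complex.conj_ofReal, map_natCast, map_ofNat, Finset.mul_sum]
    refine Finset.sum_congr rfl fun a _ => ?_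
    ring
  rw [hL.tsum_eq, hR'.tsum_eq, Nat.factorial_succ]
  have hn : (n : ℂ) + 1 ≠ 0 := by exact_mod_cast n.succ_ne_zero
  simp only [Finset.sum_const, Finset.card_univ, Fintype.card_fin, nsmul_eq_mul]
  push_cast
  field_simp

end Burgers2D

end

open Burgers2D

/-!
On the `n`-th chaos `-𝒜^ε_- (-ℒ₀ - ℒ₀^𝔴 𝒢^ε)⁻¹ 𝒜^ε_+` is a sum over pairs of pairings: `𝒜^ε_-`
splits a momentum `k_j` into `l` and `k_j - l`, and `𝒜^ε_+` merges two of the resulting `n + 1`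
momenta.

When `l` and `k_j - l` are merged again, the operator is a Fourier multiplier whose symbol is a
lattice sum over `l`. Comparing the sum with an integral over the plane and using polar coordinates,
the angular integral is explicit and, because `π G' √(1 + |𝔴|² G) = 1`, the radial one is that of
the derivative of `G ∘ L^ε`. Hence the multiplier cancels `ℒ₀^𝔴 𝒢^ε` up to an error of order
`λ_ε² |k|²`.

When a different pair is merged, each of the two pairs has an element outside the other, and
Cauchy–Schwarz with a weight that is summable in the momentum split off gives a bound of order
`λ_ε² n²` by the energies `‖(-ℒ₀)^{1/2} ·‖²`.
-/

noncomputable section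

namespace Burgers2D

open MeasureTheory Set Filter Topology
open scoped ENNReal

/-- The lattice point at the lower left corner of the unit cell containing `z`; it turns sums over
`ℤ²` into integrals over the plane. -/
def cellCorner (z : ℝ × ℝ) : Z2 := ![⌊z.1⌋, ⌊z.2⌋]

theorem measurable_cellCorner : Measurable cellCorner := by
  refine measurable_pi_iff.2 fun a => ?_
  fin_cases a
  · exact Int.measurable_floor.comp measurable_fst
  · exact Int.measurable_floor.comp measurable_snd

theorem map_cellCorner_volume : (volume : Measure (ℝ × ℝ)).map cellCorner = Measure.count := by
  refine Measure.ext_of_singleton fun l => ?_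
  have hcell : cellCorner ⁻¹' {l} = Ico (l 0 : ℝ) (l 0 + 1) ×ˢ Ico (l 1 : ℝ) (l 1 + 1) := by
    ext z
    simp only [mem_preimage, mem_singleton_iff, cellCorner, mem_prod, mem_Ico, ← Int.floor_eq_iff,
      funext_iff, Fin.forall_fin_two, Matrix.cons_val_zero, Matrix.cons_val_one]
  rw [Measure.map_apply measurable_cellCorner (measurableSet_singleton l), Measure.count_singleton,
    hcell, Measure.volume_eq_prod, Measure.prod_prod]
  simp

theorem lintegral_comp_cellCorner (F : Z2 → ℝ≥0∞) : ∫⁻ z, F (cellCorner z) = ∑' l, F l := by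
  rw [← lintegral_count, ← map_cellCorner_volume,
    lintegral_map (measurable_of_countable F) measurable_cellCorner]

theorem abs_sub_cellCorner_le (z : ℝ × ℝ) :
    |z.1 - cellCorner z 0| ≤ 1 ∧ |z.2 - cellCorner z 1| ≤ 1 := by
  have key (t : ℝ) : |t - ⌊t⌋| ≤ 1 := by
    rw [Int.self_sub_floor, abs_of_nonneg (Int.fract_nonneg t)]
    exact (Int.fract_lt_one t).le
  exact ⟨key z.1, key z.2⟩

theorem lintegral_polar {f : ℝ × ℝ → ℝ≥0∞} (hf : Measurable f) :
    ∫⁻ z, f z = ∫⁻ r in Ioi (0 : ℝ), ENNReal.ofReal r *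
      ∫⁻ θ in Ioo (-Real.pi) Real.pi, f (r * Real.cos θ, r * Real.sin θ) := by
  rw [← lintegral_comp_polarCoord_symm, polarCoord_target, Measure.volume_eq_prod,
    ← Measure.prod_restrict, lintegral_prod]
  · refine lintegral_congr fun r => ?_
    simp only [polarCoord_symm_apply, smul_eq_mul]
    exact lintegral_const_mul _ (hf.comp (by fun_prop))
  · simp only [polarCoord_symm_apply, smul_eq_mul]
    exact ((by fun_prop : Measurable fun z : ℝ × ℝ => ENNReal.ofReal z.1).mul
      (hf.comp (by fun_prop))).aemeasurable

theorem mul_cos_sq_add_mul_sin_sq (r θ : ℝ) :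
    (r * Real.cos θ) ^ 2 + (r * Real.sin θ) ^ 2 = r ^ 2 := by
  linear_combination r ^ 2 * Real.cos_sq_add_sin_sq θ

theorem lintegral_comp_sq_add_sq {f : ℝ → ℝ≥0∞} (hf : Measurable f) :
    ∫⁻ z : ℝ × ℝ, f (z.1 ^ 2 + z.2 ^ 2) =
      ENNReal.ofReal (2 * Real.pi) * ∫⁻ r in Ioi (0 : ℝ), ENNReal.ofReal r * f (r ^ 2) := by
  rw [lintegral_polar (f := fun z => f (z.1 ^ 2 + z.2 ^ 2)) (by fun_prop),
    ← lintegral_const_mul _ (by fun_prop)]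
  refine lintegral_congr fun r => ?_
  simp only [mul_cos_sq_add_mul_sin_sq, lintegral_const, Measure.restrict_apply_univ,
    Real.volume_Ioo]
  rw [show Real.pi - -Real.pi = 2 * Real.pi by ring]
  ring

theorem lintegral_Ioi_of_hasDerivAt {F F' : ℝ → ℝ} {a l : ℝ}
    (hF : ∀ x ∈ Ici a, HasDerivAt F (F' x) x) (hF' : ∀ x ∈ Ioi a, 0 ≤ F' x)
    (hl : Tendsto F atTop (𝓝 l)) :
    ∫⁻ x in Ioi a, ENNReal.ofReal (F' x) = ENNReal.ofReal (l - F a) := by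
  rw [← integral_Ioi_of_hasDerivAt_of_nonneg' hF hF' hl, ofReal_integral_eq_lintegral_ofReal]
  · exact integrableOn_Ioi_deriv_of_nonneg' hF hF' hl
  · exact (ae_restrict_iff' measurableSet_Ioi).2 (ae_of_all _ hF')

theorem lintegral_Ioi_div_sq_add_sq {K : ℝ} (hK : 0 < K) :
    ∫⁻ r in Ioi (0 : ℝ), ENNReal.ofReal (K / (r ^ 2 + K ^ 2)) = ENNReal.ofReal (Real.pi / 2) := by
  rw [lintegral_Ioi_of_hasDerivAt (F := fun r => Real.arctan (r / K)) (l := Real.pi / 2)]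
  · simp
  · intro r _
    refine ((hasDerivAt_id' r).div_const K).arctan.congr_deriv ?_
    field_simp
    ring
  · intro r _
    positivity
  · exact (Real.tendsto_arctan_atTop.mono_right nhdsWithin_le_nhds).comp
      (tendsto_id.atTop_div_const hK)

/-! ### A lattice weight with uniformly bounded sum -/

theorem sqNorm_eq (k : Z2) : sqNorm k = (k 0 : ℝ) ^ 2 + (k 1 : ℝ) ^ 2 := by
  simp [sqNorm, Fin.sum_univ_two]

theorem sqNorm_nonneg (k : Z2) : 0 ≤ sqNorm k :=
  Finset.sum_nonneg fun _ _ => sq_nonneg _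

theorem sqNorm_zero : sqNorm 0 = 0 := by
  simp [sqNorm]

theorem one_le_sqNorm {k : Z2} (hk : k ≠ 0) : 1 ≤ sqNorm k := by
  obtain ⟨a, ha⟩ := Function.ne_iff.1 hk
  have hint : (1 : ℤ) ≤ k a ^ 2 := Int.add_one_le_iff.2 (sq_pos_of_ne_zero ha)
  calc (1 : ℝ) ≤ (k a : ℝ) ^ 2 := by exact_mod_cast hint
    _ ≤ sqNorm k := Finset.single_le_sum (f := fun a => (k a : ℝ) ^ 2)
      (fun _ _ => sq_nonneg _) (Finset.mem_univ a)

/-- The weight `K / (⟨l⟩ (|l|² + K²))` as a function of `s = |l|²`, where `⟨l⟩² = |l|² + 1`. It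
dominates all error terms, and its sum over `l ∈ ℤ²` is bounded uniformly in `K ≥ 1/2`. -/
def weight (K s : ℝ) : ℝ := K / (√(s + 1) * (s + K ^ 2))

theorem weight_nonneg {K s : ℝ} (hK : 0 ≤ K) (hs : 0 ≤ s) : 0 ≤ weight K s := by
  unfold weight
  positivity

theorem sq_add_sq_le_sqNorm_cellCorner (z : ℝ × ℝ) :
    z.1 ^ 2 + z.2 ^ 2 ≤ 2 * sqNorm (cellCorner z) + 4 := by
  obtain ⟨h₁, h₂⟩ := abs_sub_cellCorner_le z
  rw [← sq_le_one_iff_abs_le_one] at h₁ h₂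
  rw [sqNorm_eq]
  nlinarith [sq_nonneg (z.1 - 2 * cellCorner z 0), sq_nonneg (z.2 - 2 * cellCorner z 1)]

theorem sqNorm_cellCorner_le (z : ℝ × ℝ) :
    sqNorm (cellCorner z) ≤ 2 * (z.1 ^ 2 + z.2 ^ 2) + 4 := by
  obtain ⟨h₁, h₂⟩ := abs_sub_cellCorner_le z
  rw [← sq_le_one_iff_abs_le_one] at h₁ h₂
  rw [sqNorm_eq]
  nlinarith [sq_nonneg (2 * z.1 - cellCorner z 0), sq_nonneg (2 * z.2 - cellCorner z 1)]

theorem weight_le_weight {K a b : ℝ} (hK : 1 / 2 ≤ K) (ha : 0 ≤ a) (hb : 0 ≤ b)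
    (hab : b ≤ 2 * a + 4) : weight K a ≤ 60 * weight K b := by
  have hK₀ : 0 < K := by linarith
  have hsqrt : √(b + 1) ≤ 3 * √(a + 1) := by
    rw [Real.sqrt_le_left (by positivity), mul_pow, Real.sq_sqrt (by positivity)]
    linarith
  have hsq : b + K ^ 2 ≤ 20 * (a + K ^ 2) := by nlinarith
  rw [weight, weight, mul_div_assoc', div_le_div_iff₀ (by positivity) (by positivity)]
  calc K * (√(b + 1) * (b + K ^ 2)) ≤ K * (3 * √(a + 1) * (20 * (a + K ^ 2))) := by gcongr
    _ = 60 * K * (√(a + 1) * (a + K ^ 2)) := by ring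

theorem mul_weight_sq_le {K r : ℝ} (hK : 0 < K) (hr : 0 < r) :
    r * weight K (r ^ 2) ≤ K / (r ^ 2 + K ^ 2) := by
  have hr' : r ≤ √(r ^ 2 + 1) := Real.le_sqrt_of_sq_le (by linarith)
  calc r * weight K (r ^ 2) = r / √(r ^ 2 + 1) * (K / (r ^ 2 + K ^ 2)) := by
        rw [weight]; field_simp
    _ ≤ 1 * (K / (r ^ 2 + K ^ 2)) := by
        gcongr
        exact (div_le_one (by positivity)).2 hr'
    _ = K / (r ^ 2 + K ^ 2) := one_mul _

theorem lintegral_weight_le {K : ℝ} (hK : 0 < K) :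
    ∫⁻ z : ℝ × ℝ, ENNReal.ofReal (weight K (z.1 ^ 2 + z.2 ^ 2)) ≤ ENNReal.ofReal (Real.pi ^ 2) := by
  have hmeas : Measurable fun s => ENNReal.ofReal (weight K s) := by
    unfold weight
    fun_prop
  calc ∫⁻ z : ℝ × ℝ, ENNReal.ofReal (weight K (z.1 ^ 2 + z.2 ^ 2))
      = ENNReal.ofReal (2 * Real.pi) *
          ∫⁻ r in Ioi (0 : ℝ), ENNReal.ofReal r * ENNReal.ofReal (weight K (r ^ 2)) :=
        lintegral_comp_sq_add_sq hmeas
    _ ≤ ENNReal.ofReal (2 * Real.pi) *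
          ∫⁻ r in Ioi (0 : ℝ), ENNReal.ofReal (K / (r ^ 2 + K ^ 2)) := by
        gcongr _ * ?_
        refine setLIntegral_mono' measurableSet_Ioi fun r (hr : 0 < r) => ?_
        rw [← ENNReal.ofReal_mul hr.le]
        exact ENNReal.ofReal_le_ofReal (mul_weight_sq_le hK hr)
    _ = ENNReal.ofReal (Real.pi ^ 2) := by
        rw [lintegral_Ioi_div_sq_add_sq hK, ← ENNReal.ofReal_mul (by positivity)]
        congr 1
        ring

theorem tsum_weight_sqNorm_le {K : ℝ} (hK : 1 / 2 ≤ K) :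
    ∑' l, ENNReal.ofReal (weight K (sqNorm l)) ≤ ENNReal.ofReal (60 * Real.pi ^ 2) := by
  rw [← lintegral_comp_cellCorner, ENNReal.ofReal_mul (by norm_num)]
  calc ∫⁻ z, ENNReal.ofReal (weight K (sqNorm (cellCorner z)))
      ≤ ∫⁻ z : ℝ × ℝ, ENNReal.ofReal 60 * ENNReal.ofReal (weight K (z.1 ^ 2 + z.2 ^ 2)) := by
        refine lintegral_mono fun z => ?_
        rw [← ENNReal.ofReal_mul (by norm_num)]
        exact ENNReal.ofReal_le_ofReal (weight_le_weight hK (sqNorm_nonneg _) (by positivity)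
          (sq_add_sq_le_sqNorm_cellCorner z))
    _ ≤ ENNReal.ofReal 60 * ENNReal.ofReal (Real.pi ^ 2) := by
        rw [lintegral_const_mul' _ _ ENNReal.ofReal_ne_top]
        gcongr
        exact lintegral_weight_le (by linarith)

/-! ### The continuum integral -/

theorem hasDerivAt_arctan_angle {u v : ℝ → ℝ} {s θ : ℝ} (hu : HasDerivAt u (v θ) θ)
    (hv : HasDerivAt v (-u θ) θ) (hs : 0 < s) (huv : 0 < u θ ^ 2 + v θ ^ 2) :
    HasDerivAt (fun θ => Real.arctan ((s - 1) * (u θ * v θ) / (s * u θ ^ 2 + v θ ^ 2)))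
      (s * (u θ ^ 2 + v θ ^ 2) / (s ^ 2 * u θ ^ 2 + v θ ^ 2) - 1) θ := by
  have hden {c : ℝ} (hc : 0 < c) : 0 < c * u θ ^ 2 + v θ ^ 2 := by
    rcases eq_or_ne (u θ) 0 with h | h
    · rw [h] at huv ⊢
      linarith
    · positivity
  have hden₁ := hden hs
  have hden₂ := hden (pow_pos hs 2)
  refine (((hu.fun_mul hv).const_mul (s - 1)).fun_div
    (((hu.fun_pow 2).const_mul s).fun_add (hv.fun_pow 2)) hden₁.ne').arctan.congr_deriv ?_
  generalize u θ = x at *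
  generalize v θ = y at *
  have hsec : 1 + ((s - 1) * (x * y) / (s * x ^ 2 + y ^ 2)) ^ 2 =
      (x ^ 2 + y ^ 2) * (s ^ 2 * x ^ 2 + y ^ 2) / (s * x ^ 2 + y ^ 2) ^ 2 := by
    field_simp
    ring
  rw [hsec, div_mul_eq_mul_div, div_sub_one hden₂.ne']
  field_simp
  ring

section Angular

variable {p q b : ℝ}

theorem hasDerivAt_angular_primitive (hpq : 0 < p ^ 2 + q ^ 2) (hb : 0 ≤ b) (θ : ℝ) :
    HasDerivAt (fun θ => (θ + Real.arctan
        ((√(1 + b * (p ^ 2 + q ^ 2)) - 1) *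
          ((p * Real.cos θ + q * Real.sin θ) * (q * Real.cos θ - p * Real.sin θ)) /
          (√(1 + b * (p ^ 2 + q ^ 2)) * (p * Real.cos θ + q * Real.sin θ) ^ 2 +
            (q * Real.cos θ - p * Real.sin θ) ^ 2))) / √(1 + b * (p ^ 2 + q ^ 2)))
      (1 / (1 + b * (p * Real.cos θ + q * Real.sin θ) ^ 2)) θ := by
  -- With `u = p cos θ + q sin θ`, `v = u'` and `s² = 1 + b (p² + q²)` the arctangent is the angle
  -- between `(v, u)` and `(v, s u)`, so that `θ + arctan …` is, up to a constant, the continuous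
  -- determination of `arctan (s u / v)`.
  have hs : 0 < √(1 + b * (p ^ 2 + q ^ 2)) := Real.sqrt_pos.2 (by positivity)
  have hs₂ : √(1 + b * (p ^ 2 + q ^ 2)) ^ 2 = 1 + b * (p ^ 2 + q ^ 2) :=
    Real.sq_sqrt (by positivity)
  set s := √(1 + b * (p ^ 2 + q ^ 2))
  have hu : HasDerivAt (fun θ => p * Real.cos θ + q * Real.sin θ)
      (q * Real.cos θ - p * Real.sin θ) θ :=
    (((Real.hasDerivAt_cos θ).const_mul p).fun_add
      ((Real.hasDerivAt_sin θ).const_mul q)).congr_deriv (by ring)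
  have hv : HasDerivAt (fun θ => q * Real.cos θ - p * Real.sin θ)
      (-(p * Real.cos θ + q * Real.sin θ)) θ :=
    (((Real.hasDerivAt_cos θ).const_mul q).fun_sub
      ((Real.hasDerivAt_sin θ).const_mul p)).congr_deriv (by ring)
  have huv : (p * Real.cos θ + q * Real.sin θ) ^ 2 + (q * Real.cos θ - p * Real.sin θ) ^ 2 =
      p ^ 2 + q ^ 2 := by
    linear_combination (p ^ 2 + q ^ 2) * Real.cos_sq_add_sin_sq θ
  refine (((hasDerivAt_id' θ).fun_add
    (hasDerivAt_arctan_angle hu hv hs (huv ▸ hpq))).div_const s).congr_deriv ?_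
  have hden : s ^ 2 * (p * Real.cos θ + q * Real.sin θ) ^ 2 +
      (q * Real.cos θ - p * Real.sin θ) ^ 2 =
        (p ^ 2 + q ^ 2) * (1 + b * (p * Real.cos θ + q * Real.sin θ) ^ 2) := by
    rw [hs₂]
    linear_combination huv
  rw [huv, hden, add_sub_cancel]
  field_simp

theorem lintegral_angular (hpq : 0 < p ^ 2 + q ^ 2) (hb : 0 ≤ b) :
    ∫⁻ θ in Ioo (-Real.pi) Real.pi,
        ENNReal.ofReal (1 / (1 + b * (p * Real.cos θ + q * Real.sin θ) ^ 2)) =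
      ENNReal.ofReal (2 * Real.pi / √(1 + b * (p ^ 2 + q ^ 2))) := by
  have hcont : Continuous fun θ => 1 / (1 + b * (p * Real.cos θ + q * Real.sin θ) ^ 2) :=
    continuous_const.div (by fun_prop) fun θ => by positivity
  rw [restrict_Ioo_eq_restrict_Ioc, ← ofReal_integral_eq_lintegral_ofReal
    (hcont.integrableOn_Icc.mono_set Ioc_subset_Icc_self) (ae_of_all _ fun θ => by positivity),
    ← intervalIntegral.integral_of_le (by linarith [Real.pi_pos]),
    intervalIntegral.integral_eq_sub_of_hasDerivAt
      (fun θ _ => hasDerivAt_angular_primitive hpq hb θ) (hcont.intervalIntegrable _ _)]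
  congr 1
  simp only [Real.cos_neg, Real.cos_pi, Real.sin_neg, Real.sin_pi]
  ring_nf

end Angular

section Symbols

variable {ε : ℝ} {w : EuclideanSpace ℝ (Fin 2)}

theorem norm_sq_eq (w : EuclideanSpace ℝ (Fin 2)) : ‖w‖ ^ 2 = w 0 ^ 2 + w 1 ^ 2 := by
  simp [EuclideanSpace.real_norm_sq_eq, Fin.sum_univ_two]

theorem log_zpow_neg_two_pos (hε₀ : 0 < ε) (hε₁ : ε < 1) : 0 < Real.log (ε ^ (-2 : ℤ)) :=
  Real.log_pos (one_lt_zpow_of_neg₀ hε₀ hε₁ (by norm_num))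

theorem lam_sq (hε₀ : 0 < ε) (hε₁ : ε < 1) : lam ε ^ 2 = 1 / Real.log (ε ^ (-2 : ℤ)) := by
  rw [lam, div_pow, one_pow, Real.sq_sqrt (log_zpow_neg_two_pos hε₀ hε₁).le]

theorem lam_pos (hε₀ : 0 < ε) (hε₁ : ε < 1) : 0 < lam ε :=
  one_div_pos.2 (Real.sqrt_pos.2 (log_zpow_neg_two_pos hε₀ hε₁))

theorem four_le_zpow_neg_two (hε₀ : 0 < ε) (hε : ε ≤ 1 / 2) : 4 ≤ ε ^ (-2 : ℤ) := by
  rw [zpow_neg, zpow_ofNat, le_inv_comm₀ (by norm_num) (by positivity)]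
  nlinarith

theorem lam_sq_le_one (hε₀ : 0 < ε) (hε : ε ≤ 1 / 2) : lam ε ^ 2 ≤ 1 := by
  have hε₄ := four_le_zpow_neg_two hε₀ hε
  have hlog : 1 ≤ Real.log (ε ^ (-2 : ℤ)) := by
    rw [Real.le_log_iff_exp_le (by positivity)]
    linarith [Real.exp_one_lt_d9]
  rw [lam_sq hε₀ (by linarith), div_le_one (by positivity)]
  exact hlog

theorem Leps_nonneg (ε : ℝ) {x : ℝ} (hx : 0 ≤ x) : 0 ≤ Leps ε x :=
  mul_nonneg (sq_nonneg _) (Real.log_nonneg (le_add_of_nonneg_right (by positivity)))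

theorem Leps_le (hε₀ : 0 < ε) {x : ℝ} (hx : 0 < x) : Leps ε x ≤ lam ε ^ 2 * (1 / (ε ^ 2 * x)) := by
  refine mul_le_mul_of_nonneg_left ?_ (sq_nonneg _)
  linarith [Real.log_le_sub_one_of_pos (x := 1 + 1 / (ε ^ 2 * x)) (by positivity)]

theorem Leps_le_three (hε₀ : 0 < ε) (hε : ε ≤ 1 / 2) {x : ℝ} (hx : 1 / 8 ≤ x) : Leps ε x ≤ 3 := by
  have hu₄ := four_le_zpow_neg_two hε₀ hε
  rw [Leps, lam_sq hε₀ (by linarith), one_div_mul_eq_div,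
    div_le_iff₀ (log_zpow_neg_two_pos hε₀ (by linarith))]
  have hle : 1 / (ε ^ 2 * x) ≤ 8 * ε ^ (-2 : ℤ) := by
    rw [zpow_neg, zpow_ofNat, div_le_iff₀ (by positivity)]
    calc (1 : ℝ) ≤ 8 * x := by linarith
      _ = 8 * (ε ^ 2)⁻¹ * (ε ^ 2 * x) := by field_simp
  set u := ε ^ (-2 : ℤ)
  calc Real.log (1 + 1 / (ε ^ 2 * x)) ≤ Real.log (u ^ 3) := by
        refine Real.log_le_log (by positivity) ?_
        nlinarith [mul_nonneg (sub_nonneg.2 hu₄) (by positivity : 0 ≤ u),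
          mul_nonneg (sub_nonneg.2 hu₄) (by positivity : 0 ≤ u ^ 2)]
    _ = 3 * Real.log u := by simp [Real.log_pow]

theorem hasDerivAt_Leps (hε₀ : 0 < ε) {x : ℝ} (hx : 0 < x) :
    HasDerivAt (Leps ε) (-(lam ε ^ 2 / (x * (1 + ε ^ 2 * x)))) x := by
  have hinner : HasDerivAt (fun x => 1 + 1 / (ε ^ 2 * x)) (-(1 / (ε ^ 2 * x ^ 2))) x := by
    simp only [one_div]
    refine ((((hasDerivAt_id' x).const_mul (ε ^ 2)).fun_inv
      (by positivity)).const_add 1).congr_deriv ?_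
    field_simp
  refine ((hinner.log (by positivity)).const_mul (lam ε ^ 2)).congr_deriv ?_
  field_simp
  ring

theorem tendsto_Leps (hε₀ : 0 < ε) : Tendsto (Leps ε) atTop (𝓝 0) := by
  have hinner : Tendsto (fun x : ℝ => 1 + 1 / (ε ^ 2 * x)) atTop (𝓝 1) := by
    have : Tendsto (fun x : ℝ => ε ^ 2 * x) atTop atTop :=
      tendsto_id.const_mul_atTop (by positivity)
    simpa using this.inv_tendsto_atTop.const_add 1
  have hlim := (hinner.log one_ne_zero).const_mul (lam ε ^ 2)
  rwa [Real.log_one, mul_zero] at hlim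

/-- The symbol of `𝒢^ε` as a function of the symbol of `-ℒ₀`. -/
def gSym (ε : ℝ) (w : EuclideanSpace ℝ (Fin 2)) (x : ℝ) : ℝ := G w (Leps ε x)

theorem one_le_slope (w : EuclideanSpace ℝ (Fin 2)) {x : ℝ} (hx : 0 ≤ x) :
    1 ≤ 3 * ‖w‖ ^ 2 / (2 * Real.pi) * x + 1 :=
  le_add_of_nonneg_left (by positivity)

theorem gSym_nonneg (ε : ℝ) (w : EuclideanSpace ℝ (Fin 2)) {x : ℝ} (hx : 0 ≤ x) :
    0 ≤ gSym ε w x :=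
  mul_nonneg (by positivity) (sub_nonneg.2
    (Real.one_le_rpow (one_le_slope w (Leps_nonneg ε hx)) (by norm_num)))

theorem measurable_gSym (ε : ℝ) (w : EuclideanSpace ℝ (Fin 2)) : Measurable (gSym ε w) := by
  unfold gSym G Leps
  fun_prop

theorem tendsto_gSym (hε₀ : 0 < ε) (w : EuclideanSpace ℝ (Fin 2)) :
    Tendsto (gSym ε w) atTop (𝓝 0) := by
  have hlim := (((((tendsto_Leps hε₀).const_mul (3 * ‖w‖ ^ 2 / (2 * Real.pi))).add_const
    1).rpow_const (p := 2 / 3) (Or.inl (by simp))).sub_const 1).const_mul (1 / ‖w‖ ^ 2)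
  simp only [mul_zero, zero_add, Real.one_rpow, sub_self] at hlim
  exact hlim

theorem gSym_le_Leps (hw : w ≠ 0) {x : ℝ} (hx : 0 ≤ x) : gSym ε w x ≤ Leps ε x / Real.pi := by
  have hw₀ : 0 < ‖w‖ := norm_pos_iff.2 hw
  have hbernoulli := rpow_one_add_le_one_add_mul_self
    (s := 3 * ‖w‖ ^ 2 / (2 * Real.pi) * Leps ε x) (p := 2 / 3)
    (by linarith [one_le_slope w (Leps_nonneg ε hx)]) (by norm_num) (by norm_num)
  rw [gSym, G, add_comm]
  calc 1 / ‖w‖ ^ 2 * ((1 + 3 * ‖w‖ ^ 2 / (2 * Real.pi) * Leps ε x) ^ ((2 : ℝ) / 3) - 1)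
      ≤ 1 / ‖w‖ ^ 2 * (2 / 3 * (3 * ‖w‖ ^ 2 / (2 * Real.pi) * Leps ε x)) := by
        gcongr
        linarith
    _ = Leps ε x / Real.pi := by field_simp

theorem gSym_le_inv (hw : w ≠ 0) (hε₀ : 0 < ε) {x : ℝ} (hx : 0 < x) :
    gSym ε w x ≤ lam ε ^ 2 * (1 / (ε ^ 2 * x)) :=
  calc gSym ε w x ≤ Leps ε x / Real.pi := gSym_le_Leps hw hx.le
    _ ≤ Leps ε x := div_le_self (Leps_nonneg ε hx.le) (by linarith [Real.pi_gt_three])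
    _ ≤ lam ε ^ 2 * (1 / (ε ^ 2 * x)) := Leps_le hε₀ hx

theorem gSym_le_one (hw : w ≠ 0) (hε₀ : 0 < ε) (hε : ε ≤ 1 / 2) {x : ℝ} (hx : 1 / 8 ≤ x) :
    gSym ε w x ≤ 1 := by
  refine (gSym_le_Leps hw (by linarith)).trans ((div_le_one Real.pi_pos).2 ?_)
  linarith [Leps_le_three hε₀ hε hx, Real.pi_gt_three]

theorem sqrt_one_add_gSym (hw : w ≠ 0) {x : ℝ} (hx : 0 ≤ x) :
    √(1 + gSym ε w x * ‖w‖ ^ 2) =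
      (3 * ‖w‖ ^ 2 / (2 * Real.pi) * Leps ε x + 1) ^ ((1 : ℝ) / 3) := by
  have hw₀ : ‖w‖ ≠ 0 := norm_ne_zero_iff.2 hw
  have hslope := one_le_slope w (Leps_nonneg ε hx)
  rw [Real.sqrt_eq_iff_mul_self_eq_of_pos (by positivity), ← Real.rpow_add (by positivity), gSym, G]
  field_simp
  norm_num

/-- This is the ordinary differential equation that determines `G`: the factor
`√(1 + gSym ε w x * ‖w‖ ^ 2)` is produced by the angular integral `lintegral_angular`. -/
theorem hasDerivAt_gSym (hε₀ : 0 < ε) (hw : w ≠ 0) {x : ℝ} (hx : 0 < x) :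
    HasDerivAt (gSym ε w) (-(lam ε ^ 2 / Real.pi /
      (x * (1 + ε ^ 2 * x) * √(1 + gSym ε w x * ‖w‖ ^ 2)))) x := by
  have hw₀ : ‖w‖ ≠ 0 := norm_ne_zero_iff.2 hw
  have hslope : 0 < 3 * ‖w‖ ^ 2 / (2 * Real.pi) * Leps ε x + 1 :=
    one_pos.trans_le (one_le_slope w (Leps_nonneg ε hx.le))
  refine ((((((hasDerivAt_Leps hε₀ hx).const_mul (3 * ‖w‖ ^ 2 / (2 * Real.pi))).add_const
    1).rpow_const (p := 2 / 3) (Or.inl hslope.ne')).sub_const 1).const_mul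
      (1 / ‖w‖ ^ 2)).congr_deriv ?_
  rw [sqrt_one_add_gSym hw hx.le, show (2 : ℝ) / 3 - 1 = -(1 / 3) by norm_num,
    Real.rpow_neg hslope.le]
  field_simp

theorem abs_gSym_sub_le (hw : w ≠ 0) (hε₀ : 0 < ε) (hε : ε ≤ 1 / 2) {m x y : ℝ} (hm : 0 < m)
    (hx : m ≤ x) (hy : m ≤ y) : |gSym ε w x - gSym ε w y| ≤ 1 / m * |x - y| := by
  refine (convex_Ici m).norm_image_sub_le_of_norm_hasDerivWithin_le (f := gSym ε w)
    (fun z hz => (hasDerivAt_gSym hε₀ hw (hm.trans_le hz)).hasDerivWithinAt)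
    (fun z (hz : m ≤ z) => ?_) hy hx
  have hz₀ : 0 < z := hm.trans_le hz
  have hsqrt : 1 ≤ √(1 + gSym ε w z * ‖w‖ ^ 2) := Real.one_le_sqrt.2
    (le_add_of_nonneg_right (mul_nonneg (gSym_nonneg ε w hz₀.le) (sq_nonneg _)))
  have hcut : 1 ≤ 1 + ε ^ 2 * z := le_add_of_nonneg_right (by positivity)
  have hpi : 1 ≤ Real.pi := by linarith [Real.pi_gt_three]
  rw [norm_neg, Real.norm_of_nonneg (by positivity), div_div]
  refine div_le_div₀ zero_le_one (lam_sq_le_one hε₀ hε) hm ?_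
  calc m ≤ z := hz
    _ = 1 * (z * 1 * 1) := by ring
    _ ≤ Real.pi * (z * (1 + ε ^ 2 * z) * √(1 + gSym ε w z * ‖w‖ ^ 2)) := by gcongr

/-- The symbol of `(-ℒ₀ - ℒ₀^𝔴 𝒢^ε)⁻¹` as a function of the symbols `x` of `-ℒ₀` and `q` of
`-ℒ₀^𝔴`. -/
def resSym (ε : ℝ) (w : EuclideanSpace ℝ (Fin 2)) (x q : ℝ) : ℝ := (x + q * gSym ε w x)⁻¹

theorem resSym_nonneg (ε : ℝ) (w : EuclideanSpace ℝ (Fin 2)) {x q : ℝ} (hx : 0 ≤ x) (hq : 0 ≤ q) :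
    0 ≤ resSym ε w x q :=
  inv_nonneg.2 (add_nonneg hx (mul_nonneg hq (gSym_nonneg ε w hx)))

theorem resSym_le_inv (ε : ℝ) (w : EuclideanSpace ℝ (Fin 2)) {x q : ℝ} (hx : 0 < x) (hq : 0 ≤ q) :
    resSym ε w x q ≤ x⁻¹ :=
  inv_anti₀ hx (le_add_of_nonneg_right (mul_nonneg hq (gSym_nonneg ε w hx.le)))

/-- The continuum counterpart `(|z|² + A) (𝔴·z)² / |z|²` of the symbol of `-ℒ₀^𝔴` at the momenta
obtained by splitting off `z` from a configuration whose symbol of `-ℒ₀` is `A`. The factor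
`(|z|² + A) / |z|²`, which is of lower order, makes the angular integral explicit. -/
def planarL0w (w : EuclideanSpace ℝ (Fin 2)) (A : ℝ) (z : ℝ × ℝ) : ℝ :=
  (z.1 ^ 2 + z.2 ^ 2 + A) * ((w 0 * z.1 + w 1 * z.2) ^ 2 / (z.1 ^ 2 + z.2 ^ 2))

/-- The continuum counterpart, with a smooth cut-off, of the summand of the diagonal part of
`𝒜^ε_- (-ℒ₀ - ℒ₀^𝔴 𝒢^ε)⁻¹ 𝒜^ε_+`. -/
def density (ε : ℝ) (w : EuclideanSpace ℝ (Fin 2)) (A : ℝ) (z : ℝ × ℝ) : ℝ :=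
  resSym ε w (z.1 ^ 2 + z.2 ^ 2 + A) (planarL0w w A z) / (1 + ε ^ 2 * (z.1 ^ 2 + z.2 ^ 2 + A))

theorem planarL0w_nonneg (w : EuclideanSpace ℝ (Fin 2)) {A : ℝ} (hA : 0 ≤ A) (z : ℝ × ℝ) :
    0 ≤ planarL0w w A z := by
  unfold planarL0w
  positivity

theorem density_nonneg (ε : ℝ) (w : EuclideanSpace ℝ (Fin 2)) {A : ℝ} (hA : 0 ≤ A) (z : ℝ × ℝ) :
    0 ≤ density ε w A z :=
  div_nonneg (resSym_nonneg ε w (by positivity) (planarL0w_nonneg w hA z)) (by positivity)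

theorem measurable_density (ε : ℝ) (w : EuclideanSpace ℝ (Fin 2)) (A : ℝ) :
    Measurable (density ε w A) := by
  have := measurable_gSym ε w
  unfold density resSym planarL0w
  fun_prop

theorem density_polar (ε : ℝ) (w : EuclideanSpace ℝ (Fin 2)) (A : ℝ) {r : ℝ} (hr : r ≠ 0) (θ : ℝ) :
    density ε w A (r * Real.cos θ, r * Real.sin θ) =
      1 / ((r ^ 2 + A) * (1 + ε ^ 2 * (r ^ 2 + A))) *
        (1 / (1 + gSym ε w (r ^ 2 + A) * (w 0 * Real.cos θ + w 1 * Real.sin θ) ^ 2)) := by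
  have hdir : (w 0 * (r * Real.cos θ) + w 1 * (r * Real.sin θ)) ^ 2 / r ^ 2 =
      (w 0 * Real.cos θ + w 1 * Real.sin θ) ^ 2 := by
    field_simp
  simp only [density, resSym, planarL0w, mul_cos_sq_add_mul_sin_sq, hdir]
  rw [div_mul_div_comm, one_mul, inv_eq_one_div, div_div]
  congr 1
  ring

theorem lintegral_density_circle (hw : w ≠ 0) {A r : ℝ} (hA : 0 ≤ A) (hr : 0 < r) :
    ∫⁻ θ in Ioo (-Real.pi) Real.pi,
        ENNReal.ofReal (density ε w A (r * Real.cos θ, r * Real.sin θ)) =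
      ENNReal.ofReal (2 * Real.pi / ((r ^ 2 + A) * (1 + ε ^ 2 * (r ^ 2 + A)) *
        √(1 + gSym ε w (r ^ 2 + A) * ‖w‖ ^ 2))) := by
  have hw₀ : 0 < w 0 ^ 2 + w 1 ^ 2 := by
    rw [← norm_sq_eq]
    have := norm_pos_iff.2 hw
    positivity
  have hfactor : 0 ≤ 1 / ((r ^ 2 + A) * (1 + ε ^ 2 * (r ^ 2 + A))) := by positivity
  simp only [density_polar ε w A hr.ne', ENNReal.ofReal_mul hfactor]
  rw [lintegral_const_mul _ (by fun_prop),
    lintegral_angular hw₀ (gSym_nonneg ε w (by positivity)), ← ENNReal.ofReal_mul hfactor,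
    div_mul_div_comm, one_mul, norm_sq_eq]

theorem hasDerivAt_radial_primitive (hε₀ : 0 < ε) (hε₁ : ε < 1) (hw : w ≠ 0) {A : ℝ} (hA : 0 < A)
    (r : ℝ) :
    HasDerivAt (fun r => -(Real.pi ^ 2 / lam ε ^ 2 * gSym ε w (r ^ 2 + A)))
      (r * (2 * Real.pi / ((r ^ 2 + A) * (1 + ε ^ 2 * (r ^ 2 + A)) *
        √(1 + gSym ε w (r ^ 2 + A) * ‖w‖ ^ 2)))) r := by
  have hY : 0 < r ^ 2 + A := by positivity
  have hg := gSym_nonneg ε w hY.le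
  have hlam := lam_pos hε₀ hε₁
  refine ((((hasDerivAt_gSym hε₀ hw hY).comp r (((hasDerivAt_id' r).fun_pow 2).add_const
    A)).const_mul (Real.pi ^ 2 / lam ε ^ 2)).neg).congr_deriv ?_
  have hsqrt : 0 < √(1 + gSym ε w (r ^ 2 + A) * ‖w‖ ^ 2) := Real.sqrt_pos.2 (by positivity)
  field_simp
  push_cast
  ring

theorem lintegral_density (hε₀ : 0 < ε) (hε₁ : ε < 1) (hw : w ≠ 0) {A : ℝ} (hA : 0 < A) :
    ∫⁻ z, ENNReal.ofReal (density ε w A z) =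
      ENNReal.ofReal (Real.pi ^ 2 / lam ε ^ 2 * gSym ε w A) := by
  have hlim : Tendsto (fun r => -(Real.pi ^ 2 / lam ε ^ 2 * gSym ε w (r ^ 2 + A))) atTop
      (𝓝 0) := by
    have hY : Tendsto (fun r : ℝ => r ^ 2 + A) atTop atTop :=
      tendsto_atTop_add_const_right _ _ (tendsto_pow_atTop two_ne_zero)
    simpa using (((tendsto_gSym hε₀ w).comp hY).const_mul (Real.pi ^ 2 / lam ε ^ 2)).neg
  have hradial := lintegral_Ioi_of_hasDerivAt (a := 0)
    (fun r _ => hasDerivAt_radial_primitive hε₀ hε₁ hw hA r)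
    (fun r (hr : 0 < r) => by positivity) hlim
  rw [zero_pow two_ne_zero, zero_add, zero_sub, neg_neg] at hradial
  rw [lintegral_polar (measurable_density ε w A).ennreal_ofReal, ← hradial]
  refine setLIntegral_congr_fun measurableSet_Ioi fun r (hr : 0 < r) => ?_
  rw [lintegral_density_circle hw hA.le hr, ENNReal.ofReal_mul hr.le]

end Symbols

/-! ### The symbols at a split configuration -/

theorem mul_add_mul_sq_le (a b c d : ℝ) :
    (a * c + b * d) ^ 2 ≤ (a ^ 2 + b ^ 2) * (c ^ 2 + d ^ 2) := by
  nlinarith [sq_nonneg (a * d - b * c)]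

theorem dot_eq (w : EuclideanSpace ℝ (Fin 2)) (k : Z2) : dot w k = w 0 * k 0 + w 1 * k 1 := by
  simp [dot, Fin.sum_univ_two]

theorem dot_sq_le (w : EuclideanSpace ℝ (Fin 2)) (k : Z2) :
    dot w k ^ 2 ≤ ‖w‖ ^ 2 * sqNorm k := by
  rw [dot_eq, norm_sq_eq, sqNorm_eq]
  exact mul_add_mul_sq_le _ _ _ _

theorem dot_sub (w : EuclideanSpace ℝ (Fin 2)) (p l : Z2) : dot w (p - l) = dot w p - dot w l := by
  simp only [dot_eq, Pi.sub_apply, Int.cast_sub]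
  ring

theorem cutoff_eq_zero_or_one (ε : ℝ) (l m : Z2) : cutoff ε l m = 0 ∨ cutoff ε l m = 1 :=
  (ite_eq_or_eq _ _ _).symm

theorem cutoff_nonneg (ε : ℝ) (l m : Z2) : 0 ≤ cutoff ε l m := by
  rcases cutoff_eq_zero_or_one ε l m with h | h <;> simp [h]

theorem cutoff_ne_zero_iff {ε : ℝ} (hε₀ : 0 < ε) {l m : Z2} :
    cutoff ε l m ≠ 0 ↔ (l ≠ 0 ∧ ε ^ 2 * sqNorm l ≤ 1) ∧ (m ≠ 0 ∧ ε ^ 2 * sqNorm m ≤ 1) ∧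
      (l + m ≠ 0 ∧ ε ^ 2 * sqNorm (l + m) ≤ 1) := by
  have hpos (p : Z2) : 0 < ε * √(sqNorm p) ↔ p ≠ 0 := by
    rw [mul_pos_iff_of_pos_left hε₀, Real.sqrt_pos]
    exact ⟨fun h hp => by simp [hp, sqNorm] at h, fun h => one_pos.trans_le (one_le_sqNorm h)⟩
  have hle (p : Z2) : ε * √(sqNorm p) ≤ 1 ↔ ε ^ 2 * sqNorm p ≤ 1 := by
    rw [← sq_le_one_iff₀ (by positivity), mul_pow, Real.sq_sqrt (sqNorm_nonneg p)]
  simp only [cutoff, hpos, hle, ne_eq, ite_eq_right_iff, one_ne_zero, imp_false, not_not]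

section Split

variable {n : ℕ} {k : Fin n → Z2} {j : Fin n}

theorem sum_split {M : Type*} [AddCommGroup M] (F : Z2 → M) (k : Fin n → Z2) (j : Fin n) (l : Z2) :
    ∑ i, F (split k j l i) = ∑ i, F (k i) + (F l + F (k j - l) - F (k j)) := by
  have hne : ∀ i ∈ Finset.univ.erase j, F (Function.update k j (k j - l) i) = F (k i) :=
    fun i hi => by rw [Function.update_of_ne (Finset.ne_of_mem_erase hi)]
  rw [Fin.sum_univ_succ, ← Finset.add_sum_erase _ (fun i => F (k i)) (Finset.mem_univ j),
    ← Finset.add_sum_erase _ _ (Finset.mem_univ j)]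
  simp only [split, Fin.cons_zero, Fin.cons_succ, Function.update_self]
  rw [Finset.sum_congr rfl hne]
  abel

theorem symNegL0_split (k : Fin n → Z2) (j : Fin n) (l : Z2) :
    symNegL0 (n + 1) (split k j l) =
      symNegL0 n k + sqNorm l - ((l 0 : ℝ) * k j 0 + (l 1 : ℝ) * k j 1) := by
  rw [symNegL0, symNegL0, sum_split]
  simp only [sqNorm_eq, Pi.sub_apply, Int.cast_sub]
  ring

theorem symL0w_split (w : EuclideanSpace ℝ (Fin 2)) (k : Fin n → Z2) (j : Fin n) (l : Z2) :
    symL0w w (n + 1) (split k j l) =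
      symL0w w n k - dot w l ^ 2 + dot w l * dot w (k j) := by
  rw [symL0w, symL0w, sum_split fun p => dot w p ^ 2, dot_sub]
  ring

theorem symNegL0_nonneg (n : ℕ) (k : Fin n → Z2) : 0 ≤ symNegL0 n k :=
  mul_nonneg (by norm_num) (Finset.sum_nonneg fun _ _ => sqNorm_nonneg _)

theorem sqNorm_le_symNegL0 (k : Fin n → Z2) (j : Fin n) : sqNorm (k j) ≤ 2 * symNegL0 n k := by
  have := Finset.single_le_sum (f := fun i => sqNorm (k i)) (fun _ _ => sqNorm_nonneg _)
    (Finset.mem_univ j)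
  rw [symNegL0]
  linarith

theorem half_le_symNegL0 (hk : k j ≠ 0) : 1 / 2 ≤ symNegL0 n k := by
  linarith [one_le_sqNorm hk, sqNorm_le_symNegL0 k j]

theorem symL0w_nonpos (w : EuclideanSpace ℝ (Fin 2)) (n : ℕ) (k : Fin n → Z2) :
    symL0w w n k ≤ 0 :=
  neg_nonpos.2 (mul_nonneg (by norm_num) (Finset.sum_nonneg fun _ _ => sq_nonneg _))

theorem abs_symL0w_le (w : EuclideanSpace ℝ (Fin 2)) (n : ℕ) (k : Fin n → Z2) :
    |symL0w w n k| ≤ ‖w‖ ^ 2 * symNegL0 n k := by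
  have hsum : ∑ i, dot w (k i) ^ 2 ≤ ‖w‖ ^ 2 * ∑ i, sqNorm (k i) := by
    rw [Finset.mul_sum]
    exact Finset.sum_le_sum fun i _ => dot_sq_le w (k i)
  rw [abs_of_nonpos (symL0w_nonpos w n k), symL0w, symNegL0]
  linarith

theorem symG_nonneg (ε : ℝ) (w : EuclideanSpace ℝ (Fin 2)) (n : ℕ) (k : Fin n → Z2) :
    0 ≤ symG ε w n k :=
  gSym_nonneg ε w (symNegL0_nonneg n k)

/-- The symbol of the resolvent `(-ℒ₀ - ℒ₀^𝔴 𝒢^ε)⁻¹`. -/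
def symRes (ε : ℝ) (w : EuclideanSpace ℝ (Fin 2)) (n : ℕ) (k : Fin n → Z2) : ℝ :=
  (symNegL0 n k - symL0w w n k * symG ε w n k)⁻¹

theorem symRes_eq_resSym (ε : ℝ) (w : EuclideanSpace ℝ (Fin 2)) (n : ℕ) (k : Fin n → Z2) :
    symRes ε w n k = resSym ε w (symNegL0 n k) (-symL0w w n k) := by
  rw [symRes, resSym, neg_mul, ← sub_eq_add_neg]
  rfl

theorem symRes_nonneg (ε : ℝ) (w : EuclideanSpace ℝ (Fin 2)) (n : ℕ) (k : Fin n → Z2) :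
    0 ≤ symRes ε w n k := by
  rw [symRes_eq_resSym]
  exact resSym_nonneg ε w (symNegL0_nonneg n k) (neg_nonneg.2 (symL0w_nonpos w n k))

theorem symRes_le_inv (ε : ℝ) (w : EuclideanSpace ℝ (Fin 2)) (h : 0 < symNegL0 n k) :
    symRes ε w n k ≤ (symNegL0 n k)⁻¹ := by
  rw [symRes_eq_resSym]
  exact resSym_le_inv ε w h (neg_nonneg.2 (symL0w_nonpos w n k))

end Split

/-! ### Comparison of the lattice sum with the continuum integral -/

/-- The size `√(A (L + A))` of the error made when the momenta obtained by splitting off `l`, with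
`|l|² = L`, from a configuration whose symbol of `-ℒ₀` is `A` are replaced by a point of the cell
with corner `l`. -/
def errorScale (A L : ℝ) : ℝ := √(A * (L + A))

theorem le_errorScale {A L : ℝ} (hA : 0 ≤ A) (hL : 0 ≤ L) : A ≤ errorScale A L :=
  Real.le_sqrt_of_sq_le (by nlinarith)

theorem abs_le_mul_errorScale {A L P c t : ℝ} (hA : 0 ≤ A) (hL : 0 ≤ L) (hP : P ≤ 4 * A)
    (hc : 0 ≤ c) (ht : t ^ 2 ≤ c ^ 2 * (L * P)) : |t| ≤ 2 * c * errorScale A L := by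
  refine abs_le_of_sq_le_sq ?_ (mul_nonneg (by positivity) (Real.sqrt_nonneg _))
  rw [mul_pow, errorScale, Real.sq_sqrt (by positivity)]
  calc t ^ 2 ≤ c ^ 2 * (L * P) := ht
    _ ≤ c ^ 2 * (L * (4 * A)) := by gcongr
    _ ≤ (2 * c) ^ 2 * (A * (L + A)) := by nlinarith [sq_nonneg (c * A)]

theorem errorScale_div_sq_le_weight {A L : ℝ} (hA : 1 / 2 ≤ A) (hL : 0 ≤ L) :
    errorScale A L / (L + A) ^ 2 ≤ 2 * weight (√A) L := by
  have hA₀ : 0 < A := by linarith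
  have hsqrt : √(L + 1) ≤ 2 * √(L + A) := by
    rw [Real.sqrt_le_left (by positivity), mul_pow, Real.sq_sqrt (by positivity)]
    linarith
  rw [weight, errorScale, Real.sq_sqrt hA₀.le, Real.sqrt_mul hA₀.le, mul_div_assoc',
    div_le_div_iff₀ (by positivity) (by positivity)]
  calc √A * √(L + A) * (√(L + 1) * (L + A))
      ≤ √A * √(L + A) * ((2 * √(L + A)) * (L + A)) := by gcongr
    _ = 2 * √A * √(L + A) ^ 2 * (L + A) := by ring
    _ = 2 * √A * (L + A) ^ 2 := by rw [Real.sq_sqrt (by positivity)]; ring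

theorem sq_le_weight {ε L : ℝ} (hε₀ : 0 < ε) (hε : ε ≤ 1 / 2) (hL : 0 ≤ L) (hεL : ε ^ 2 * L ≤ 1) :
    ε ^ 2 ≤ 3 * weight (1 / ε) L := by
  have hε₂ : 0 < ε ^ 2 := by positivity
  have hsqrt : √(L + 1) ≤ 3 / 2 * (1 / ε) := by
    rw [Real.sqrt_le_left (by positivity), mul_pow, div_pow, div_pow, one_pow, mul_one_div,
      le_div_iff₀ hε₂]
    nlinarith
  have hsum : L + (1 / ε) ^ 2 ≤ 2 * (1 / ε) ^ 2 := by
    have : L ≤ (1 / ε) ^ 2 := by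
      rw [div_pow, one_pow, le_div_iff₀ hε₂]
      linarith
    linarith
  rw [weight, mul_div_assoc', le_div_iff₀ (by positivity)]
  calc ε ^ 2 * (√(L + 1) * (L + (1 / ε) ^ 2))
      ≤ ε ^ 2 * ((3 / 2 * (1 / ε)) * (2 * (1 / ε) ^ 2)) := by gcongr
    _ = 3 * (1 / ε) := by field_simp

theorem one_div_le_weight {L A Y : ℝ} (hL : 0 ≤ L) (hA : 1 / 2 ≤ A) (hY : L + A ≤ 9 * Y)
    (hLA : L ≤ 2 * A) : 1 / Y ≤ 18 * weight (√A) L := by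
  have hA₀ : 0 < A := by linarith
  have hY₀ : 0 < Y := by linarith
  have hsqrt : √(L + 1) ≤ 2 * √A := by
    rw [Real.sqrt_le_left (by positivity), mul_pow, Real.sq_sqrt hA₀.le]
    linarith
  rw [weight, Real.sq_sqrt hA₀.le, mul_div_assoc', div_le_div_iff₀ hY₀ (by positivity)]
  calc 1 * (√(L + 1) * (L + A)) ≤ 1 * ((2 * √A) * (9 * Y)) := by gcongr
    _ = 18 * √A * Y := by ring

theorem one_div_div_le_weight {ε L A Y : ℝ} (hε₀ : 0 < ε) (hL : 0 ≤ L) (hA : 1 / 2 ≤ A)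
    (hY : L + A ≤ 9 * Y) (hεL : 1 ≤ 3 * (ε ^ 2 * (L + A))) :
    1 / Y / (1 + ε ^ 2 * Y) ≤ 1296 * weight (1 / ε) L := by
  have hy₀ : 0 < L + A := by linarith
  have hY₀ : 0 < Y := by linarith
  have hsqrt : √(L + 1) ≤ 2 * √(L + A) := by
    rw [Real.sqrt_le_left (by positivity), mul_pow, Real.sq_sqrt hy₀.le]
    linarith
  have hone : 1 ≤ 2 * (ε * √(L + A)) := by
    rw [← one_le_sq_iff₀ (by positivity), mul_pow, mul_pow, Real.sq_sqrt hy₀.le]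
    linarith
  have hsum : L + (1 / ε) ^ 2 ≤ 4 * (L + A) := by
    have : (1 / ε) ^ 2 ≤ 3 * (L + A) := by
      rw [div_pow, one_pow, div_le_iff₀ (by positivity)]
      linarith
    linarith
  have hcut : ε ^ 2 * (L + A) ^ 2 ≤ 81 * (Y * (1 + ε ^ 2 * Y)) :=
    calc ε ^ 2 * (L + A) ^ 2 ≤ ε ^ 2 * (9 * Y) ^ 2 := by gcongr
      _ ≤ 81 * (Y * (1 + ε ^ 2 * Y)) := by nlinarith
  rw [weight, div_div, mul_div_assoc', div_le_div_iff₀ (by positivity) (by positivity)]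
  calc 1 * (√(L + 1) * (L + (1 / ε) ^ 2))
      ≤ (2 * (ε * √(L + A))) * ((2 * √(L + A)) * (4 * (L + A))) := by gcongr
    _ = 16 * (1 / ε) * (ε ^ 2 * (√(L + A) ^ 2 * (L + A))) := by
        field_simp
        ring
    _ = 16 * (1 / ε) * (ε ^ 2 * (L + A) ^ 2) := by
        rw [Real.sq_sqrt hy₀.le, sq (L + A)]
    _ ≤ 16 * (1 / ε) * (81 * (Y * (1 + ε ^ 2 * Y))) := by gcongr
    _ = 1296 * (1 / ε) * (Y * (1 + ε ^ 2 * Y)) := by ring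

theorem abs_inv_sub_inv_le {a b c y : ℝ} (hy : 0 < y) (ha : y ≤ 4 * a) (hb : y ≤ 9 * b)
    (hab : |a - b| ≤ c) : |a⁻¹ - b⁻¹| ≤ 36 * (c / y ^ 2) := by
  have ha₀ : 0 < a := by linarith
  have hb₀ : 0 < b := by linarith
  have hden : y ^ 2 ≤ 36 * (a * b) := by nlinarith
  rw [inv_sub_inv ha₀.ne' hb₀.ne', abs_div, abs_of_pos (mul_pos ha₀ hb₀), abs_sub_comm]
  calc |a - b| / (a * b) ≤ c / (y ^ 2 / 36) :=
        div_le_div₀ ((abs_nonneg _).trans hab) hab (by positivity) (by linarith)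
    _ = 36 * (c / y ^ 2) := by field_simp

theorem abs_resSym_denom_sub_le {ε : ℝ} {w : EuclideanSpace ℝ (Fin 2)} (hw : w ≠ 0) (hε₀ : 0 < ε)
    (hε : ε ≤ 1 / 2) {x Y q P y s : ℝ} (hy : 1 / 2 ≤ y) (hx : y ≤ 4 * x) (hyY : y ≤ 9 * Y)
    (hYy : Y ≤ 9 * y) (hP : 0 ≤ P) (hPY : P ≤ ‖w‖ ^ 2 * Y) (hxY : |x - Y| ≤ 10 * s)
    (hqP : |q - P| ≤ 12 * ‖w‖ ^ 2 * s) :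
    |(x + q * gSym ε w x) - (Y + P * gSym ε w Y)| ≤ 830 * (1 + ‖w‖ ^ 2) * s := by
  have hs : 0 ≤ s := by linarith [abs_nonneg (x - Y)]
  have hg₀ : 0 ≤ gSym ε w x := gSym_nonneg ε w (by linarith)
  have hg₁ : gSym ε w x ≤ 1 := gSym_le_one hw hε₀ hε (by linarith)
  have hlip : |gSym ε w x - gSym ε w Y| ≤ 1 / (y / 9) * |x - Y| :=
    abs_gSym_sub_le hw hε₀ hε (by linarith) (by linarith) (by linarith)
  have hcoeff : P * |gSym ε w x - gSym ε w Y| ≤ 810 * (‖w‖ ^ 2 * s) :=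
    calc P * |gSym ε w x - gSym ε w Y|
        ≤ (‖w‖ ^ 2 * (9 * y)) * (1 / (y / 9) * (10 * s)) := by
          have hPy : P ≤ ‖w‖ ^ 2 * (9 * y) := hPY.trans (by gcongr)
          have hy₀ : 0 ≤ 1 / (y / 9) := by positivity
          exact mul_le_mul hPy (hlip.trans (by gcongr)) (abs_nonneg _) (hP.trans hPy)
      _ = 810 * (‖w‖ ^ 2 * s) := by field_simp; ring
  calc |(x + q * gSym ε w x) - (Y + P * gSym ε w Y)|
      = |(x - Y) + (q - P) * gSym ε w x + P * (gSym ε w x - gSym ε w Y)| := by congr 1; ring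
    _ ≤ |x - Y| + |q - P| * gSym ε w x + P * |gSym ε w x - gSym ε w Y| := by
        refine (abs_add_three _ _ _).trans_eq ?_
        rw [abs_mul, abs_mul, abs_of_nonneg hg₀, abs_of_nonneg hP]
    _ ≤ 10 * s + 12 * ‖w‖ ^ 2 * s * 1 + 810 * (‖w‖ ^ 2 * s) := by gcongr
    _ ≤ 830 * (1 + ‖w‖ ^ 2) * s := by nlinarith [mul_nonneg (sq_nonneg ‖w‖) hs]

theorem abs_resSym_sub_le {ε : ℝ} {w : EuclideanSpace ℝ (Fin 2)} (hw : w ≠ 0) (hε₀ : 0 < ε)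
    (hε : ε ≤ 1 / 2) {x Y q P y s : ℝ} (hy : 1 / 2 ≤ y) (hx : y ≤ 4 * x) (hyY : y ≤ 9 * Y)
    (hYy : Y ≤ 9 * y) (hq : 0 ≤ q) (hP : 0 ≤ P) (hPY : P ≤ ‖w‖ ^ 2 * Y)
    (hxY : |x - Y| ≤ 10 * s) (hqP : |q - P| ≤ 12 * ‖w‖ ^ 2 * s) :
    |resSym ε w x q - resSym ε w Y P| ≤ 29880 * (1 + ‖w‖ ^ 2) * (s / y ^ 2) := by
  have hx₀ : x ≤ x + q * gSym ε w x :=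
    le_add_of_nonneg_right (mul_nonneg hq (gSym_nonneg ε w (by linarith)))
  have hY₀ : Y ≤ Y + P * gSym ε w Y :=
    le_add_of_nonneg_right (mul_nonneg hP (gSym_nonneg ε w (by linarith)))
  calc |resSym ε w x q - resSym ε w Y P|
      ≤ 36 * (830 * (1 + ‖w‖ ^ 2) * s / y ^ 2) :=
        abs_inv_sub_inv_le (by linarith) (by linarith) (by linarith)
          (abs_resSym_denom_sub_le hw hε₀ hε hy hx hyY hYy hP hPY hxY hqP)
    _ = 29880 * (1 + ‖w‖ ^ 2) * (s / y ^ 2) := by ring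

theorem planarL0w_le (w : EuclideanSpace ℝ (Fin 2)) {A : ℝ} (hA : 0 ≤ A) (z : ℝ × ℝ) :
    planarL0w w A z ≤ ‖w‖ ^ 2 * (z.1 ^ 2 + z.2 ^ 2 + A) := by
  rw [planarL0w, mul_comm]
  gcongr
  refine div_le_of_le_mul₀ (by positivity) (sq_nonneg _) ?_
  rw [norm_sq_eq]
  exact mul_add_mul_sq_le _ _ _ _

theorem abs_sq_sub_planarL0w_le (w : EuclideanSpace ℝ (Fin 2)) {A : ℝ} (hA : 0 ≤ A) (z : ℝ × ℝ) :
    |(w 0 * z.1 + w 1 * z.2) ^ 2 - planarL0w w A z| ≤ ‖w‖ ^ 2 * A := by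
  have hCS : (w 0 * z.1 + w 1 * z.2) ^ 2 ≤ ‖w‖ ^ 2 * (z.1 ^ 2 + z.2 ^ 2) := by
    rw [norm_sq_eq]
    exact mul_add_mul_sq_le _ _ _ _
  have hcancel : (z.1 ^ 2 + z.2 ^ 2) * ((w 0 * z.1 + w 1 * z.2) ^ 2 / (z.1 ^ 2 + z.2 ^ 2)) =
      (w 0 * z.1 + w 1 * z.2) ^ 2 :=
    mul_div_cancel_of_imp' fun h => by rw [h, mul_zero] at hCS; exact hCS.antisymm (sq_nonneg _)
  rw [planarL0w, add_mul, hcancel, sub_add_cancel_left, abs_neg, abs_of_nonneg (by positivity),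
    mul_comm]
  gcongr
  exact div_le_of_le_mul₀ (by positivity) (sq_nonneg _) hCS

section Cell

variable {n : ℕ} {k : Fin n → Z2} {j : Fin n}

theorem sqNorm_add_symNegL0_le (k : Fin n → Z2) (j : Fin n) (l : Z2) :
    sqNorm l + symNegL0 n k ≤ 4 * symNegL0 (n + 1) (split k j l) := by
  have hp := sqNorm_le_symNegL0 k j
  rw [symNegL0_split]
  rw [sqNorm_eq] at hp ⊢
  nlinarith [sq_nonneg (3 * (l 0 : ℝ) - 2 * k j 0), sq_nonneg (3 * (l 1 : ℝ) - 2 * k j 1)]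

theorem abs_symNegL0_split_sub_le (hk : k j ≠ 0) (z : ℝ × ℝ) :
    |symNegL0 (n + 1) (split k j (cellCorner z)) - (z.1 ^ 2 + z.2 ^ 2 + symNegL0 n k)| ≤
      10 * errorScale (symNegL0 n k) (sqNorm (cellCorner z)) := by
  obtain ⟨hd₀, hd₁⟩ := abs_sub_cellCorner_le z
  have hA := half_le_symNegL0 hk
  set l := cellCorner z
  set A := symNegL0 n k
  have hL := sqNorm_nonneg l
  obtain ⟨d₀, hz₀⟩ : ∃ d₀, z.1 = l 0 + d₀ := ⟨_, (add_sub_cancel _ _).symm⟩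
  obtain ⟨d₁, hz₁⟩ : ∃ d₁, z.2 = l 1 + d₁ := ⟨_, (add_sub_cancel _ _).symm⟩
  rw [hz₀, add_sub_cancel_left, ← sq_le_one_iff_abs_le_one] at hd₀
  rw [hz₁, add_sub_cancel_left, ← sq_le_one_iff_abs_le_one] at hd₁
  have hlp : |(l 0 : ℝ) * k j 0 + l 1 * k j 1| ≤ 2 * 1 * errorScale A (sqNorm l) := by
    refine abs_le_mul_errorScale (P := sqNorm (k j)) (by linarith) hL
      (by linarith [sqNorm_le_symNegL0 k j]) one_pos.le ?_
    rw [one_pow, one_mul, sqNorm_eq, sqNorm_eq]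
    exact mul_add_mul_sq_le _ _ _ _
  have hld : |(l 0 : ℝ) * d₀ + l 1 * d₁| ≤ 2 * 1 * errorScale A (sqNorm l) := by
    refine abs_le_mul_errorScale (P := d₀ ^ 2 + d₁ ^ 2) (by linarith) hL (by linarith)
      one_pos.le ?_
    rw [one_pow, one_mul, sqNorm_eq]
    exact mul_add_mul_sq_le _ _ _ _
  have hs : A ≤ errorScale A (sqNorm l) := le_errorScale (by linarith) hL
  have hdiff : symNegL0 (n + 1) (split k j l) - (z.1 ^ 2 + z.2 ^ 2 + A) =
      -(((l 0 : ℝ) * k j 0 + l 1 * k j 1) + 2 * (l 0 * d₀ + l 1 * d₁) + (d₀ ^ 2 + d₁ ^ 2)) := by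
    rw [symNegL0_split, hz₀, hz₁, sqNorm_eq]
    ring
  rw [hdiff, abs_neg, abs_le]
  rw [abs_le] at hlp hld
  constructor <;> nlinarith

theorem abs_mul_le_mul_errorScale {A L P V x y : ℝ} (hA : 0 ≤ A) (hL : 0 ≤ L) (hP : P ≤ 4 * A)
    (hV : 0 ≤ V) (hx : x ^ 2 ≤ V * L) (hy : y ^ 2 ≤ V * P) :
    |x * y| ≤ 2 * V * errorScale A L := by
  refine abs_le_mul_errorScale hA hL hP hV ?_
  calc (x * y) ^ 2 = x ^ 2 * y ^ 2 := mul_pow x y 2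
    _ ≤ (V * L) * (V * P) := by gcongr
    _ = V ^ 2 * (L * P) := by ring

theorem abs_symL0w_split_sub_sq_le (w : EuclideanSpace ℝ (Fin 2)) (hk : k j ≠ 0) (z : ℝ × ℝ) :
    |-symL0w w (n + 1) (split k j (cellCorner z)) - (w 0 * z.1 + w 1 * z.2) ^ 2| ≤
      11 * ‖w‖ ^ 2 * errorScale (symNegL0 n k) (sqNorm (cellCorner z)) := by
  obtain ⟨hd₀, hd₁⟩ := abs_sub_cellCorner_le z
  have hA := half_le_symNegL0 hk
  set l := cellCorner z
  set A := symNegL0 n k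
  have hL := sqNorm_nonneg l
  obtain ⟨e, he⟩ : ∃ e, e = w 0 * (z.1 - l 0) + w 1 * (z.2 - l 1) := ⟨_, rfl⟩
  rw [← sq_le_one_iff_abs_le_one] at hd₀ hd₁
  have hs : A ≤ errorScale A (sqNorm l) := le_errorScale (by linarith) hL
  have he_sq : e ^ 2 ≤ ‖w‖ ^ 2 * 2 :=
    calc e ^ 2 ≤ ‖w‖ ^ 2 * ((z.1 - l 0) ^ 2 + (z.2 - l 1) ^ 2) := by
          rw [he, norm_sq_eq]
          exact mul_add_mul_sq_le _ _ _ _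
      _ ≤ ‖w‖ ^ 2 * 2 := by gcongr; linarith
  have hwlwp : |dot w l * dot w (k j)| ≤ 2 * ‖w‖ ^ 2 * errorScale A (sqNorm l) :=
    abs_mul_le_mul_errorScale (by linarith) hL (by linarith [sqNorm_le_symNegL0 k j])
      (sq_nonneg _) (dot_sq_le w l) (dot_sq_le w (k j))
  have hwle : |dot w l * e| ≤ 2 * ‖w‖ ^ 2 * errorScale A (sqNorm l) :=
    abs_mul_le_mul_errorScale (by linarith) hL (by linarith) (sq_nonneg _) (dot_sq_le w l) he_sq
  have hQ : |symL0w w n k| ≤ ‖w‖ ^ 2 * errorScale A (sqNorm l) :=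
    (abs_symL0w_le w n k).trans (by gcongr)
  have he_s : e ^ 2 ≤ 4 * (‖w‖ ^ 2 * errorScale A (sqNorm l)) := by
    nlinarith [sq_nonneg ‖w‖]
  have hdiff : -symL0w w (n + 1) (split k j l) - (w 0 * z.1 + w 1 * z.2) ^ 2 =
      -symL0w w n k - dot w l * dot w (k j) - 2 * (dot w l * e) - e ^ 2 := by
    rw [symL0w_split, he, dot_eq w l]
    ring
  rw [hdiff, abs_le]
  rw [abs_le] at hwlwp hwle hQ
  constructor <;> linarith [sq_nonneg e]

theorem abs_symL0w_split_sub_planarL0w_le (w : EuclideanSpace ℝ (Fin 2)) (hk : k j ≠ 0)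
    (z : ℝ × ℝ) :
    |-symL0w w (n + 1) (split k j (cellCorner z)) - planarL0w w (symNegL0 n k) z| ≤
      12 * ‖w‖ ^ 2 * errorScale (symNegL0 n k) (sqNorm (cellCorner z)) := by
  have hplanar : |(w 0 * z.1 + w 1 * z.2) ^ 2 - planarL0w w (symNegL0 n k) z| ≤
      ‖w‖ ^ 2 * errorScale (symNegL0 n k) (sqNorm (cellCorner z)) :=
    (abs_sq_sub_planarL0w_le w (symNegL0_nonneg n k) z).trans
      (by gcongr; exact le_errorScale (symNegL0_nonneg n k) (sqNorm_nonneg _))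
  linarith [abs_sub_le (-symL0w w (n + 1) (split k j (cellCorner z)))
    ((w 0 * z.1 + w 1 * z.2) ^ 2) (planarL0w w (symNegL0 n k) z),
    abs_symL0w_split_sub_sq_le w hk z]

theorem abs_symRes_split_sub_le {ε : ℝ} {w : EuclideanSpace ℝ (Fin 2)} (hw : w ≠ 0) (hε₀ : 0 < ε)
    (hε : ε ≤ 1 / 2) (hk : k j ≠ 0) (z : ℝ × ℝ) :
    |symRes ε w (n + 1) (split k j (cellCorner z)) -
        resSym ε w (z.1 ^ 2 + z.2 ^ 2 + symNegL0 n k) (planarL0w w (symNegL0 n k) z)| ≤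
      60000 * (1 + ‖w‖ ^ 2) * weight (√(symNegL0 n k)) (sqNorm (cellCorner z)) := by
  have hA := half_le_symNegL0 hk
  have hL := sqNorm_nonneg (cellCorner z)
  have hw₀ := weight_nonneg (Real.sqrt_nonneg (symNegL0 n k)) hL
  rw [symRes_eq_resSym]
  refine (abs_resSym_sub_le hw hε₀ hε (y := sqNorm (cellCorner z) + symNegL0 n k) (by linarith)
    (sqNorm_add_symNegL0_le k j _)
    (by linarith [sqNorm_cellCorner_le z, sq_nonneg z.1, sq_nonneg z.2])
    (by linarith [sq_add_sq_le_sqNorm_cellCorner z]) (neg_nonneg.2 (symL0w_nonpos w _ _))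
    (planarL0w_nonneg w (by linarith) z) (planarL0w_le w (by linarith) z)
    (abs_symNegL0_split_sub_le hk z) (abs_symL0w_split_sub_planarL0w_le w hk z)).trans ?_
  calc 29880 * (1 + ‖w‖ ^ 2) * (errorScale (symNegL0 n k) (sqNorm (cellCorner z)) /
        (sqNorm (cellCorner z) + symNegL0 n k) ^ 2)
      ≤ 29880 * (1 + ‖w‖ ^ 2) * (2 * weight (√(symNegL0 n k)) (sqNorm (cellCorner z))) := by
        gcongr
        exact errorScale_div_sq_le_weight hA hL
    _ ≤ 60000 * (1 + ‖w‖ ^ 2) * weight (√(symNegL0 n k)) (sqNorm (cellCorner z)) := by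
        nlinarith [mul_nonneg (sq_nonneg ‖w‖) hw₀]

theorem abs_resSym_sub_density_le (ε : ℝ) (w : EuclideanSpace ℝ (Fin 2)) {A : ℝ} (hA : 0 < A)
    (z : ℝ × ℝ) :
    |resSym ε w (z.1 ^ 2 + z.2 ^ 2 + A) (planarL0w w A z) - density ε w A z| ≤ ε ^ 2 := by
  have hY : 0 < z.1 ^ 2 + z.2 ^ 2 + A := by positivity
  have hP := planarL0w_nonneg w hA.le z
  have hr₀ := resSym_nonneg ε w hY.le hP
  have hrY :
      resSym ε w (z.1 ^ 2 + z.2 ^ 2 + A) (planarL0w w A z) * (z.1 ^ 2 + z.2 ^ 2 + A) ≤ 1 := by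
    rw [← le_div_iff₀ hY, one_div]
    exact resSym_le_inv ε w hY hP
  rw [density]
  set Y := z.1 ^ 2 + z.2 ^ 2 + A
  set r := resSym ε w Y (planarL0w w A z)
  have hdiff : r - r / (1 + ε ^ 2 * Y) = ε ^ 2 * (r * Y) / (1 + ε ^ 2 * Y) := by
    field_simp
    ring
  rw [hdiff, abs_of_nonneg (by positivity)]
  calc ε ^ 2 * (r * Y) / (1 + ε ^ 2 * Y) ≤ ε ^ 2 * (r * Y) :=
        div_le_self (by positivity) (le_add_of_nonneg_right (by positivity))
    _ ≤ ε ^ 2 := mul_le_of_le_one_right (sq_nonneg ε) hrY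

theorem density_le (ε : ℝ) (w : EuclideanSpace ℝ (Fin 2)) {A : ℝ} (hA : 0 < A) (z : ℝ × ℝ) :
    density ε w A z ≤ 1 / (z.1 ^ 2 + z.2 ^ 2 + A) / (1 + ε ^ 2 * (z.1 ^ 2 + z.2 ^ 2 + A)) := by
  rw [density, one_div]
  gcongr
  exact resSym_le_inv ε w (by positivity) (planarL0w_nonneg w hA.le z)

theorem sqNorm_le_or_of_cutoff_eq_zero {ε : ℝ} (hε₀ : 0 < ε) (hk : k j ≠ 0)
    (hkε : ε ^ 2 * sqNorm (k j) ≤ 1) {l : Z2} (hl : cutoff ε l (k j - l) = 0) :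
    sqNorm l ≤ 2 * symNegL0 n k ∨ 1 ≤ 3 * (ε ^ 2 * (sqNorm l + symNegL0 n k)) := by
  by_contra! h
  obtain ⟨hlarge, hsmall⟩ := h
  have hA := half_le_symNegL0 hk
  have hp := sqNorm_le_symNegL0 k j
  have hε₂ : 0 < ε ^ 2 := by positivity
  have hdiff : sqNorm (k j - l) ≤ 3 * (sqNorm l + symNegL0 n k) := by
    simp only [sqNorm_eq, Pi.sub_apply, Int.cast_sub] at hp ⊢
    nlinarith [sq_nonneg ((k j 0 : ℝ) + 2 * l 0), sq_nonneg ((k j 1 : ℝ) + 2 * l 1)]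
  refine (cutoff_ne_zero_iff hε₀).2 ⟨⟨?_, ?_⟩, ⟨?_, ?_⟩, ?_⟩ hl
  · rintro rfl
    rw [sqNorm_zero] at hlarge
    linarith
  · nlinarith [sqNorm_nonneg l]
  · intro h
    rw [← sub_eq_zero.1 h] at hlarge
    linarith
  · nlinarith
  · rw [add_sub_cancel]
    exact ⟨hk, hkε⟩

theorem density_le_weight {ε : ℝ} (w : EuclideanSpace ℝ (Fin 2)) (hε₀ : 0 < ε) {A : ℝ}
    (hA : 1 / 2 ≤ A) (z : ℝ × ℝ) (h : sqNorm (cellCorner z) ≤ 2 * A ∨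
      1 ≤ 3 * (ε ^ 2 * (sqNorm (cellCorner z) + A))) :
    density ε w A z ≤ 1296 * (weight (√A) (sqNorm (cellCorner z)) +
      weight (1 / ε) (sqNorm (cellCorner z))) := by
  have hL := sqNorm_nonneg (cellCorner z)
  have hw₁ := weight_nonneg (Real.sqrt_nonneg A) hL
  have hw₂ := weight_nonneg (K := 1 / ε) (by positivity) hL
  have hY : sqNorm (cellCorner z) + A ≤ 9 * (z.1 ^ 2 + z.2 ^ 2 + A) := by
    linarith [sqNorm_cellCorner_le z, sq_nonneg z.1, sq_nonneg z.2]
  refine (density_le ε w (by linarith) z).trans ?_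
  rcases h with h | h
  · have hbulk := one_div_le_weight hL hA hY h
    have hself : 1 / (z.1 ^ 2 + z.2 ^ 2 + A) / (1 + ε ^ 2 * (z.1 ^ 2 + z.2 ^ 2 + A)) ≤
        1 / (z.1 ^ 2 + z.2 ^ 2 + A) :=
      div_le_self (by positivity) (le_add_of_nonneg_right (by positivity))
    linarith
  · linarith [one_div_div_le_weight hε₀ hL hA hY h]

theorem abs_cutoff_mul_symRes_sub_density_le {ε : ℝ} {w : EuclideanSpace ℝ (Fin 2)} (hw : w ≠ 0)
    (hε₀ : 0 < ε) (hε : ε ≤ 1 / 2) (hk : k j ≠ 0) (hkε : ε ^ 2 * sqNorm (k j) ≤ 1) (z : ℝ × ℝ) :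
    |cutoff ε (cellCorner z) (k j - cellCorner z) *
        symRes ε w (n + 1) (split k j (cellCorner z)) - density ε w (symNegL0 n k) z| ≤
      60000 * (1 + ‖w‖ ^ 2) * (weight (√(symNegL0 n k)) (sqNorm (cellCorner z)) +
        weight (1 / ε) (sqNorm (cellCorner z))) := by
  have hA := half_le_symNegL0 hk
  have hL := sqNorm_nonneg (cellCorner z)
  have hw₁ := weight_nonneg (Real.sqrt_nonneg (symNegL0 n k)) hL
  have hw₂ := weight_nonneg (K := 1 / ε) (by positivity) hL
  by_cases hcut : cutoff ε (cellCorner z) (k j - cellCorner z) = 0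
  · rw [hcut, zero_mul, zero_sub, abs_neg, abs_of_nonneg (density_nonneg ε w (by linarith) z)]
    refine (density_le_weight w hε₀ hA z (sqNorm_le_or_of_cutoff_eq_zero hε₀ hk hkε hcut)).trans ?_
    gcongr
    linarith [sq_nonneg ‖w‖]
  · obtain ⟨⟨-, hlε⟩, -⟩ := (cutoff_ne_zero_iff hε₀).1 hcut
    rw [(cutoff_eq_zero_or_one ε _ _).resolve_left hcut, one_mul]
    calc |symRes ε w (n + 1) (split k j (cellCorner z)) - density ε w (symNegL0 n k) z|
        ≤ 60000 * (1 + ‖w‖ ^ 2) * weight (√(symNegL0 n k)) (sqNorm (cellCorner z)) +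
            3 * weight (1 / ε) (sqNorm (cellCorner z)) :=
          (abs_sub_le _ _ _).trans (add_le_add (abs_symRes_split_sub_le hw hε₀ hε hk z)
            ((abs_resSym_sub_density_le ε w (by linarith) z).trans (sq_le_weight hε₀ hε hL hlε)))
      _ ≤ 60000 * (1 + ‖w‖ ^ 2) * (weight (√(symNegL0 n k)) (sqNorm (cellCorner z)) +
            weight (1 / ε) (sqNorm (cellCorner z))) := by
          nlinarith [mul_nonneg (sq_nonneg ‖w‖) hw₂]

end Cell

theorem summable_cutoff_mul {ε : ℝ} (hε₀ : 0 < ε) (p : Z2) (F : Z2 → ℝ) :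
    Summable fun l => cutoff ε l (p - l) * F l := by
  obtain ⟨B, hB⟩ := cutoff_finite hε₀
  exact summable_of_ne_finset_zero (s := B) fun l hl =>
    mul_eq_zero_of_left (not_not.1 (mt (fun h => (hB _ _ h).1) hl)) _

theorem abs_tsum_sub_le {a E : Z2 → ℝ} {f : ℝ × ℝ → ℝ} {I C : ℝ} (ha₀ : ∀ l, 0 ≤ a l)
    (ha : Summable a) (hf₀ : ∀ z, 0 ≤ f z) (hf : Measurable f) (hI₀ : 0 ≤ I) (hC₀ : 0 ≤ C)
    (hI : ∫⁻ z, ENNReal.ofReal (f z) = ENNReal.ofReal I)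
    (hC : ∑' l, ENNReal.ofReal (E l) ≤ ENNReal.ofReal C)
    (h : ∀ z, |a (cellCorner z) - f z| ≤ E (cellCorner z)) : |(∑' l, a l) - I| ≤ C := by
  have hE₀ (z : ℝ × ℝ) : 0 ≤ E (cellCorner z) := (abs_nonneg _).trans (h z)
  have hsum := ENNReal.ofReal_tsum_of_nonneg ha₀ ha
  have hup : ENNReal.ofReal (∑' l, a l) ≤ ENNReal.ofReal (I + C) := by
    rw [hsum, ENNReal.ofReal_add hI₀ hC₀, ← hI]
    refine le_trans ?_ (add_le_add_right hC _)
    rw [← lintegral_comp_cellCorner, ← lintegral_comp_cellCorner,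
      ← lintegral_add_left hf.ennreal_ofReal]
    refine lintegral_mono fun z => ?_
    rw [← ENNReal.ofReal_add (hf₀ z) (hE₀ z)]
    exact ENNReal.ofReal_le_ofReal (by linarith [(abs_le.1 (h z)).2])
  have hlow : ENNReal.ofReal I ≤ ENNReal.ofReal ((∑' l, a l) + C) := by
    rw [← hI, ENNReal.ofReal_add (tsum_nonneg ha₀) hC₀, hsum]
    refine le_trans ?_ (add_le_add_right hC _)
    rw [← ENNReal.tsum_add, ← lintegral_comp_cellCorner]
    refine lintegral_mono fun z => ?_
    rw [← ENNReal.ofReal_add (ha₀ _) (hE₀ z)]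
    exact ENNReal.ofReal_le_ofReal (by linarith [(abs_le.1 (h z)).1])
  rw [ENNReal.ofReal_le_ofReal_iff (by positivity)] at hup
  rw [ENNReal.ofReal_le_ofReal_iff (add_nonneg (tsum_nonneg ha₀) hC₀)] at hlow
  exact abs_sub_le_iff.2 ⟨by linarith, by linarith⟩

theorem tsum_weight_add_weight_le {c K K' : ℝ} (hc : 0 ≤ c) (hK : 1 / 2 ≤ K) (hK' : 1 / 2 ≤ K') :
    ∑' l, ENNReal.ofReal (c * (weight K (sqNorm l) + weight K' (sqNorm l))) ≤
      ENNReal.ofReal (c * (120 * Real.pi ^ 2)) := by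
  have hadd (l : Z2) : ENNReal.ofReal (c * (weight K (sqNorm l) + weight K' (sqNorm l))) =
      ENNReal.ofReal c *
        (ENNReal.ofReal (weight K (sqNorm l)) + ENNReal.ofReal (weight K' (sqNorm l))) := by
    rw [ENNReal.ofReal_mul hc, ENNReal.ofReal_add (weight_nonneg (by linarith) (sqNorm_nonneg l))
      (weight_nonneg (by linarith) (sqNorm_nonneg l))]
  calc ∑' l, ENNReal.ofReal (c * (weight K (sqNorm l) + weight K' (sqNorm l)))
      = ENNReal.ofReal c * (∑' l, ENNReal.ofReal (weight K (sqNorm l)) +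
          ∑' l, ENNReal.ofReal (weight K' (sqNorm l))) := by
        rw [tsum_congr hadd, ENNReal.tsum_mul_left, ENNReal.tsum_add]
    _ ≤ ENNReal.ofReal c *
          (ENNReal.ofReal (60 * Real.pi ^ 2) + ENNReal.ofReal (60 * Real.pi ^ 2)) := by
        gcongr <;> exact tsum_weight_sqNorm_le ‹_›
    _ = ENNReal.ofReal (c * (120 * Real.pi ^ 2)) := by
        rw [← ENNReal.ofReal_add (by positivity) (by positivity), ← ENNReal.ofReal_mul hc]
        ring_nf

section Diagonal

variable {ε : ℝ} {w : EuclideanSpace ℝ (Fin 2)} {n : ℕ} {k : Fin n → Z2} {j : Fin n}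

theorem cutoff_mul_symRes_nonneg (ε : ℝ) (w : EuclideanSpace ℝ (Fin 2)) (k : Fin n → Z2)
    (j : Fin n) (l : Z2) : 0 ≤ cutoff ε l (k j - l) * symRes ε w (n + 1) (split k j l) :=
  mul_nonneg (cutoff_nonneg _ _ _) (symRes_nonneg _ _ _ _)

theorem abs_tsum_cutoff_mul_symRes_sub_le (hw : w ≠ 0) (hε₀ : 0 < ε) (hε : ε ≤ 1 / 2)
    (hk : k j ≠ 0) (hkε : ε ^ 2 * sqNorm (k j) ≤ 1) :
    |(∑' l, cutoff ε l (k j - l) * symRes ε w (n + 1) (split k j l)) -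
      Real.pi ^ 2 / lam ε ^ 2 * symG ε w n k| ≤
      60000 * (1 + ‖w‖ ^ 2) * (120 * Real.pi ^ 2) := by
  have hA := half_le_symNegL0 hk
  have hsqrtA : 1 / 2 ≤ √(symNegL0 n k) := Real.le_sqrt_of_sq_le (by linarith)
  have hε_inv : 1 / 2 ≤ 1 / ε := one_div_le_one_div_of_le hε₀ (by linarith)
  exact abs_tsum_sub_le (cutoff_mul_symRes_nonneg ε w k j) (summable_cutoff_mul hε₀ _ _)
    (density_nonneg ε w (by linarith)) (measurable_density ε w _)
    (mul_nonneg (by positivity) (symG_nonneg ε w n k)) (by positivity)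
    (lintegral_density hε₀ (by linarith) hw (by linarith))
    (tsum_weight_add_weight_le (by positivity) hsqrtA hε_inv)
    (abs_cutoff_mul_symRes_sub_density_le hw hε₀ hε hk hkε)

theorem symRes_split_le_two {l : Z2} (hl : l ≠ 0) : symRes ε w (n + 1) (split k j l) ≤ 2 := by
  have hhalf : 1 / 2 ≤ symNegL0 (n + 1) (split k j l) :=
    half_le_symNegL0 (j := 0) (by simpa only [split, Fin.cons_zero] using hl)
  refine (symRes_le_inv ε w (by linarith)).trans ?_
  rw [inv_le_comm₀ (by linarith) two_pos]
  linarith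

theorem two_le_weight_one {L : ℝ} (hL : 0 ≤ L) (hL₄ : L ≤ 4) : 2 ≤ 24 * weight 1 L := by
  have hsqrt : √(L + 1) ≤ 12 / 5 := by
    rw [Real.sqrt_le_left (by norm_num)]
    linarith
  rw [weight, mul_one_div, le_div_iff₀ (by positivity)]
  calc 2 * (√(L + 1) * (L + 1 ^ 2)) ≤ 2 * (12 / 5 * (4 + 1 ^ 2)) := by gcongr
    _ = 24 := by norm_num

theorem tsum_cutoff_mul_symRes_le (hε₀ : 0 < ε) (hε : 1 / 2 < ε) (k : Fin n → Z2) (j : Fin n) :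
    ∑' l, cutoff ε l (k j - l) * symRes ε w (n + 1) (split k j l) ≤ 24 * (60 * Real.pi ^ 2) := by
  have hterm (l : Z2) : cutoff ε l (k j - l) * symRes ε w (n + 1) (split k j l) ≤
      24 * weight 1 (sqNorm l) := by
    by_cases hcut : cutoff ε l (k j - l) = 0
    · rw [hcut, zero_mul]
      exact mul_nonneg (by norm_num) (weight_nonneg zero_le_one (sqNorm_nonneg l))
    · obtain ⟨⟨hl, hlε⟩, -⟩ := (cutoff_ne_zero_iff hε₀).1 hcut
      have hL₄ : sqNorm l ≤ 4 := by nlinarith [sqNorm_nonneg l]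
      rw [(cutoff_eq_zero_or_one ε _ _).resolve_left hcut, one_mul]
      exact (symRes_split_le_two hl).trans (two_le_weight_one (sqNorm_nonneg l) hL₄)
  rw [← ENNReal.ofReal_le_ofReal_iff (by positivity),
    ENNReal.ofReal_tsum_of_nonneg (cutoff_mul_symRes_nonneg ε w k j) (summable_cutoff_mul hε₀ _ _)]
  calc ∑' l, ENNReal.ofReal (cutoff ε l (k j - l) * symRes ε w (n + 1) (split k j l))
      ≤ ∑' l, ENNReal.ofReal 24 * ENNReal.ofReal (weight 1 (sqNorm l)) := by
        gcongr with l
        rw [← ENNReal.ofReal_mul (by norm_num)]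
        exact ENNReal.ofReal_le_ofReal (hterm l)
    _ ≤ ENNReal.ofReal 24 * ENNReal.ofReal (60 * Real.pi ^ 2) := by
        rw [ENNReal.tsum_mul_left]
        gcongr
        exact tsum_weight_sqNorm_le (by norm_num)
    _ = ENNReal.ofReal (24 * (60 * Real.pi ^ 2)) := (ENNReal.ofReal_mul (by norm_num)).symm

theorem symG_le_of_large (hw : w ≠ 0) (hε₀ : 0 < ε) (hk : k j ≠ 0)
    (h : ¬(ε ≤ 1 / 2 ∧ ε ^ 2 * sqNorm (k j) ≤ 1)) : symG ε w n k ≤ 8 * lam ε ^ 2 := by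
  have hA := half_le_symNegL0 hk
  have hεA : 1 / 8 ≤ ε ^ 2 * symNegL0 n k := by
    by_cases hε : ε ≤ 1 / 2
    · nlinarith [lt_of_not_ge fun hkε => h ⟨hε, hkε⟩, sqNorm_le_symNegL0 k j, sq_nonneg ε]
    · nlinarith [not_le.1 hε]
  calc symG ε w n k ≤ lam ε ^ 2 * (1 / (ε ^ 2 * symNegL0 n k)) := gSym_le_inv hw hε₀ (by linarith)
    _ ≤ lam ε ^ 2 * (1 / (1 / 8)) := by gcongr
    _ = 8 * lam ε ^ 2 := by ring

theorem tsum_cutoff_mul_symRes_le_of_large (hε₀ : 0 < ε)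
    (h : ¬(ε ≤ 1 / 2 ∧ ε ^ 2 * sqNorm (k j) ≤ 1)) :
    ∑' l, cutoff ε l (k j - l) * symRes ε w (n + 1) (split k j l) ≤ 24 * (60 * Real.pi ^ 2) := by
  by_cases hε : ε ≤ 1 / 2
  · have hcut (l : Z2) : cutoff ε l (k j - l) = 0 := by
      by_contra hcut
      obtain ⟨-, -, -, hkε⟩ := (cutoff_ne_zero_iff hε₀).1 hcut
      rw [add_sub_cancel] at hkε
      exact h ⟨hε, hkε⟩
    simp only [hcut, zero_mul, tsum_zero]
    positivity
  · exact tsum_cutoff_mul_symRes_le hε₀ (not_le.1 hε) k j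

variable (w) in
/-- The constant in the estimate of the diagonal part of
`-𝒜^ε_- (-ℒ₀ - ℒ₀^𝔴 𝒢^ε)⁻¹ 𝒜^ε_+ + ℒ₀^𝔴 𝒢^ε`. -/
def diagonalConst : ℝ := 3600000 * (1 + ‖w‖ ^ 2)

theorem abs_diagonal_sub_le (hw : w ≠ 0) (hε₀ : 0 < ε) (hε₁ : ε < 1) (hk : k j ≠ 0) :
    |lam ε ^ 2 / (2 * Real.pi ^ 2) *
        (∑' l, cutoff ε l (k j - l) * symRes ε w (n + 1) (split k j l)) -
      1 / 2 * symG ε w n k| ≤ diagonalConst w * lam ε ^ 2 := by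
  have hlam := lam_pos hε₀ hε₁
  have hsum₀ : 0 ≤ ∑' l, cutoff ε l (k j - l) * symRes ε w (n + 1) (split k j l) :=
    tsum_nonneg (cutoff_mul_symRes_nonneg ε w k j)
  by_cases h : ε ≤ 1 / 2 ∧ ε ^ 2 * sqNorm (k j) ≤ 1
  · have hbulk := abs_tsum_cutoff_mul_symRes_sub_le hw hε₀ h.1 hk h.2
    set S := ∑' l, cutoff ε l (k j - l) * symRes ε w (n + 1) (split k j l)
    have hfactor : lam ε ^ 2 / (2 * Real.pi ^ 2) * S - 1 / 2 * symG ε w n k =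
        lam ε ^ 2 / (2 * Real.pi ^ 2) * (S - Real.pi ^ 2 / lam ε ^ 2 * symG ε w n k) := by
      field_simp
    calc |lam ε ^ 2 / (2 * Real.pi ^ 2) * S - 1 / 2 * symG ε w n k|
        = lam ε ^ 2 / (2 * Real.pi ^ 2) * |S - Real.pi ^ 2 / lam ε ^ 2 * symG ε w n k| := by
          rw [hfactor, abs_mul, abs_of_nonneg (by positivity)]
      _ ≤ lam ε ^ 2 / (2 * Real.pi ^ 2) * (60000 * (1 + ‖w‖ ^ 2) * (120 * Real.pi ^ 2)) := by
          gcongr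
      _ = diagonalConst w * lam ε ^ 2 := by
          rw [diagonalConst]
          field_simp
          ring
  · have hsum : lam ε ^ 2 / (2 * Real.pi ^ 2) *
        (∑' l, cutoff ε l (k j - l) * symRes ε w (n + 1) (split k j l)) ≤ 720 * lam ε ^ 2 := by
      calc lam ε ^ 2 / (2 * Real.pi ^ 2) *
            (∑' l, cutoff ε l (k j - l) * symRes ε w (n + 1) (split k j l))
          ≤ lam ε ^ 2 / (2 * Real.pi ^ 2) * (24 * (60 * Real.pi ^ 2)) := by
            gcongr
            exact tsum_cutoff_mul_symRes_le_of_large hε₀ h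
        _ = 720 * lam ε ^ 2 := by field_simp; ring
    have hconst : 720 * lam ε ^ 2 ≤ diagonalConst w * lam ε ^ 2 := by
      gcongr
      linarith [diagonalConst.eq_1 w, sq_nonneg ‖w‖]
    refine (abs_sub_le_of_nonneg_of_le (by positivity) (hsum.trans hconst)
      (mul_nonneg (by norm_num) (symG_nonneg ε w n k)) ?_)
    linarith [symG_le_of_large hw hε₀ hk h, sq_nonneg (lam ε)]

end Diagonal

/-! ### The operators map kernels to kernels -/

theorem memℓp_two_iff {ι : Type*} {f : ι → ℂ} : Memℓp f 2 ↔ Summable fun k => ‖f k‖ ^ 2 := by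
  rw [memℓp_gen_iff (by norm_num)]
  simp only [ENNReal.toReal_ofNat, Real.rpow_ofNat]

theorem sqSummable_add {ι : Type*} {f g : ι → ℂ} (hf : Summable fun k => ‖f k‖ ^ 2)
    (hg : Summable fun k => ‖g k‖ ^ 2) : Summable fun k => ‖f k + g k‖ ^ 2 :=
  memℓp_two_iff.1 ((memℓp_two_iff.2 hf).add (memℓp_two_iff.2 hg))

theorem sqSummable_sum {ι κ : Type*} {f : κ → ι → ℂ} (s : Finset κ)
    (hf : ∀ i ∈ s, Summable fun k => ‖f i k‖ ^ 2) : Summable fun k => ‖∑ i ∈ s, f i k‖ ^ 2 :=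
  memℓp_two_iff.1 (Memℓp.finsetSum s fun i hi => memℓp_two_iff.2 (hf i hi))

theorem sqSummable_of_le {ι : Type*} {f g : ι → ℂ} {M : ℝ} (hf : Summable fun k => ‖f k‖ ^ 2)
    (h : ∀ k, ‖g k‖ ≤ M * ‖f k‖) : Summable fun k => ‖g k‖ ^ 2 := by
  refine Summable.of_nonneg_of_le (fun _ => sq_nonneg _) (fun k => ?_) (hf.mul_left (M ^ 2))
  rw [← mul_pow]
  exact pow_le_pow_left₀ (norm_nonneg _) (h k) 2

section Permutations

variable {n : ℕ}

theorem merge_comp_perm {f : (Fin n → Z2) → ℂ} (hf : IsKernel n f) (k : Fin (n + 1) → Z2)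
    (σ : Equiv.Perm (Fin (n + 1))) (i j : Fin (n + 1)) :
    f (merge (k ∘ σ) i j) = f (merge k (σ i) (σ j)) := by
  let e : {x : Fin (n + 1) // x ≠ j} ≃ {x : Fin (n + 1) // x ≠ σ j} :=
    σ.subtypeEquiv fun a => σ.injective.ne_iff.symm
  let τ : Equiv.Perm (Fin n) :=
    ((finSuccAboveEquiv j).trans e).trans (finSuccAboveEquiv (σ j)).symm
  have hτ (a : Fin n) : (σ j).succAbove (τ a) = σ (j.succAbove a) :=
    congrArg Subtype.val ((finSuccAboveEquiv (σ j)).apply_symm_apply (e (finSuccAboveEquiv j a)))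
  rw [← hf.symm τ (merge k (σ i) (σ j))]
  congr 1
  funext a
  simp only [merge, Function.comp, Fin.removeNth, hτ]
  by_cases h : j.succAbove a = i
  · rw [h, Function.update_self, Function.update_self]
  · rw [Function.update_of_ne h, Function.update_of_ne (σ.injective.ne h), Function.comp_apply]

theorem split_comp_perm {g : (Fin (n + 1) → Z2) → ℂ} (hg : IsKernel (n + 1) g)
    (k : Fin n → Z2) (σ : Equiv.Perm (Fin n)) (j : Fin n) (l : Z2) :
    g (split (k ∘ σ) j l) = g (split k (σ j) l) := by
  rw [← hg.symm (Equiv.Perm.decomposeFin.symm (0, σ)) (split k (σ j) l)]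
  congr 1
  funext a
  refine Fin.cases ?_ (fun a => ?_) a
  · simp only [split, Function.comp, Equiv.Perm.decomposeFin_symm_apply_zero, Fin.cons_zero]
  · simp only [split, Function.comp, Fin.cons_succ, Equiv.Perm.decomposeFin_symm_apply_succ,
      Equiv.swap_self, Equiv.refl_apply]
    by_cases h : a = j
    · rw [h, Function.update_self, Function.update_self]
    · rw [Function.update_of_ne h, Function.update_of_ne (σ.injective.ne h), Function.comp_apply]

theorem two_mul_sum_lt_eq (X : Fin (n + 1) → Fin (n + 1) → ℂ)
    (hX : ∀ i j, i ≠ j → X i j = X j i) :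
    2 * ∑ i, ∑ j ∈ Finset.Ioi i, X i j = ∑ j, ((∑ i, X i j) - X j j) := by
  rw [sum_lt_eq X hX]
  refine Finset.sum_congr rfl fun j _ => ?_
  rw [Fin.sum_univ_succAbove _ j, add_sub_cancel_left]

theorem sum_lt_comp_perm (σ : Equiv.Perm (Fin (n + 1))) (X : Fin (n + 1) → Fin (n + 1) → ℂ)
    (hX : ∀ i j, i ≠ j → X i j = X j i) :
    ∑ i, ∑ j ∈ Finset.Ioi i, X (σ i) (σ j) = ∑ i, ∑ j ∈ Finset.Ioi i, X i j := by
  refine mul_left_cancel₀ (two_ne_zero (α := ℂ)) ?_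
  rw [two_mul_sum_lt_eq X hX,
    two_mul_sum_lt_eq (fun i j => X (σ i) (σ j)) fun i j h => hX _ _ (σ.injective.ne h),
    ← Equiv.sum_comp σ fun j => (∑ i, X i j) - X j j]
  exact Finset.sum_congr rfl fun j _ => by rw [← Equiv.sum_comp σ fun i => X i (σ j)]

theorem sum_comp_perm (F : Z2 → ℝ) (σ : Equiv.Perm (Fin n)) (k : Fin n → Z2) :
    ∑ i, F ((k ∘ σ) i) = ∑ i, F (k i) :=
  Equiv.sum_comp σ fun i => F (k i)

theorem symNegL0_comp_perm (σ : Equiv.Perm (Fin n)) (k : Fin n → Z2) :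
    symNegL0 n (k ∘ σ) = symNegL0 n k := by
  rw [symNegL0, sum_comp_perm, symNegL0]

theorem symL0w_comp_perm (w : EuclideanSpace ℝ (Fin 2)) (σ : Equiv.Perm (Fin n))
    (k : Fin n → Z2) : symL0w w n (k ∘ σ) = symL0w w n k := by
  rw [symL0w, sum_comp_perm (fun p => dot w p ^ 2), symL0w]

theorem symG_comp_perm (ε : ℝ) (w : EuclideanSpace ℝ (Fin 2)) (σ : Equiv.Perm (Fin n))
    (k : Fin n → Z2) : symG ε w n (k ∘ σ) = symG ε w n k := by
  rw [symG, symNegL0_comp_perm, symG]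

end Permutations

theorem merge_split {n : ℕ} (k : Fin n → Z2) (j : Fin n) (l : Z2) :
    merge (split k j l) j.succ 0 = k := by
  funext i
  simp only [merge, split, Fin.removeNth, Fin.succAbove_zero, Fin.cons_zero, Fin.cons_succ,
    Function.update_self, sub_add_cancel]
  by_cases hi : i = j
  · rw [hi, Function.update_self]
  · rw [Function.update_of_ne (by simpa using hi), Fin.cons_succ, Function.update_of_ne hi]

theorem merge_splitEquiv {n : ℕ} (j : Fin (n + 1)) (a : Fin n) (l : Z2) (q : Fin n → Z2) :
    merge (splitEquiv j a (l, q)) (j.succAbove a) j = q :=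
  congrArg Prod.snd ((splitEquiv j a).left_inv (l, q))

theorem exists_merge_eq {n : ℕ} (k : Fin (n + 1) → Z2) {i j m : Fin (n + 1)} (hi : m ≠ i)
    (hj : m ≠ j) : ∃ a, merge k i j a = k m := by
  obtain ⟨a, ha⟩ := Fin.exists_succAbove_eq hj
  exact ⟨a, by rw [merge, Fin.removeNth, ha, Function.update_of_ne hi]⟩

theorem cutoff_zero_left (ε : ℝ) (m : Z2) : cutoff ε 0 m = 0 := by
  simp [cutoff, sqNorm_zero]

theorem cutoff_zero_right (ε : ℝ) (m : Z2) : cutoff ε m 0 = 0 := by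
  rw [cutoff_comm, cutoff_zero_left]

theorem exists_abs_dot_mul_cutoff_le {ε : ℝ} (hε₀ : 0 < ε) (w : EuclideanSpace ℝ (Fin 2)) :
    ∃ D : ℝ, ∀ l m, |dot w (l + m)| * cutoff ε l m ≤ D := by
  obtain ⟨B, hB⟩ := cutoff_finite hε₀
  refine ⟨∑ p ∈ B, |dot w p|, fun l m => ?_⟩
  by_cases h : cutoff ε l m = 0
  · rw [h, mul_zero]
    exact Finset.sum_nonneg fun _ _ => abs_nonneg _
  · rw [(cutoff_eq_zero_or_one ε l m).resolve_left h, mul_one]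
    exact Finset.single_le_sum (f := fun p => |dot w p|) (fun _ _ => abs_nonneg _) (hB l m h).2

theorem norm_dot_mul_cutoff_mul (ε : ℝ) (w : EuclideanSpace ℝ (Fin 2)) (p l m : Z2) (z : ℂ) :
    ‖(dot w p : ℂ) * (cutoff ε l m : ℂ) * z‖ = |dot w p| * cutoff ε l m * ‖z‖ := by
  rw [norm_mul, norm_mul, Complex.norm_real, Complex.norm_real, Real.norm_eq_abs,
    Real.norm_of_nonneg (cutoff_nonneg _ _ _)]

theorem splitEquiv_apply_self {n : ℕ} (j : Fin (n + 1)) (a : Fin n) (l : Z2) (q : Fin n → Z2) :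
    splitEquiv j a (l, q) j = l := by
  simp [splitEquiv]

theorem sqSummable_mul_merge {ε : ℝ} (hε₀ : 0 < ε) (w : EuclideanSpace ℝ (Fin 2)) {n : ℕ}
    {f : (Fin n → Z2) → ℂ} (hf : IsKernel n f) {i j : Fin (n + 1)} (hij : i ≠ j) :
    Summable fun k : Fin (n + 1) → Z2 =>
      ‖(dot w (k i + k j) : ℂ) * (cutoff ε (k i) (k j) : ℂ) * f (merge k i j)‖ ^ 2 := by
  obtain ⟨D, hD⟩ := exists_abs_dot_mul_cutoff_le hε₀ w
  obtain ⟨B, hB⟩ := cutoff_finite hε₀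
  obtain ⟨a, rfl⟩ := Fin.exists_succAbove_eq hij
  let ind : Z2 → ℝ := (B : Set Z2).indicator 1
  have hind (p : Z2) : 0 ≤ ind p := Set.indicator_nonneg (fun _ _ => zero_le_one) p
  have hindSum : Summable ind :=
    summable_of_ne_finset_zero (s := B) fun b hb => Set.indicator_of_notMem (by simpa using hb) _
  have hdom : Summable fun p : Z2 × (Fin n → Z2) => ind p.1 * ‖f p.2‖ ^ 2 :=
    Summable.mul_of_nonneg (g := fun q => ‖f q‖ ^ 2) hindSum hf.sq_summable hind
      fun _ => sq_nonneg _
  have hdom' : Summable fun k : Fin (n + 1) → Z2 =>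
      ind (k j) * ‖f (merge k (j.succAbove a) j)‖ ^ 2 := by
    rw [← (splitEquiv j a).summable_iff]
    refine hdom.congr fun p => ?_
    rw [Function.comp_apply, splitEquiv_apply_self, merge_splitEquiv]
  refine Summable.of_nonneg_of_le (fun _ => sq_nonneg _) (fun k => ?_) (hdom'.mul_left (D ^ 2))
  rw [norm_dot_mul_cutoff_mul, mul_pow, mul_left_comm]
  by_cases h : cutoff ε (k (j.succAbove a)) (k j) = 0
  · rw [h, mul_zero, zero_pow two_ne_zero, zero_mul]
    exact mul_nonneg (hind _) (by positivity)
  · have hone : ind (k j) = 1 :=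
      Set.indicator_of_mem (Finset.mem_coe.2 (hB _ _ (cutoff_comm ε _ _ ▸ h)).1) _
    rw [hone, one_mul]
    exact mul_le_mul_of_nonneg_right (pow_le_pow_left₀
      (mul_nonneg (abs_nonneg _) (cutoff_nonneg _ _ _)) (hD _ _) 2) (sq_nonneg _)

theorem isKernel_Aplus {ε : ℝ} (hε₀ : 0 < ε) (w : EuclideanSpace ℝ (Fin 2)) {n : ℕ} {ψ : Family}
    (hψ : IsKernel n (ψ n)) : IsKernel (n + 1) (Aplus ε w ψ (n + 1)) where
  symm σ k := by
    simp only [Aplus]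
    congr 1
    simp only [merge_comp_perm hψ, Function.comp_apply]
    refine sum_lt_comp_perm σ (fun i j => (dot w (k i + k j) : ℂ) * (cutoff ε (k i) (k j) : ℂ) *
      ψ n (merge k i j)) fun i j _ => ?_
    rw [add_comm, cutoff_comm, merge_comm hψ k j i]
  zero_mean k := by
    rintro ⟨m, hm⟩
    refine mul_eq_zero_of_right _ (Finset.sum_eq_zero fun i _ => Finset.sum_eq_zero fun j _ => ?_)
    by_cases hi : m = i
    · rw [← hi, hm, cutoff_zero_left, Complex.ofReal_zero, mul_zero, zero_mul]
    by_cases hj : m = j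
    · rw [← hj, hm, cutoff_zero_right, Complex.ofReal_zero, mul_zero, zero_mul]
    obtain ⟨a, ha⟩ := exists_merge_eq k hi hj
    rw [hψ.zero_mean _ ⟨a, ha.trans hm⟩, mul_zero]
  sq_summable :=
    sqSummable_of_le (sqSummable_sum _ fun i _ => sqSummable_sum _ fun j hj =>
      sqSummable_mul_merge hε₀ w hψ (Finset.mem_Ioi.1 hj).ne) fun _ => (norm_mul _ _).le

theorem sqSummable_mul_split {ε : ℝ} (hε₀ : 0 < ε) (w : EuclideanSpace ℝ (Fin 2)) {n : ℕ}
    {f : (Fin (n + 1) → Z2) → ℂ} (hf : IsKernel (n + 1) f) (j : Fin n) (l : Z2) :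
    Summable fun k : Fin n → Z2 =>
      ‖(dot w (k j) : ℂ) * (cutoff ε l (k j - l) : ℂ) * f (split k j l)‖ ^ 2 := by
  obtain ⟨D, hD⟩ := exists_abs_dot_mul_cutoff_le hε₀ w
  have hinj : Function.Injective fun k : Fin n → Z2 => split k j l :=
    Function.LeftInverse.injective (g := fun κ => merge κ j.succ 0) fun k => merge_split k j l
  refine sqSummable_of_le (M := D) (hf.sq_summable.comp_injective hinj) fun k => ?_
  rw [norm_dot_mul_cutoff_mul]
  refine mul_le_mul_of_nonneg_right ?_ (norm_nonneg _)
  simpa only [add_sub_cancel] using hD l (k j - l)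

theorem isKernel_Aminus {ε : ℝ} (hε₀ : 0 < ε) (w : EuclideanSpace ℝ (Fin 2)) {n : ℕ} {ψ : Family}
    (hψ : IsKernel (n + 1) (ψ (n + 1))) : IsKernel n (Aminus ε w ψ n) where
  symm σ k := by
    simp only [Aminus]
    congr 1
    rw [← Equiv.sum_comp σ fun j => (dot w (k j) : ℂ) *
        ∑' l : Z2, (cutoff ε l (k j - l) : ℂ) * ψ (n + 1) (split k j l)]
    simp only [split_comp_perm hψ, Function.comp]
  zero_mean k := by
    rintro ⟨m, hm⟩
    refine mul_eq_zero_of_right _ (Finset.sum_eq_zero fun j _ => ?_)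
    by_cases h : m = j
    · rw [← h, hm, dot_eq]
      simp
    · have hsplit (l : Z2) : ψ (n + 1) (split k j l) = 0 :=
        hψ.zero_mean _ ⟨m.succ, by rw [split, Fin.cons_succ, Function.update_of_ne h, hm]⟩
      simp only [hsplit, mul_zero, tsum_zero]
  sq_summable := by
    obtain ⟨B, hB⟩ := cutoff_finite hε₀
    have hfin (k : Fin n → Z2) (j : Fin n) :
        ∑' l : Z2, (cutoff ε l (k j - l) : ℂ) * ψ (n + 1) (split k j l) =
          ∑ l ∈ B, (cutoff ε l (k j - l) : ℂ) * ψ (n + 1) (split k j l) := by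
      refine tsum_eq_sum fun l hl => ?_
      rw [not_not.1 (mt (fun h => (hB _ _ h).1) hl), Complex.ofReal_zero, zero_mul]
    simp only [Aminus, hfin, Finset.mul_sum (s := B), ← mul_assoc (dot w _ : ℂ)]
    exact sqSummable_of_le (sqSummable_sum _ fun j _ => sqSummable_sum _ fun l _ =>
      sqSummable_mul_split hε₀ w hψ j l) fun _ => (norm_mul _ _).le

theorem isKernel_multiplier {n : ℕ} {f : (Fin n → Z2) → ℂ} (hf : IsKernel n f)
    {m : (Fin n → Z2) → ℝ} (hm : ∀ (σ : Equiv.Perm (Fin n)) k, m (k ∘ σ) = m k) {M : ℝ}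
    (hM : ∀ k, (∀ i, k i ≠ 0) → |m k| ≤ M) : IsKernel n fun k => (m k : ℂ) * f k where
  symm σ k := by rw [hm, hf.symm]
  zero_mean k hk := by rw [hf.zero_mean k hk, mul_zero]
  sq_summable := by
    refine sqSummable_of_le (M := M) hf.sq_summable fun k => ?_
    by_cases hk : ∃ i, k i = 0
    · rw [hf.zero_mean k hk, mul_zero, norm_zero, mul_zero]
    · rw [norm_mul, Complex.norm_real, Real.norm_eq_abs]
      exact mul_le_mul_of_nonneg_right (hM k (not_exists.1 hk)) (norm_nonneg _)

theorem isKernel_add {n : ℕ} {f g : (Fin n → Z2) → ℂ} (hf : IsKernel n f) (hg : IsKernel n g) :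
    IsKernel n (f + g) where
  symm σ k := by simp only [Pi.add_apply, hf.symm, hg.symm]
  zero_mean k hk := by simp only [Pi.add_apply, hf.zero_mean k hk, hg.zero_mean k hk, add_zero]
  sq_summable := sqSummable_add hf.sq_summable hg.sq_summable

theorem isKernel_neg {n : ℕ} {f : (Fin n → Z2) → ℂ} (hf : IsKernel n f) : IsKernel n (-f) where
  symm σ k := by simp only [Pi.neg_apply, hf.symm]
  zero_mean k hk := by simp only [Pi.neg_apply, hf.zero_mean k hk, neg_zero]
  sq_summable := by simpa only [Pi.neg_apply, norm_neg] using hf.sq_summable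

theorem symRes_le_two (ε : ℝ) (w : EuclideanSpace ℝ (Fin 2)) {n : ℕ} {k : Fin n → Z2}
    (hk : ∀ i, k i ≠ 0) : symRes ε w n k ≤ 2 := by
  rcases n with _ | n
  · simp [symRes, symNegL0, symL0w]
  · have hA := half_le_symNegL0 (hk 0)
    refine (symRes_le_inv ε w (by linarith)).trans ?_
    rw [inv_le_comm₀ (by linarith) two_pos]
    linarith

theorem abs_symL0w_mul_symG_le {ε : ℝ} (hε₀ : 0 < ε) {w : EuclideanSpace ℝ (Fin 2)} (hw : w ≠ 0)
    {n : ℕ} {k : Fin n → Z2} (hk : ∀ i, k i ≠ 0) :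
    |symL0w w n k * symG ε w n k| ≤ ‖w‖ ^ 2 * (lam ε ^ 2 * (1 / ε ^ 2)) := by
  rw [abs_mul, abs_of_nonneg (symG_nonneg ε w n k)]
  rcases n with _ | n
  · simp only [symL0w, Finset.univ_eq_empty, Finset.sum_empty, mul_zero, neg_zero, abs_zero,
      zero_mul]
    positivity
  · have hA : 0 < symNegL0 (n + 1) k := by linarith [half_le_symNegL0 (hk 0)]
    calc |symL0w w (n + 1) k| * symG ε w (n + 1) k
        ≤ (‖w‖ ^ 2 * symNegL0 (n + 1) k) * (lam ε ^ 2 * (1 / (ε ^ 2 * symNegL0 (n + 1) k))) :=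
          mul_le_mul (abs_symL0w_le w _ k) (gSym_le_inv hw hε₀ hA) (symG_nonneg ε w _ k)
            (by positivity)
      _ = ‖w‖ ^ 2 * (lam ε ^ 2 * (1 / ε ^ 2)) := by field_simp

theorem isKernel_resolvent (ε : ℝ) (w : EuclideanSpace ℝ (Fin 2)) {n : ℕ} {ψ : Family}
    (hψ : IsKernel n (ψ n)) : IsKernel n (resolvent ε w ψ n) :=
  isKernel_multiplier (m := symRes ε w n) hψ
    (fun σ k => by rw [symRes, symRes, symNegL0_comp_perm, symL0w_comp_perm, symG_comp_perm])
    fun k hk => (abs_of_nonneg (symRes_nonneg ε w n k)).trans_le (symRes_le_two ε w hk)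

theorem L0w_Geps_apply (ε : ℝ) (w : EuclideanSpace ℝ (Fin 2)) (ψ : Family) (n : ℕ)
    (k : Fin n → Z2) :
    L0w w (Geps ε w ψ) n k = ((symL0w w n k * symG ε w n k : ℝ) : ℂ) * ψ n k := by
  rw [L0w, Geps, multiplier, multiplier, Complex.ofReal_mul, mul_assoc]

theorem isKernel_L0w_Geps {ε : ℝ} (hε₀ : 0 < ε) {w : EuclideanSpace ℝ (Fin 2)} (hw : w ≠ 0) {n : ℕ}
    {ψ : Family} (hψ : IsKernel n (ψ n)) : IsKernel n (L0w w (Geps ε w ψ) n) := by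
  rw [funext (L0w_Geps_apply ε w ψ n)]
  exact isKernel_multiplier hψ (fun σ k => by rw [symL0w_comp_perm, symG_comp_perm])
    fun k hk => abs_symL0w_mul_symG_le hε₀ hw hk

theorem isKernel_replacementOp {ε : ℝ} (hε₀ : 0 < ε) {w : EuclideanSpace ℝ (Fin 2)} (hw : w ≠ 0)
    {n : ℕ} {ψ : Family} (hψ : IsKernel n (ψ n)) : IsKernel n (replacementOp ε w ψ n) :=
  isKernel_add
    (isKernel_neg (isKernel_Aminus hε₀ w (isKernel_resolvent ε w (isKernel_Aplus hε₀ w hψ))))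
    (isKernel_L0w_Geps hε₀ hw hψ)

/-! ### Two distinct pairings -/

theorem sum_le_of_tsum_ofReal_le {ι : Type*} {t : ι → ℝ} (ht : ∀ i, 0 ≤ t i) {M : ℝ} (hM : 0 ≤ M)
    (h : ∑' i, ENNReal.ofReal (t i) ≤ ENNReal.ofReal M) (s : Finset ι) : ∑ i ∈ s, t i ≤ M := by
  rw [← ENNReal.ofReal_le_ofReal_iff hM, ENNReal.ofReal_sum_of_nonneg fun i _ => ht i]
  exact (ENNReal.sum_le_tsum s).trans h

theorem summable_and_tsum_le {ι : Type*} {t : ι → ℝ} (ht : ∀ i, 0 ≤ t i) {M : ℝ} (hM : 0 ≤ M)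
    (h : ∑' i, ENNReal.ofReal (t i) ≤ ENNReal.ofReal M) : Summable t ∧ ∑' i, t i ≤ M :=
  have hsum := sum_le_of_tsum_ofReal_le ht hM h
  have hsummable := summable_of_sum_le ht hsum
  ⟨hsummable, hsummable.tsum_le_of_sum_le hsum⟩

theorem tsum_ofReal_le_sqrt_mul_sqrt {ι : Type*} {a b c : ι → ℝ} (ha : ∀ i, 0 ≤ a i)
    (hb : ∀ i, 0 ≤ b i) (hc : ∀ i, c i ^ 2 ≤ a i * b i) {α β : ℝ} (hα : 0 ≤ α) (hβ : 0 ≤ β)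
    (hA : ∑' i, ENNReal.ofReal (a i) ≤ ENNReal.ofReal α)
    (hB : ∑' i, ENNReal.ofReal (b i) ≤ ENNReal.ofReal β) :
    ∑' i, ENNReal.ofReal (c i) ≤ ENNReal.ofReal (√α * √β) := by
  rw [ENNReal.tsum_eq_iSup_sum]
  refine iSup_le fun s => ?_
  calc ∑ i ∈ s, ENNReal.ofReal (c i) ≤ ∑ i ∈ s, ENNReal.ofReal (√(a i) * √(b i)) := by
        refine Finset.sum_le_sum fun i _ => ENNReal.ofReal_le_ofReal ?_
        rw [← Real.sqrt_mul (ha i)]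
        exact Real.le_sqrt_of_sq_le (hc i)
    _ = ENNReal.ofReal (∑ i ∈ s, √(a i) * √(b i)) :=
        (ENNReal.ofReal_sum_of_nonneg fun i _ => by positivity).symm
    _ ≤ ENNReal.ofReal (√α * √β) := by
        refine ENNReal.ofReal_le_ofReal ((Real.sum_sqrt_mul_sqrt_le s ha hb).trans ?_)
        gcongr
        · exact sum_le_of_tsum_ofReal_le ha hα hA s
        · exact sum_le_of_tsum_ofReal_le hb hβ hB s

/-- The energy `‖(-ℒ₀)^{1/2} f‖²_{L²}` of a kernel. It is the junk value `0` when the series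
diverges, so that summability is assumed separately wherever the energy bounds something. -/
def energy (n : ℕ) (f : (Fin n → Z2) → ℂ) : ℝ := ∑' k, symNegL0 n k * ‖f k‖ ^ 2

section Energy

variable {n : ℕ} {f : (Fin n → Z2) → ℂ}

theorem energy_term_nonneg (f : (Fin n → Z2) → ℂ) (k : Fin n → Z2) :
    0 ≤ symNegL0 n k * ‖f k‖ ^ 2 :=
  mul_nonneg (symNegL0_nonneg n k) (sq_nonneg _)

theorem energy_nonneg (n : ℕ) (f : (Fin n → Z2) → ℂ) : 0 ≤ energy n f :=
  tsum_nonneg (energy_term_nonneg f)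

theorem tsum_ofReal_energy_term (hE : Summable fun k => symNegL0 n k * ‖f k‖ ^ 2) :
    ∑' k, ENNReal.ofReal (symNegL0 n k * ‖f k‖ ^ 2) = ENNReal.ofReal (energy n f) :=
  (ENNReal.ofReal_tsum_of_nonneg (energy_term_nonneg f) hE).symm

theorem summable_sqNorm_mul (hE : Summable fun k => symNegL0 n k * ‖f k‖ ^ 2) (a : Fin n) :
    Summable fun k => sqNorm (k a) * ‖f k‖ ^ 2 := by
  refine Summable.of_nonneg_of_le (fun k => mul_nonneg (sqNorm_nonneg _) (sq_nonneg _))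
    (fun k => ?_) (hE.mul_left 2)
  rw [← mul_assoc]
  exact mul_le_mul_of_nonneg_right (sqNorm_le_symNegL0 k a) (sq_nonneg _)

theorem tsum_sqNorm_mul_eq_swap (hf : IsKernel n f) (a i : Fin n) :
    ∑' k : Fin n → Z2, sqNorm (k i) * ‖f k‖ ^ 2 = ∑' k, sqNorm (k a) * ‖f k‖ ^ 2 := by
  rw [← ((Equiv.swap a i).arrowCongr (Equiv.refl Z2)).tsum_eq]
  refine tsum_congr fun k => ?_
  have hcomp : (Equiv.swap a i).arrowCongr (Equiv.refl Z2) k = k ∘ Equiv.swap a i := rfl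
  rw [hcomp, hf.symm, Function.comp_apply, Equiv.swap_apply_right]

theorem tsum_sqNorm_mul (hf : IsKernel n f)
    (hE : Summable fun k => symNegL0 n k * ‖f k‖ ^ 2) (a : Fin n) :
    ∑' k, ENNReal.ofReal (sqNorm (k a) * ‖f k‖ ^ 2) = ENNReal.ofReal (2 / n * energy n f) := by
  have hn : (n : ℝ) ≠ 0 := Nat.cast_ne_zero.2 a.pos.ne'
  have hsum : 2 * energy n f = n * ∑' k, sqNorm (k a) * ‖f k‖ ^ 2 := by
    calc 2 * energy n f = ∑' k, ∑ i, sqNorm (k i) * ‖f k‖ ^ 2 := by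
          rw [energy, ← tsum_mul_left]
          refine tsum_congr fun k => ?_
          rw [symNegL0, ← Finset.sum_mul]
          ring
      _ = ∑ i, ∑' k, sqNorm (k i) * ‖f k‖ ^ 2 :=
          Summable.tsum_finsetSum fun i _ => summable_sqNorm_mul hE i
      _ = n * ∑' k, sqNorm (k a) * ‖f k‖ ^ 2 := by
          simp only [tsum_sqNorm_mul_eq_swap hf a, Finset.sum_const, Finset.card_univ,
            Fintype.card_fin, nsmul_eq_mul]
  rw [← ENNReal.ofReal_tsum_of_nonneg (fun k => mul_nonneg (sqNorm_nonneg _) (sq_nonneg _))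
    (summable_sqNorm_mul hE a), div_mul_eq_mul_div, hsum, mul_div_cancel_left₀ _ hn]

end Energy

/-- The factor `2 / (s + t) · (t / s)^{1/2}`. Exchanging `s` and `t` inverts the second factor, so
that Cauchy–Schwarz with these weights costs exactly the resolvent bound `2 / (s + t)`, while each
weight alone is summable over `l` when `s = |l|²`. It is `0` for `s = 0`, by division by zero. -/
def pairWeight (s t : ℝ) : ℝ := 2 / (s + t) * √(t / s)

theorem pairWeight_nonneg {s t : ℝ} (hs : 0 ≤ s) (ht : 0 ≤ t) : 0 ≤ pairWeight s t := by
  unfold pairWeight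
  positivity

theorem pairWeight_mul_swap {s t : ℝ} (hs : 0 < s) (ht : 0 < t) :
    pairWeight s t * pairWeight t s = (2 / (s + t)) ^ 2 := by
  have hinv : √(t / s) * √(s / t) = 1 := by
    rw [← Real.sqrt_mul (by positivity), div_mul_div_cancel₀ hs.ne', div_self ht.ne', Real.sqrt_one]
  rw [pairWeight, pairWeight, add_comm t s, mul_mul_mul_comm, hinv, mul_one, sq]

theorem pairWeight_le_weight {s t : ℝ} (hs : 1 ≤ s) (ht : 0 ≤ t) :
    pairWeight s t ≤ 4 * weight √t s := by
  have hs₀ : 0 < √s := Real.sqrt_pos.2 (by linarith)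
  have hs₁ : 0 < √(s + 1) := Real.sqrt_pos.2 (by linarith)
  have hsqrt : √(s + 1) ≤ 2 * √s := by
    rw [Real.sqrt_le_left (by positivity), mul_pow, Real.sq_sqrt (by linarith)]
    linarith
  rw [pairWeight, Real.sqrt_div ht, weight, Real.sq_sqrt ht, div_mul_div_comm, mul_div_assoc',
    div_le_div_iff₀ (by positivity) (by positivity)]
  calc 2 * √t * (√(s + 1) * (s + t)) ≤ 2 * √t * ((2 * √s) * (s + t)) := by gcongr
    _ = 4 * √t * ((s + t) * √s) := by ring

theorem tsum_pairWeight_le (p : Z2) :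
    ∑' l : Z2, ENNReal.ofReal (pairWeight (sqNorm l) (sqNorm p)) ≤
      ENNReal.ofReal (240 * Real.pi ^ 2) := by
  rcases eq_or_ne p 0 with rfl | hp
  · simp [pairWeight, sqNorm_zero]
  have hK : 1 / 2 ≤ √(sqNorm p) := Real.le_sqrt_of_sq_le (by linarith [one_le_sqNorm hp])
  calc ∑' l : Z2, ENNReal.ofReal (pairWeight (sqNorm l) (sqNorm p))
      ≤ ∑' l : Z2, ENNReal.ofReal 4 * ENNReal.ofReal (weight √(sqNorm p) (sqNorm l)) := by
        refine ENNReal.tsum_le_tsum fun l => ?_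
        rw [← ENNReal.ofReal_mul (by norm_num)]
        refine ENNReal.ofReal_le_ofReal ?_
        rcases eq_or_ne l 0 with rfl | hl
        · rw [sqNorm_zero, pairWeight, div_zero, Real.sqrt_zero, mul_zero]
          exact mul_nonneg (by norm_num) (weight_nonneg (Real.sqrt_nonneg _) le_rfl)
        · exact pairWeight_le_weight (one_le_sqNorm hl) (sqNorm_nonneg p)
    _ ≤ ENNReal.ofReal 4 * ENNReal.ofReal (60 * Real.pi ^ 2) := by
        rw [ENNReal.tsum_mul_left]
        gcongr
        exact tsum_weight_sqNorm_le hK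
    _ = ENNReal.ofReal (240 * Real.pi ^ 2) := by
        rw [← ENNReal.ofReal_mul (by norm_num)]
        ring_nf

/-- The modulus `|k_a + k_b| |f(k_a + k_b, …)|` of the contribution of the pair `{a, b}` to
`𝒜^ε_+ f`, without cut-off and up to constants. -/
def pairAmp {n : ℕ} (f : (Fin n → Z2) → ℂ) (k : Fin (n + 1) → Z2) (a b : Fin (n + 1)) : ℝ :=
  √(sqNorm (k a + k b)) * ‖f (merge k a b)‖

section PairAmp

variable {n : ℕ} {f g : (Fin n → Z2) → ℂ}

theorem pairAmp_nonneg (f : (Fin n → Z2) → ℂ) (k : Fin (n + 1) → Z2) (a b : Fin (n + 1)) :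
    0 ≤ pairAmp f k a b := by
  unfold pairAmp
  positivity

theorem pairAmp_comm (hf : IsKernel n f) (k : Fin (n + 1) → Z2) (a b : Fin (n + 1)) :
    pairAmp f k a b = pairAmp f k b a := by
  rw [pairAmp, pairAmp, add_comm, merge_comm hf]

theorem pairAmp_eq_zero (hf : IsKernel n f) {k : Fin (n + 1) → Z2} {a b m : Fin (n + 1)}
    (hm : k m = 0) (ha : m ≠ a) (hb : m ≠ b) : pairAmp f k a b = 0 := by
  obtain ⟨i, hi⟩ := exists_merge_eq k ha hb
  rw [pairAmp, hf.zero_mean _ ⟨i, hi.trans hm⟩, norm_zero, mul_zero]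

theorem pairAmp_splitEquiv (f : (Fin n → Z2) → ℂ) (b : Fin (n + 1)) (a : Fin n) (l : Z2)
    (q : Fin n → Z2) :
    pairAmp f (splitEquiv b a (l, q)) (b.succAbove a) b = √(sqNorm (q a)) * ‖f q‖ := by
  have hadd : splitEquiv b a (l, q) (b.succAbove a) + splitEquiv b a (l, q) b = q a := by
    simp [splitEquiv]
  rw [pairAmp, merge_splitEquiv, hadd]

theorem splitEquiv_apply_of_ne (b : Fin (n + 1)) {a d : Fin n} (hda : d ≠ a) (l : Z2)
    (q : Fin n → Z2) : splitEquiv b a (l, q) (b.succAbove d) = q d := by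
  simp [splitEquiv, hda]

theorem tsum_pairWeight_mul_pairAmp_sq_le (hf : IsKernel n f)
    (hE : Summable fun k => symNegL0 n k * ‖f k‖ ^ 2) {a b d : Fin (n + 1)} (hab : a ≠ b)
    (hdb : d ≠ b) (hda : d ≠ a) :
    ∑' k : Fin (n + 1) → Z2, ENNReal.ofReal
        (pairWeight (sqNorm (k b)) (sqNorm (k d)) * pairAmp f k a b ^ 2) ≤
      ENNReal.ofReal (480 * Real.pi ^ 2 / n * energy n f) := by
  obtain ⟨a, rfl⟩ := Fin.exists_succAbove_eq hab
  obtain ⟨d, rfl⟩ := Fin.exists_succAbove_eq hdb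
  have hda' : d ≠ a := fun h => hda (congrArg b.succAbove h)
  calc ∑' k : Fin (n + 1) → Z2, ENNReal.ofReal
        (pairWeight (sqNorm (k b)) (sqNorm (k (b.succAbove d))) *
          pairAmp f k (b.succAbove a) b ^ 2)
      = ∑' q : Fin n → Z2, ∑' l : Z2, ENNReal.ofReal (pairWeight (sqNorm l) (sqNorm (q d))) *
          ENNReal.ofReal (sqNorm (q a) * ‖f q‖ ^ 2) := by
        rw [← (splitEquiv b a).tsum_eq, ENNReal.tsum_prod', ENNReal.tsum_comm]
        refine tsum_congr fun q => tsum_congr fun l => ?_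
        rw [splitEquiv_apply_self, splitEquiv_apply_of_ne b hda', pairAmp_splitEquiv, mul_pow,
          Real.sq_sqrt (sqNorm_nonneg _),
          ENNReal.ofReal_mul (pairWeight_nonneg (sqNorm_nonneg _) (sqNorm_nonneg _))]
    _ ≤ ∑' q : Fin n → Z2, ENNReal.ofReal (240 * Real.pi ^ 2) *
          ENNReal.ofReal (sqNorm (q a) * ‖f q‖ ^ 2) := by
        refine ENNReal.tsum_le_tsum fun q => ?_
        rw [ENNReal.tsum_mul_right]
        gcongr
        exact tsum_pairWeight_le (q d)
    _ = ENNReal.ofReal (480 * Real.pi ^ 2 / n * energy n f) := by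
        rw [ENNReal.tsum_mul_left, tsum_sqNorm_mul hf hE, ← ENNReal.ofReal_mul (by positivity)]
        ring_nf

theorem symRes_le_two_div (ε : ℝ) (w : EuclideanSpace ℝ (Fin 2)) {k : Fin n → Z2} {b d : Fin n}
    (hbd : b ≠ d) (hb : k b ≠ 0) : symRes ε w n k ≤ 2 / (sqNorm (k b) + sqNorm (k d)) := by
  have hpos : 0 < sqNorm (k b) + sqNorm (k d) := by
    linarith [one_le_sqNorm hb, sqNorm_nonneg (k d)]
  have hle : (sqNorm (k b) + sqNorm (k d)) / 2 ≤ symNegL0 n k := by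
    have hpair : sqNorm (k b) + sqNorm (k d) ≤ ∑ i, sqNorm (k i) := by
      rw [← Finset.sum_pair (f := fun i => sqNorm (k i)) hbd]
      exact Finset.sum_le_sum_of_subset_of_nonneg (Finset.subset_univ _)
        fun i _ _ => sqNorm_nonneg _
    rw [symNegL0]
    linarith
  rw [← inv_div]
  exact (symRes_le_inv ε w (by linarith)).trans (inv_anti₀ (by positivity) hle)

theorem tsum_symRes_mul_pairAmp_le_of_notMem (ε : ℝ) (w : EuclideanSpace ℝ (Fin 2))
    (hf : IsKernel n f) (hg : IsKernel n g) (hfE : Summable fun k => symNegL0 n k * ‖f k‖ ^ 2)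
    (hgE : Summable fun k => symNegL0 n k * ‖g k‖ ^ 2) {a b c d : Fin (n + 1)} (hab : a ≠ b)
    (hcd : c ≠ d) (hbc : b ≠ c) (hbd : b ≠ d) (hda : d ≠ a) :
    ∑' k : Fin (n + 1) → Z2, ENNReal.ofReal
        (symRes ε w (n + 1) k * pairAmp f k a b * pairAmp g k c d) ≤
      ENNReal.ofReal (480 * Real.pi ^ 2 / n * (√(energy n f) * √(energy n g))) := by
  have hC : 0 ≤ 480 * Real.pi ^ 2 / n := by positivity
  have hEf := energy_nonneg n f
  have hEg := energy_nonneg n g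
  have hsplit : 480 * Real.pi ^ 2 / n * (√(energy n f) * √(energy n g)) =
      √(480 * Real.pi ^ 2 / n * energy n f) * √(480 * Real.pi ^ 2 / n * energy n g) := by
    rw [Real.sqrt_mul hC, Real.sqrt_mul hC, mul_mul_mul_comm, Real.mul_self_sqrt hC]
  have hweight (k : Fin (n + 1) → Z2) (i j : Fin (n + 1)) :
      0 ≤ pairWeight (sqNorm (k i)) (sqNorm (k j)) :=
    pairWeight_nonneg (sqNorm_nonneg _) (sqNorm_nonneg _)
  rw [hsplit]
  refine tsum_ofReal_le_sqrt_mul_sqrt (fun k => mul_nonneg (hweight k _ _) (sq_nonneg _))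
    (fun k => mul_nonneg (hweight k _ _) (sq_nonneg _)) (fun k => ?_) (by positivity)
    (by positivity) (tsum_pairWeight_mul_pairAmp_sq_le hf hfE hab hbd.symm hda)
    (tsum_pairWeight_mul_pairAmp_sq_le hg hgE hcd hbd hbc)
  rcases eq_or_ne (k b) 0 with hb | hb
  · rw [pairAmp_eq_zero hg hb hbc hbd, mul_zero, zero_pow two_ne_zero, mul_zero, mul_zero]
  rcases eq_or_ne (k d) 0 with hd | hd
  · rw [pairAmp_eq_zero hf hd hda hbd.symm, mul_zero, zero_mul, zero_pow two_ne_zero, mul_zero,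
      zero_mul]
  have hres := symRes_le_two_div ε w hbd hb
  rw [mul_mul_mul_comm, pairWeight_mul_swap (zero_lt_one.trans_le (one_le_sqNorm hb))
    (zero_lt_one.trans_le (one_le_sqNorm hd)), ← mul_pow, ← mul_pow, ← mul_assoc]
  have hfamp := pairAmp_nonneg f k a b
  have hgamp := pairAmp_nonneg g k c d
  have hres₀ := symRes_nonneg ε w (n + 1) k
  gcongr

theorem tsum_symRes_mul_pairAmp_le (ε : ℝ) (w : EuclideanSpace ℝ (Fin 2)) (hf : IsKernel n f)
    (hg : IsKernel n g) (hfE : Summable fun k => symNegL0 n k * ‖f k‖ ^ 2)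
    (hgE : Summable fun k => symNegL0 n k * ‖g k‖ ^ 2) {a b c d : Fin (n + 1)} (hab : a ≠ b)
    (hcd : c ≠ d) (hne : s(a, b) ≠ s(c, d)) :
    ∑' k : Fin (n + 1) → Z2, ENNReal.ofReal
        (symRes ε w (n + 1) k * pairAmp f k a b * pairAmp g k c d) ≤
      ENNReal.ofReal (480 * Real.pi ^ 2 / n * (√(energy n f) * √(energy n g))) := by
  -- Two distinct pairs each have an element outside the other; relabel so that these are `b`, `d`.
  have hb : (b ≠ c ∧ b ≠ d) ∨ (a ≠ c ∧ a ≠ d) := by grind [Sym2.eq_iff]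
  have hd : (d ≠ a ∧ d ≠ b) ∨ (c ≠ a ∧ c ≠ b) := by grind [Sym2.eq_iff]
  rcases hb with hb | hb <;> rcases hd with hd | hd
  · exact tsum_symRes_mul_pairAmp_le_of_notMem ε w hf hg hfE hgE hab hcd hb.1 hb.2 hd.1
  · simp only [pairAmp_comm hg _ c d]
    exact tsum_symRes_mul_pairAmp_le_of_notMem ε w hf hg hfE hgE hab hcd.symm hb.2 hb.1 hd.1
  · simp only [pairAmp_comm hf _ a b]
    exact tsum_symRes_mul_pairAmp_le_of_notMem ε w hf hg hfE hgE hab.symm hcd hb.1 hb.2 hd.2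
  · simp only [pairAmp_comm hf _ a b, pairAmp_comm hg _ c d]
    exact tsum_symRes_mul_pairAmp_le_of_notMem ε w hf hg hfE hgE hab.symm hcd.symm hb.2 hb.1 hd.2

end PairAmp

/-! ### The symbol expansion of the replacement operator -/

theorem splitEquiv_zero {n : ℕ} (j : Fin n) (l : Z2) (k : Fin n → Z2) :
    splitEquiv 0 j (l, k) = split k j l := by
  simp only [splitEquiv, split, Equiv.coe_fn_mk, Fin.insertNth_zero']

/-- The pairs of indices in `{0, …, n}` other than `{0, j + 1}`, the places where `split k j l` puts
the two new momenta. -/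
def otherPairs {n : ℕ} (j : Fin n) : Finset (Fin (n + 1) × Fin (n + 1)) :=
  (Finset.univ.filter fun p => p.1 < p.2).erase (0, j.succ)

theorem sum_Ioi_eq_add_sum_otherPairs {n : ℕ} (X : Fin (n + 1) → Fin (n + 1) → ℂ) (j : Fin n) :
    ∑ a, ∑ b ∈ Finset.Ioi a, X a b = X 0 j.succ + ∑ p ∈ otherPairs j, X p.1 p.2 := by
  have herase := Finset.add_sum_erase
    (Finset.univ.filter fun p : Fin (n + 1) × Fin (n + 1) => p.1 < p.2)
    (fun p => X p.1 p.2) (a := (0, j.succ)) (by simp [Fin.succ_pos])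
  exact (Finset.sum_finset_product' _ _ _ (by simp)).symm.trans herase.symm

theorem card_otherPairs_le {n : ℕ} (j : Fin n) : (otherPairs j).card ≤ (n + 1) ^ 2 := by
  refine (Finset.card_le_univ _).trans_eq ?_
  rw [Fintype.card_prod, Fintype.card_fin, sq]

section Expansion

variable {ε : ℝ} {w : EuclideanSpace ℝ (Fin 2)} {n : ℕ}

/-- The term of `𝒜^ε_+ f` in which the momenta `κ_a` and `κ_b` are merged, without the numerical
factor. -/
def pairTerm (ε : ℝ) (w : EuclideanSpace ℝ (Fin 2)) (f : (Fin n → Z2) → ℂ) (κ : Fin (n + 1) → Z2)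
    (a b : Fin (n + 1)) : ℂ :=
  (dot w (κ a + κ b) : ℂ) * (cutoff ε (κ a) (κ b) : ℂ) * f (merge κ a b)

/-- The coefficient of `𝒜^ε_- (-ℒ₀ - ℒ₀^𝔴 𝒢^ε)⁻¹` at the splitting of `k_j` into `l` and `k_j - l`,
without the numerical factor. -/
def splitCoeff (ε : ℝ) (w : EuclideanSpace ℝ (Fin 2)) (k : Fin n → Z2) (j : Fin n) (l : Z2) : ℝ :=
  dot w (k j) * cutoff ε l (k j - l) * symRes ε w (n + 1) (split k j l)

/-- The off-diagonal part of `-𝒜^ε_- (-ℒ₀ - ℒ₀^𝔴 𝒢^ε)⁻¹ 𝒜^ε_+`: the two momenta into which `𝒜^ε_-`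
splits `k_j` are not the two that `𝒜^ε_+` merges. -/
def offDiagonal (ε : ℝ) (w : EuclideanSpace ℝ (Fin 2)) (f : (Fin n → Z2) → ℂ) (k : Fin n → Z2) :
    ℂ :=
  ((lam ε ^ 2 / (2 * Real.pi ^ 2) : ℝ) : ℂ) * ∑ j : Fin n, ∑ p ∈ otherPairs j,
    ∑' l : Z2, (splitCoeff ε w k j l : ℂ) * pairTerm ε w f (split k j l) p.1 p.2

/-- The symbol of `ℒ₀^𝔴 𝒢^ε` plus the diagonal part of `-𝒜^ε_- (-ℒ₀ - ℒ₀^𝔴 𝒢^ε)⁻¹ 𝒜^ε_+`. -/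
def diagSymbol (ε : ℝ) (w : EuclideanSpace ℝ (Fin 2)) (n : ℕ) (k : Fin n → Z2) : ℝ :=
  ∑ j, dot w (k j) ^ 2 * (lam ε ^ 2 / (2 * Real.pi ^ 2) *
    (∑' l, cutoff ε l (k j - l) * symRes ε w (n + 1) (split k j l)) - 1 / 2 * symG ε w n k)

theorem summable_splitCoeff_mul (hε₀ : 0 < ε) (w : EuclideanSpace ℝ (Fin 2)) (k : Fin n → Z2)
    (j : Fin n) (F : Z2 → ℂ) : Summable fun l => (splitCoeff ε w k j l : ℂ) * F l := by
  obtain ⟨B, hB⟩ := cutoff_finite hε₀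
  refine summable_of_ne_finset_zero (s := B) fun l hl => ?_
  rw [splitCoeff, not_not.1 (mt (fun h => (hB _ _ h).1) hl), mul_zero, zero_mul,
    Complex.ofReal_zero, zero_mul]

theorem pairTerm_split_self {f : (Fin n → Z2) → ℂ} (hf : IsKernel n f) (k : Fin n → Z2)
    (j : Fin n) (l : Z2) :
    pairTerm ε w f (split k j l) 0 j.succ =
      (dot w (k j) : ℂ) * (cutoff ε l (k j - l) : ℂ) * f k := by
  have hsucc : split k j l j.succ = k j - l := by rw [split, Fin.cons_succ, Function.update_self]
  have hzero : split k j l 0 = l := rfl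
  rw [pairTerm, merge_comm hf _ j.succ 0, merge_split, hzero, hsucc, add_sub_cancel]

theorem splitCoeff_mul_pairTerm_self {f : (Fin n → Z2) → ℂ} (hf : IsKernel n f) (k : Fin n → Z2)
    (j : Fin n) (l : Z2) :
    (splitCoeff ε w k j l : ℂ) * pairTerm ε w f (split k j l) 0 j.succ =
      ((dot w (k j) ^ 2 * (cutoff ε l (k j - l) * symRes ε w (n + 1) (split k j l)) : ℝ) : ℂ) *
        f k := by
  rw [pairTerm_split_self hf, splitCoeff]
  rcases cutoff_eq_zero_or_one ε l (k j - l) with h | h <;> rw [h] <;> push_cast <;> ring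

theorem tsum_splitCoeff_mul_sum_pairTerm (hε₀ : 0 < ε) (w : EuclideanSpace ℝ (Fin 2))
    {f : (Fin n → Z2) → ℂ} (hf : IsKernel n f) (k : Fin n → Z2) (j : Fin n) :
    ∑' l, (splitCoeff ε w k j l : ℂ) *
        ∑ a, ∑ b ∈ Finset.Ioi a, pairTerm ε w f (split k j l) a b =
      ((dot w (k j) ^ 2 * ∑' l, cutoff ε l (k j - l) *
          symRes ε w (n + 1) (split k j l) : ℝ) : ℂ) * f k +
        ∑ p ∈ otherPairs j, ∑' l, (splitCoeff ε w k j l : ℂ) *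
          pairTerm ε w f (split k j l) p.1 p.2 := by
  have hsummable := summable_splitCoeff_mul hε₀ w k j
  simp only [sum_Ioi_eq_add_sum_otherPairs _ j, mul_add, Finset.mul_sum]
  rw [Summable.tsum_add (hsummable _) (summable_sum fun p _ => hsummable _),
    Summable.tsum_finsetSum fun p _ => hsummable _]
  simp only [splitCoeff_mul_pairTerm_self hf]
  rw [tsum_mul_right, ← Complex.ofReal_tsum, tsum_mul_left]

theorem neg_Aminus_resolvent_Aplus_apply (ε : ℝ) (w : EuclideanSpace ℝ (Fin 2)) (ψ : Family)
    (k : Fin n → Z2) :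
    -Aminus ε w (resolvent ε w (Aplus ε w ψ)) n k =
      ((lam ε ^ 2 / (2 * Real.pi ^ 2) : ℝ) : ℂ) * ∑ j : Fin n, ∑' l, (splitCoeff ε w k j l : ℂ) *
        ∑ a, ∑ b ∈ Finset.Ioi a, pairTerm ε w (ψ n) (split k j l) a b := by
  let S (j : Fin n) (l : Z2) : ℂ := ∑ a, ∑ b ∈ Finset.Ioi a, pairTerm ε w (ψ n) (split k j l) a b
  let T (j : Fin n) : ℂ := ∑' l,
    ((cutoff ε l (k j - l) * symRes ε w (n + 1) (split k j l) : ℝ) : ℂ) * S j l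
  have hinner (j : Fin n) :
      ∑' l, (cutoff ε l (k j - l) : ℂ) * resolvent ε w (Aplus ε w ψ) (n + 1) (split k j l) =
        -(2 * Complex.I / (2 * Real.pi)) * ((lam ε : ℂ) / (n + 1)) * T j := by
    rw [← tsum_mul_left]
    refine tsum_congr fun l => ?_
    change _ * ((symRes ε w (n + 1) (split k j l) : ℂ) * (_ * S j l)) = _
    push_cast
    ring
  have hcoeff (j : Fin n) : ∑' l, (splitCoeff ε w k j l : ℂ) * S j l = (dot w (k j) : ℂ) * T j := by
    rw [← tsum_mul_left]
    refine tsum_congr fun l => ?_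
    rw [splitCoeff]
    push_cast
    ring
  have hn : (n : ℂ) + 1 ≠ 0 := by exact_mod_cast n.succ_ne_zero
  have hpi : (Real.pi : ℂ) ≠ 0 := by exact_mod_cast Real.pi_ne_zero
  change _ = _ * ∑ j, ∑' l, (splitCoeff ε w k j l : ℂ) * S j l
  simp only [Aminus, hinner, hcoeff]
  rw [Finset.mul_sum, Finset.mul_sum, ← Finset.sum_neg_distrib]
  refine Finset.sum_congr rfl fun j _ => ?_
  push_cast
  field_simp
  linear_combination (-(lam ε : ℂ) ^ 2 * dot w (k j) * T j) * Complex.I_sq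

theorem replacementOp_apply (hε₀ : 0 < ε) (w : EuclideanSpace ℝ (Fin 2)) {ψ : Family}
    (hψ : IsKernel n (ψ n)) (k : Fin n → Z2) :
    replacementOp ε w ψ n k = (diagSymbol ε w n k : ℂ) * ψ n k + offDiagonal ε w (ψ n) k := by
  change -Aminus ε w (resolvent ε w (Aplus ε w ψ)) n k + L0w w (Geps ε w ψ) n k = _
  have hsymbol : diagSymbol ε w n k = lam ε ^ 2 / (2 * Real.pi ^ 2) * (∑ j, dot w (k j) ^ 2 *
      ∑' l, cutoff ε l (k j - l) * symRes ε w (n + 1) (split k j l)) +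
        symL0w w n k * symG ε w n k := by
    rw [diagSymbol, symL0w, Finset.mul_sum, neg_mul, mul_assoc, Finset.sum_mul, Finset.mul_sum,
      ← sub_eq_add_neg, ← Finset.sum_sub_distrib]
    exact Finset.sum_congr rfl fun j _ => by ring
  rw [neg_Aminus_resolvent_Aplus_apply, L0w_Geps_apply]
  simp only [tsum_splitCoeff_mul_sum_pairTerm hε₀ w hψ]
  rw [Finset.sum_add_distrib, ← Finset.sum_mul, ← Complex.ofReal_sum, offDiagonal, hsymbol,
    Complex.ofReal_add, Complex.ofReal_mul (lam ε ^ 2 / (2 * Real.pi ^ 2))]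
  ring

theorem abs_diagSymbol_le (hw : w ≠ 0) (hε₀ : 0 < ε) (hε₁ : ε < 1) {k : Fin n → Z2}
    (hk : ∀ i, k i ≠ 0) :
    |diagSymbol ε w n k| ≤ 2 * diagonalConst w * ‖w‖ ^ 2 * lam ε ^ 2 * symNegL0 n k := by
  calc |diagSymbol ε w n k|
      ≤ ∑ j, ‖w‖ ^ 2 * sqNorm (k j) * (diagonalConst w * lam ε ^ 2) := by
        refine (Finset.abs_sum_le_sum_abs _ _).trans (Finset.sum_le_sum fun j _ => ?_)
        rw [abs_mul, abs_of_nonneg (sq_nonneg _)]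
        exact mul_le_mul (dot_sq_le w _) (abs_diagonal_sub_le hw hε₀ hε₁ (hk j)) (abs_nonneg _)
          (mul_nonneg (sq_nonneg _) (sqNorm_nonneg _))
    _ = 2 * diagonalConst w * ‖w‖ ^ 2 * lam ε ^ 2 * symNegL0 n k := by
        rw [← Finset.sum_mul, ← Finset.mul_sum, symNegL0]
        ring

end Expansion

/-! ### The off-diagonal part -/

theorem abs_dot_le (w : EuclideanSpace ℝ (Fin 2)) (k : Z2) : |dot w k| ≤ ‖w‖ * √(sqNorm k) := by
  rw [← Real.sqrt_sq (norm_nonneg w), ← Real.sqrt_mul (sq_nonneg _)]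
  exact Real.abs_le_sqrt (dot_sq_le w k)

section OffDiagonal

variable {n : ℕ} {f g : (Fin n → Z2) → ℂ}

theorem pairAmp_split (g : (Fin n → Z2) → ℂ) (k : Fin n → Z2) (j : Fin n) (l : Z2) :
    pairAmp g (split k j l) j.succ 0 = √(sqNorm (k j)) * ‖g k‖ := by
  rw [← splitEquiv_zero, ← Fin.zero_succAbove, pairAmp_splitEquiv]

theorem norm_pairTerm_le (ε : ℝ) (w : EuclideanSpace ℝ (Fin 2)) (f : (Fin n → Z2) → ℂ)
    (κ : Fin (n + 1) → Z2) (a b : Fin (n + 1)) :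
    ‖pairTerm ε w f κ a b‖ ≤ ‖w‖ * pairAmp f κ a b := by
  rw [pairTerm, norm_dot_mul_cutoff_mul, pairAmp, ← mul_assoc]
  refine mul_le_mul_of_nonneg_right ?_ (norm_nonneg _)
  exact (mul_le_of_le_one_right (abs_nonneg _) ((le_abs_self _).trans (cutoff_le_one _ _ _))).trans
    (abs_dot_le w _)

theorem abs_splitCoeff_le (ε : ℝ) (w : EuclideanSpace ℝ (Fin 2)) (k : Fin n → Z2) (j : Fin n)
    (l : Z2) :
    |splitCoeff ε w k j l| ≤ ‖w‖ * √(sqNorm (k j)) * symRes ε w (n + 1) (split k j l) := by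
  rw [splitCoeff, abs_mul, abs_mul, abs_of_nonneg (symRes_nonneg ε w _ _)]
  refine mul_le_mul_of_nonneg_right ?_ (symRes_nonneg ε w _ _)
  exact (mul_le_of_le_one_right (abs_nonneg _) (cutoff_le_one _ _ _)).trans (abs_dot_le w _)

theorem norm_splitCoeff_mul_pairTerm_mul_le (ε : ℝ) (w : EuclideanSpace ℝ (Fin 2))
    (f g : (Fin n → Z2) → ℂ) (k : Fin n → Z2) (j : Fin n) (l : Z2) (a b : Fin (n + 1)) :
    ‖(splitCoeff ε w k j l : ℂ) * pairTerm ε w f (split k j l) a b‖ * ‖g k‖ ≤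
      ‖w‖ ^ 2 * (symRes ε w (n + 1) (split k j l) * pairAmp f (split k j l) a b *
        pairAmp g (split k j l) j.succ 0) := by
  rw [norm_mul, Complex.norm_real, Real.norm_eq_abs, pairAmp_split]
  have hres := symRes_nonneg ε w (n + 1) (split k j l)
  calc |splitCoeff ε w k j l| * ‖pairTerm ε w f (split k j l) a b‖ * ‖g k‖
      ≤ ‖w‖ * √(sqNorm (k j)) * symRes ε w (n + 1) (split k j l) *
          (‖w‖ * pairAmp f (split k j l) a b) * ‖g k‖ := by
        gcongr
        exacts [abs_splitCoeff_le ε w k j l, norm_pairTerm_le ε w f _ a b]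
    _ = _ := by ring

theorem tsum_tsum_splitCoeff_mul_pairTerm_le (ε : ℝ) (w : EuclideanSpace ℝ (Fin 2))
    (hf : IsKernel n f) (hg : IsKernel n g) (hfE : Summable fun k => symNegL0 n k * ‖f k‖ ^ 2)
    (hgE : Summable fun k => symNegL0 n k * ‖g k‖ ^ 2) {j : Fin n} {p : Fin (n + 1) × Fin (n + 1)}
    (hp : p ∈ otherPairs j) :
    ∑' k, ∑' l, ENNReal.ofReal
        (‖(splitCoeff ε w k j l : ℂ) * pairTerm ε w f (split k j l) p.1 p.2‖ * ‖g k‖) ≤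
      ENNReal.ofReal (‖w‖ ^ 2 * (480 * Real.pi ^ 2 / n * (√(energy n f) * √(energy n g)))) := by
  obtain ⟨hne, hmem⟩ := Finset.mem_erase.1 hp
  have hlt : p.1 < p.2 := (Finset.mem_filter.1 hmem).2
  have hsym : s(p.1, p.2) ≠ s(j.succ, 0) := by
    rw [Ne, Sym2.eq_iff]
    rintro (⟨-, h⟩ | ⟨h₁, h₂⟩)
    · exact (Fin.not_lt_zero _) (h ▸ hlt)
    · exact hne (Prod.ext h₁ h₂)
  have hpairs := tsum_symRes_mul_pairAmp_le ε w hf hg hfE hgE hlt.ne (Fin.succ_ne_zero j) hsym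
  rw [← (splitEquiv 0 j).tsum_eq, ENNReal.tsum_prod', ENNReal.tsum_comm] at hpairs
  rw [ENNReal.ofReal_mul (sq_nonneg _)]
  refine le_trans ?_ (mul_le_mul_right hpairs _)
  simp only [← ENNReal.tsum_mul_left]
  refine ENNReal.tsum_le_tsum fun k => ENNReal.tsum_le_tsum fun l => ?_
  rw [splitEquiv_zero, ← ENNReal.ofReal_mul (sq_nonneg _)]
  exact ENNReal.ofReal_le_ofReal (norm_splitCoeff_mul_pairTerm_mul_le ε w f g k j l p.1 p.2)

theorem ofReal_norm_offDiagonal_mul_le (ε : ℝ) (w : EuclideanSpace ℝ (Fin 2))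
    (f g : (Fin n → Z2) → ℂ) (k : Fin n → Z2) :
    ENNReal.ofReal (‖offDiagonal ε w f k‖ * ‖g k‖) ≤
      ENNReal.ofReal (lam ε ^ 2 / (2 * Real.pi ^ 2)) * ∑ j : Fin n, ∑ p ∈ otherPairs j,
        ∑' l, ENNReal.ofReal
          (‖(splitCoeff ε w k j l : ℂ) * pairTerm ε w f (split k j l) p.1 p.2‖ * ‖g k‖) := by
  simp only [ENNReal.ofReal_mul (norm_nonneg _), ofReal_norm, ENNReal.tsum_mul_right,
    ← Finset.sum_mul]
  rw [offDiagonal, enorm_mul, ← mul_assoc]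
  gcongr
  · rw [← ofReal_norm, Complex.norm_real, Real.norm_of_nonneg (by positivity)]
  · refine (enorm_sum_le _ _).trans (Finset.sum_le_sum fun j _ => ?_)
    exact (enorm_sum_le _ _).trans (Finset.sum_le_sum fun p _ => enorm_tsum_le_tsum_enorm)

theorem sum_card_otherPairs_mul_le (n : ℕ) {x : ℝ} (hx : 0 ≤ x) :
    ∑ j : Fin n, (otherPairs j).card * (x / n) ≤ 4 * (n : ℝ) ^ 2 * x := by
  rcases Nat.eq_zero_or_pos n with rfl | hn
  · simp
  have hn₁ : (1 : ℝ) ≤ n := by exact_mod_cast hn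
  have hcard (j : Fin n) : ((otherPairs j).card : ℝ) ≤ 4 * (n : ℝ) ^ 2 := by
    calc ((otherPairs j).card : ℝ) ≤ ((n : ℝ) + 1) ^ 2 := by exact_mod_cast card_otherPairs_le j
      _ ≤ 4 * (n : ℝ) ^ 2 := by nlinarith
  calc ∑ j : Fin n, (otherPairs j).card * (x / n) ≤ ∑ _j : Fin n, 4 * (n : ℝ) ^ 2 * (x / n) := by
        gcongr with j
        exact hcard j
    _ = 4 * (n : ℝ) ^ 2 * x := by
        rw [Finset.sum_const, Finset.card_univ, Fintype.card_fin, nsmul_eq_mul]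
        field_simp

theorem tsum_offDiagonal_le (ε : ℝ) (w : EuclideanSpace ℝ (Fin 2)) (hf : IsKernel n f)
    (hg : IsKernel n g) (hfE : Summable fun k => symNegL0 n k * ‖f k‖ ^ 2)
    (hgE : Summable fun k => symNegL0 n k * ‖g k‖ ^ 2) :
    ∑' k, ENNReal.ofReal (‖offDiagonal ε w f k‖ * ‖g k‖) ≤
      ENNReal.ofReal (960 * ‖w‖ ^ 2 * lam ε ^ 2 * n ^ 2 * (√(energy n f) * √(energy n g))) := by
  set EE := √(energy n f) * √(energy n g) with hEE
  set c : ℝ := lam ε ^ 2 / (2 * Real.pi ^ 2) with hc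
  have hEE₀ : 0 ≤ EE := by positivity
  have hc₀ : 0 ≤ c := by positivity
  calc ∑' k, ENNReal.ofReal (‖offDiagonal ε w f k‖ * ‖g k‖)
      ≤ ∑' k, ENNReal.ofReal c * ∑ j : Fin n, ∑ p ∈ otherPairs j, ∑' l, ENNReal.ofReal
          (‖(splitCoeff ε w k j l : ℂ) * pairTerm ε w f (split k j l) p.1 p.2‖ * ‖g k‖) :=
        ENNReal.tsum_le_tsum (ofReal_norm_offDiagonal_mul_le ε w f g)
    _ = ENNReal.ofReal c * ∑ j : Fin n, ∑ p ∈ otherPairs j, ∑' k, ∑' l, ENNReal.ofReal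
          (‖(splitCoeff ε w k j l : ℂ) * pairTerm ε w f (split k j l) p.1 p.2‖ * ‖g k‖) := by
        simp only [ENNReal.tsum_mul_left, Summable.tsum_finsetSum fun _ _ => ENNReal.summable]
    _ ≤ ENNReal.ofReal c * ∑ j : Fin n, ∑ _p ∈ otherPairs j,
          ENNReal.ofReal (‖w‖ ^ 2 * (480 * Real.pi ^ 2 / n * EE)) := by
        gcongr with j _ p hp
        exact tsum_tsum_splitCoeff_mul_pairTerm_le ε w hf hg hfE hgE hp
    _ = ENNReal.ofReal (c * ∑ j : Fin n,
          (otherPairs j).card * (‖w‖ ^ 2 * (480 * Real.pi ^ 2) * EE / n)) := by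
        rw [ENNReal.ofReal_mul hc₀, ENNReal.ofReal_sum_of_nonneg fun _ _ => by positivity]
        congr 1
        refine Finset.sum_congr rfl fun j _ => ?_
        rw [Finset.sum_const, nsmul_eq_mul, ENNReal.ofReal_mul (Nat.cast_nonneg _),
          ENNReal.ofReal_natCast]
        ring_nf
    _ ≤ ENNReal.ofReal (c * (4 * (n : ℝ) ^ 2 * (‖w‖ ^ 2 * (480 * Real.pi ^ 2) * EE))) := by
        gcongr
        exact sum_card_otherPairs_mul_le n (by positivity)
    _ = ENNReal.ofReal (960 * ‖w‖ ^ 2 * lam ε ^ 2 * n ^ 2 * EE) := by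
        rw [hc]
        congr 1
        field_simp
        ring

end OffDiagonal

/-! ### The replacement estimate -/

/-- The constant of the replacement lemma: twice the constant of the diagonal comparison, times
`‖w‖²`, plus the constant of the off-diagonal bound. -/
def replacementConst (w : EuclideanSpace ℝ (Fin 2)) : ℝ :=
  2 * diagonalConst w * ‖w‖ ^ 2 + 960 * ‖w‖ ^ 2

theorem diagonalConst_pos (w : EuclideanSpace ℝ (Fin 2)) : 0 < diagonalConst w := by
  unfold diagonalConst
  positivity

theorem replacementConst_pos {w : EuclideanSpace ℝ (Fin 2)} (hw : w ≠ 0) :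
    0 < replacementConst w := by
  have := norm_pos_iff.2 hw
  have := diagonalConst_pos w
  unfold replacementConst
  positivity

section Chaos

variable {n : ℕ} {f g : (Fin n → Z2) → ℂ}

theorem tsum_symNegL0_mul_le (hfE : Summable fun k => symNegL0 n k * ‖f k‖ ^ 2)
    (hgE : Summable fun k => symNegL0 n k * ‖g k‖ ^ 2) :
    ∑' k, ENNReal.ofReal (symNegL0 n k * ‖f k‖ * ‖g k‖) ≤
      ENNReal.ofReal (√(energy n f) * √(energy n g)) :=
  tsum_ofReal_le_sqrt_mul_sqrt (energy_term_nonneg f) (energy_term_nonneg g)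
    (fun k => le_of_eq (by ring)) (energy_nonneg n f) (energy_nonneg n g)
    (tsum_ofReal_energy_term hfE).le (tsum_ofReal_energy_term hgE).le

theorem norm_replacementOp_mul_le {w : EuclideanSpace ℝ (Fin 2)} (hw : w ≠ 0) {ε : ℝ} (hε₀ : 0 < ε)
    (hε₁ : ε < 1) {ψ : Family} (hψ : IsKernel n (ψ n)) (hg : IsKernel n g) (k : Fin n → Z2) :
    ‖replacementOp ε w ψ n k‖ * ‖g k‖ ≤
      2 * diagonalConst w * ‖w‖ ^ 2 * lam ε ^ 2 * (symNegL0 n k * ‖ψ n k‖ * ‖g k‖) +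
        ‖offDiagonal ε w (ψ n) k‖ * ‖g k‖ := by
  by_cases hk : ∃ i, k i = 0
  · simp [hg.zero_mean k hk]
  have hsymbol := abs_diagSymbol_le hw hε₀ hε₁ (not_exists.1 hk)
  calc ‖replacementOp ε w ψ n k‖ * ‖g k‖
      ≤ (|diagSymbol ε w n k| * ‖ψ n k‖ + ‖offDiagonal ε w (ψ n) k‖) * ‖g k‖ := by
        rw [replacementOp_apply hε₀ w hψ, ← Real.norm_eq_abs, ← Complex.norm_real,
          ← norm_mul (diagSymbol ε w n k : ℂ)]
        gcongr
        exact norm_add_le _ _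
    _ ≤ (2 * diagonalConst w * ‖w‖ ^ 2 * lam ε ^ 2 * symNegL0 n k * ‖ψ n k‖ +
          ‖offDiagonal ε w (ψ n) k‖) * ‖g k‖ := by gcongr
    _ = _ := by ring

theorem tsum_replacementOp_le {w : EuclideanSpace ℝ (Fin 2)} (hw : w ≠ 0) {ε : ℝ} (hε₀ : 0 < ε)
    (hε₁ : ε < 1) {ψ : Family} (hψ : IsKernel n (ψ n)) (hg : IsKernel n g)
    (hψE : Summable fun k => symNegL0 n k * ‖ψ n k‖ ^ 2)
    (hgE : Summable fun k => symNegL0 n k * ‖g k‖ ^ 2) :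
    ∑' k, ENNReal.ofReal (‖replacementOp ε w ψ n k‖ * ‖g k‖) ≤ ENNReal.ofReal
      (replacementConst w * lam ε ^ 2 * n ^ 2 * (√(energy n (ψ n)) * √(energy n g))) := by
  set EE := √(energy n (ψ n)) * √(energy n g) with hEE
  set c := 2 * diagonalConst w * ‖w‖ ^ 2 * lam ε ^ 2 with hc
  have hEE₀ : 0 ≤ EE := by positivity
  have hc₀ : 0 ≤ c := by
    have := diagonalConst_pos w
    positivity
  have hEE_le : EE ≤ n ^ 2 * EE := by
    rcases Nat.eq_zero_or_pos n with rfl | hn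
    · simp [hEE, energy, symNegL0]
    · exact le_mul_of_one_le_left hEE₀ (one_le_pow₀ (by exact_mod_cast hn))
  calc ∑' k, ENNReal.ofReal (‖replacementOp ε w ψ n k‖ * ‖g k‖)
      ≤ ∑' k, (ENNReal.ofReal c * ENNReal.ofReal (symNegL0 n k * ‖ψ n k‖ * ‖g k‖) +
          ENNReal.ofReal (‖offDiagonal ε w (ψ n) k‖ * ‖g k‖)) := by
        refine ENNReal.tsum_le_tsum fun k => ?_
        have hs := symNegL0_nonneg n k
        rw [← ENNReal.ofReal_mul hc₀, ← ENNReal.ofReal_add (by positivity) (by positivity)]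
        exact ENNReal.ofReal_le_ofReal (norm_replacementOp_mul_le hw hε₀ hε₁ hψ hg k)
    _ ≤ ENNReal.ofReal c * ENNReal.ofReal EE +
          ENNReal.ofReal (960 * ‖w‖ ^ 2 * lam ε ^ 2 * n ^ 2 * EE) := by
        rw [ENNReal.tsum_add, ENNReal.tsum_mul_left]
        gcongr
        exacts [tsum_symNegL0_mul_le hψE hgE, tsum_offDiagonal_le ε w hψ hg hψE hgE]
    _ = ENNReal.ofReal (c * EE + 960 * ‖w‖ ^ 2 * lam ε ^ 2 * n ^ 2 * EE) := by
        rw [← ENNReal.ofReal_mul hc₀, ← ENNReal.ofReal_add (by positivity) (by positivity)]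
    _ ≤ ENNReal.ofReal (c * (n ^ 2 * EE) + 960 * ‖w‖ ^ 2 * lam ε ^ 2 * n ^ 2 * EE) := by gcongr
    _ = ENNReal.ofReal (replacementConst w * lam ε ^ 2 * n ^ 2 * EE) := by
        rw [hc, replacementConst]
        ring_nf

end Chaos

theorem norm_sq_number_sqrtNegL0 (ψ : Family) (n : ℕ) (k : Fin n → Z2) :
    ‖number (sqrtNegL0 ψ) n k‖ ^ 2 = (n : ℝ) ^ 2 * (symNegL0 n k * ‖ψ n k‖ ^ 2) := by
  simp only [number, sqrtNegL0, multiplier, norm_mul, Complex.norm_real, Real.norm_eq_abs, mul_pow,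
    sq_abs]
  rw [Real.sq_sqrt (symNegL0_nonneg n k)]

theorem summable_energy {ψ : Family} (h : MemFock (number (sqrtNegL0 ψ))) (n : ℕ) :
    Summable fun k => symNegL0 n k * ‖ψ n k‖ ^ 2 := by
  rcases Nat.eq_zero_or_pos n with rfl | hn
  · simp [symNegL0]
  · have hsum := (h.kernel n).sq_summable
    simp only [norm_sq_number_sqrtNegL0] at hsum
    exact (summable_mul_left_iff (by positivity)).1 hsum

theorem tsum_norm_sq_number_sqrtNegL0 (ψ : Family) (n : ℕ) :
    ∑' k, ‖number (sqrtNegL0 ψ) n k‖ ^ 2 = (n : ℝ) ^ 2 * energy n (ψ n) := by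
  simp only [norm_sq_number_sqrtNegL0, tsum_mul_left, energy]

theorem tsum_factorial_mul_energy_le {ψ₁ ψ₂ : Family} (hd₁ : MemFock (number (sqrtNegL0 ψ₁)))
    (hd₂ : MemFock (number (sqrtNegL0 ψ₂))) :
    ∑' n : ℕ, ENNReal.ofReal
        ((n.factorial : ℝ) * (n : ℝ) ^ 2 * (√(energy n (ψ₁ n)) * √(energy n (ψ₂ n)))) ≤
      ENNReal.ofReal (fockNorm (number (sqrtNegL0 ψ₁)) * fockNorm (number (sqrtNegL0 ψ₂))) := by
  have hpos (ψ : Family) (n : ℕ) : 0 ≤ (n.factorial : ℝ) * ((n : ℝ) ^ 2 * energy n (ψ n)) :=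
    mul_nonneg (Nat.cast_nonneg _) (mul_nonneg (sq_nonneg _) (energy_nonneg n (ψ n)))
  have hsum₁ := hd₁.summable
  have hsum₂ := hd₂.summable
  simp only [tsum_norm_sq_number_sqrtNegL0] at hsum₁ hsum₂
  simp only [fockNorm, tsum_norm_sq_number_sqrtNegL0]
  refine tsum_ofReal_le_sqrt_mul_sqrt (hpos ψ₁) (hpos ψ₂) (fun n => le_of_eq ?_)
    (tsum_nonneg (hpos ψ₁)) (tsum_nonneg (hpos ψ₂))
    (ENNReal.ofReal_tsum_of_nonneg (hpos ψ₁) hsum₁).ge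
    (ENNReal.ofReal_tsum_of_nonneg (hpos ψ₂) hsum₂).ge
  rw [mul_pow, mul_pow (√_), Real.sq_sqrt (energy_nonneg _ _), Real.sq_sqrt (energy_nonneg _ _)]
  ring

section Fock

variable {w : EuclideanSpace ℝ (Fin 2)} {ε : ℝ}

theorem norm_tsum_replacementOp_mul_conj_le (hw : w ≠ 0) (hε₀ : 0 < ε) (hε₁ : ε < 1) {n : ℕ}
    {ψ : Family} {g : (Fin n → Z2) → ℂ} (hψ : IsKernel n (ψ n)) (hg : IsKernel n g)
    (hψE : Summable fun k => symNegL0 n k * ‖ψ n k‖ ^ 2)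
    (hgE : Summable fun k => symNegL0 n k * ‖g k‖ ^ 2) :
    ‖∑' k, replacementOp ε w ψ n k * (starRingEnd ℂ) (g k)‖ ≤
      replacementConst w * lam ε ^ 2 * n ^ 2 * (√(energy n (ψ n)) * √(energy n g)) := by
  have hconst := replacementConst_pos hw
  have hnorm (k : Fin n → Z2) : ‖replacementOp ε w ψ n k * (starRingEnd ℂ) (g k)‖ =
      ‖replacementOp ε w ψ n k‖ * ‖g k‖ := by rw [norm_mul, RCLike.norm_conj]
  obtain ⟨hsum, hle⟩ := summable_and_tsum_le (fun k => by positivity) (by positivity)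
    (tsum_replacementOp_le hw hε₀ hε₁ hψ hg hψE hgE)
  simp only [← hnorm] at hsum hle
  exact (norm_tsum_le_tsum_norm hsum).trans hle

theorem summable_and_norm_fockInner_replacementOp_le (hw : w ≠ 0) (hε₀ : 0 < ε) (hε₁ : ε < 1)
    {ψ₁ ψ₂ : Family} (h₁ : MemFock ψ₁) (h₂ : MemFock ψ₂)
    (hd₁ : MemFock (number (sqrtNegL0 ψ₁))) (hd₂ : MemFock (number (sqrtNegL0 ψ₂))) :
    (Summable fun n : ℕ => (n.factorial : ℝ) *
        ‖∑' k, replacementOp ε w ψ₁ n k * (starRingEnd ℂ) (ψ₂ n k)‖) ∧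
      ‖fockInner (replacementOp ε w ψ₁) ψ₂‖ ≤ replacementConst w * lam ε ^ 2 *
        fockNorm (number (sqrtNegL0 ψ₁)) * fockNorm (number (sqrtNegL0 ψ₂)) := by
  have hconst := replacementConst_pos hw
  have hK : 0 ≤ replacementConst w * lam ε ^ 2 := by positivity
  have hM : 0 ≤ replacementConst w * lam ε ^ 2 *
      (fockNorm (number (sqrtNegL0 ψ₁)) * fockNorm (number (sqrtNegL0 ψ₂))) :=
    mul_nonneg hK (mul_nonneg (Real.sqrt_nonneg _) (Real.sqrt_nonneg _))
  have hbound : ∑' n : ℕ, ENNReal.ofReal ((n.factorial : ℝ) *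
        ‖∑' k, replacementOp ε w ψ₁ n k * (starRingEnd ℂ) (ψ₂ n k)‖) ≤
      ENNReal.ofReal (replacementConst w * lam ε ^ 2 *
        (fockNorm (number (sqrtNegL0 ψ₁)) * fockNorm (number (sqrtNegL0 ψ₂)))) := by
    rw [ENNReal.ofReal_mul hK]
    refine le_trans ?_ (mul_le_mul_right (tsum_factorial_mul_energy_le hd₁ hd₂) _)
    rw [← ENNReal.tsum_mul_left]
    refine ENNReal.tsum_le_tsum fun n => ?_
    rw [← ENNReal.ofReal_mul hK]
    refine ENNReal.ofReal_le_ofReal ?_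
    have hchaos := norm_tsum_replacementOp_mul_conj_le hw hε₀ hε₁ (h₁.kernel n) (h₂.kernel n)
      (summable_energy hd₁ n) (summable_energy hd₂ n)
    linarith [mul_le_mul_of_nonneg_left hchaos (Nat.cast_nonneg (α := ℝ) n.factorial)]
  obtain ⟨hsum, hle⟩ := summable_and_tsum_le (fun n => by positivity) hM hbound
  have hnorm (n : ℕ) : ‖(n.factorial : ℂ) *
      ∑' k, replacementOp ε w ψ₁ n k * (starRingEnd ℂ) (ψ₂ n k)‖ = (n.factorial : ℝ) *
        ‖∑' k, replacementOp ε w ψ₁ n k * (starRingEnd ℂ) (ψ₂ n k)‖ := by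
    rw [norm_mul, Complex.norm_natCast]
  refine ⟨hsum, ?_⟩
  simp only [← hnorm] at hsum hle
  rw [mul_assoc (_ * _)]
  exact (norm_tsum_le_tsum_norm hsum).trans hle

theorem isKernel_invSqrtNegL0 {ψ : Family} {n : ℕ} (hψ : IsKernel n (ψ n)) :
    IsKernel n (invSqrtNegL0 ψ n) := by
  change IsKernel n fun k => (((√(symNegL0 n k))⁻¹ : ℝ) : ℂ) * ψ n k
  refine isKernel_multiplier (M := 2) hψ (fun σ k => by rw [symNegL0_comp_perm]) fun k hk => ?_
  rw [abs_of_nonneg (by positivity)]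
  rcases n with - | n
  · simp [symNegL0]
  · have hsqrt : 2⁻¹ ≤ √(symNegL0 (n + 1) k) :=
      Real.le_sqrt_of_sq_le (by linarith [half_le_symNegL0 (hk 0)])
    exact inv_le_of_inv_le₀ two_pos hsqrt

theorem energy_invSqrtNegL0_le {ψ : Family} {n : ℕ} (hψ : IsKernel n (ψ n)) :
    (Summable fun k => symNegL0 n k * ‖invSqrtNegL0 ψ n k‖ ^ 2) ∧
      energy n (invSqrtNegL0 ψ n) ≤ ∑' k, ‖ψ n k‖ ^ 2 := by
  have hle (k : Fin n → Z2) : symNegL0 n k * ‖invSqrtNegL0 ψ n k‖ ^ 2 ≤ ‖ψ n k‖ ^ 2 := by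
    simp only [invSqrtNegL0, multiplier, norm_mul, Complex.norm_real, Real.norm_eq_abs, mul_pow,
      sq_abs, inv_pow]
    rw [Real.sq_sqrt (symNegL0_nonneg n k), ← mul_assoc]
    exact mul_le_of_le_one_left (sq_nonneg _) mul_inv_le_one
  have hsum := Summable.of_nonneg_of_le (energy_term_nonneg _) hle hψ.sq_summable
  exact ⟨hsum, hsum.tsum_le_tsum hle hψ.sq_summable⟩

theorem offDiagonal_zero (ε : ℝ) (w : EuclideanSpace ℝ (Fin 2)) {n : ℕ} (k : Fin n → Z2) :
    offDiagonal ε w (0 : (Fin n → Z2) → ℂ) k = 0 := by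
  simp [offDiagonal, pairTerm]

theorem isKernel_zero (n : ℕ) : IsKernel n (0 : (Fin n → Z2) → ℂ) where
  symm _ _ := rfl
  zero_mean _ _ := rfl
  sq_summable := by simp

theorem inChaos_invSqrtNegL0 {n : ℕ} {ψ : Family} (h : InChaos n ψ) :
    InChaos n (invSqrtNegL0 ψ) := fun m hm => by
  funext k
  simp [invSqrtNegL0, multiplier, h m hm]

theorem inChaos_replacementOp (hε₀ : 0 < ε) (w : EuclideanSpace ℝ (Fin 2)) {n : ℕ} {ψ : Family}
    (h : InChaos n ψ) : InChaos n (replacementOp ε w ψ) := fun m hm => by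
  have hker : IsKernel m (ψ m) := h m hm ▸ isKernel_zero m
  funext k
  rw [replacementOp_apply hε₀ w hker, h m hm, offDiagonal_zero, Pi.zero_apply, mul_zero, add_zero]

theorem fockNorm_of_inChaos {n : ℕ} {ψ : Family} (h : InChaos n ψ) :
    fockNorm ψ = √(n.factorial : ℝ) * √(∑' k, ‖ψ n k‖ ^ 2) := by
  rw [fockNorm, tsum_eq_single n fun m hm => by simp [h m hm], Real.sqrt_mul (Nat.cast_nonneg _)]

theorem memFock_of_inChaos {n : ℕ} {ψ : Family} (h : InChaos n ψ) (hker : ∀ m, IsKernel m (ψ m)) :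
    MemFock ψ where
  kernel := hker
  summable := summable_of_ne_finset_zero (s := {n}) fun m hm => by
    simp [h m (by simpa using hm)]

theorem sqrt_tsum_norm_sq_sandwich_le (hw : w ≠ 0) (hε₀ : 0 < ε) (hε₁ : ε < 1) {n : ℕ} {ψ : Family}
    (hψ : IsKernel n (ψ n)) :
    √(∑' k, ‖invSqrtNegL0 (replacementOp ε w (invSqrtNegL0 ψ)) n k‖ ^ 2) ≤
      replacementConst w * lam ε ^ 2 * n ^ 2 * √(∑' k, ‖ψ n k‖ ^ 2) := by
  set φ := invSqrtNegL0 ψ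
  set u := invSqrtNegL0 (replacementOp ε w φ) with hu
  have hconst := replacementConst_pos hw
  have hφ : IsKernel n (φ n) := isKernel_invSqrtNegL0 hψ
  have huker : IsKernel n (u n) := isKernel_invSqrtNegL0 (isKernel_replacementOp hε₀ hw hφ)
  obtain ⟨hφE, hφ_le⟩ := energy_invSqrtNegL0_le hψ
  obtain ⟨hvE, hv_le⟩ := energy_invSqrtNegL0_le huker
  -- Duality: `‖u‖² = ⟨ℛ φ, (-ℒ₀)^{-1/2} u⟩`, so one factor `‖u‖` can be cancelled.
  have hdual (k : Fin n → Z2) :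
      ‖replacementOp ε w φ n k‖ * ‖invSqrtNegL0 u n k‖ = ‖u n k‖ ^ 2 := by
    simp only [hu, invSqrtNegL0, multiplier, norm_mul]
    ring
  have hbound := tsum_replacementOp_le hw hε₀ hε₁ hφ (isKernel_invSqrtNegL0 huker) hφE hvE
  simp only [hdual] at hbound
  obtain ⟨-, hle⟩ := summable_and_tsum_le (fun k => sq_nonneg _) (by positivity) hbound
  rcases (Real.sqrt_nonneg (∑' k, ‖u n k‖ ^ 2)).eq_or_lt with hzero | hpos
  · rw [← hzero]
    positivity
  refine le_of_mul_le_mul_right ?_ hpos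
  calc √(∑' k, ‖u n k‖ ^ 2) * √(∑' k, ‖u n k‖ ^ 2) = ∑' k, ‖u n k‖ ^ 2 :=
        Real.mul_self_sqrt (tsum_nonneg fun _ => sq_nonneg _)
    _ ≤ replacementConst w * lam ε ^ 2 * n ^ 2 *
          (√(∑' k, ‖ψ n k‖ ^ 2) * √(∑' k, ‖u n k‖ ^ 2)) := by
        refine hle.trans ?_
        gcongr
    _ = _ := by ring

theorem memFock_and_fockNorm_sandwich_le (hw : w ≠ 0) (hε₀ : 0 < ε) (hε₁ : ε < 1) {n : ℕ}
    {ψ : Family} (hψ : ∀ m, IsKernel m (ψ m)) (hc : InChaos n ψ) :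
    MemFock (invSqrtNegL0 (replacementOp ε w (invSqrtNegL0 ψ))) ∧
      fockNorm (invSqrtNegL0 (replacementOp ε w (invSqrtNegL0 ψ))) ≤
        replacementConst w * lam ε ^ 2 * (n : ℝ) ^ 2 * fockNorm ψ := by
  have hchaos : InChaos n (invSqrtNegL0 (replacementOp ε w (invSqrtNegL0 ψ))) :=
    inChaos_invSqrtNegL0 (inChaos_replacementOp hε₀ w (inChaos_invSqrtNegL0 hc))
  refine ⟨memFock_of_inChaos hchaos fun m => isKernel_invSqrtNegL0
    (isKernel_replacementOp hε₀ hw (isKernel_invSqrtNegL0 (hψ m))), ?_⟩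
  rw [fockNorm_of_inChaos hchaos, fockNorm_of_inChaos hc, mul_left_comm]
  gcongr
  exact sqrt_tsum_norm_sq_sandwich_le hw hε₀ hε₁ (hψ n)

end Fock

end Burgers2D

end

theorem lemma4p2 (w : EuclideanSpace ℝ (Fin 2)) (hw : w ≠ 0) :
    ∃ C : ℝ, 0 < C ∧ ∀ ε : ℝ, 0 < ε → ε < 1 →
      (∀ ψ₁ ψ₂ : Family, MemFock ψ₁ → MemFock ψ₂ →
        MemFock (number (sqrtNegL0 ψ₁)) → MemFock (number (sqrtNegL0 ψ₂)) →
        (∀ n, IsKernel n (replacementOp ε w ψ₁ n)) ∧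
        (Summable fun n : ℕ => (n.factorial : ℝ) *
          ‖∑' k, replacementOp ε w ψ₁ n k * (starRingEnd ℂ) (ψ₂ n k)‖) ∧
        ‖fockInner (replacementOp ε w ψ₁) ψ₂‖ ≤
          C * lam ε ^ 2 * fockNorm (number (sqrtNegL0 ψ₁)) * fockNorm (number (sqrtNegL0 ψ₂))) ∧
      (∀ n : ℕ, 1 ≤ n → ∀ ψ : Family, MemFock ψ → InChaos n ψ →
        MemFock (invSqrtNegL0 (replacementOp ε w (invSqrtNegL0 ψ))) ∧
        fockNorm (invSqrtNegL0 (replacementOp ε w (invSqrtNegL0 ψ))) ≤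
          C * lam ε ^ 2 * (n : ℝ) ^ 2 * fockNorm ψ) := by
  refine ⟨replacementConst w, replacementConst_pos hw, fun ε hε₀ hε₁ =>
    ⟨fun ψ₁ ψ₂ h₁ h₂ hd₁ hd₂ => ⟨fun n => ?_, ?_⟩, fun n _ ψ hψ hc => ?_⟩⟩
  · exact isKernel_replacementOp hε₀ hw (h₁.kernel n)
  · exact summable_and_norm_fockInner_replacementOp_le hw hε₀ hε₁ h₁ h₂ hd₁ hd₂
  · exact memFock_and_fockNorm_sandwich_le hw hε₀ hε₁ hψ.kernel hc
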